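/- Let $d\ge 2$ and let $\mathbb{H}^d$ be the $d$-dimensional hyperbolic space of constant sectional curvature $-1$, realised as the upper half-space $\{x\in\mathbb{R}^d : x_d>0\}$ with distance $d_1(x,y)=\operatorname{arcosh}\bigl(1+\tfrac{|x-y|^2}{2x_dy_d}\bigr)$, where $|\cdot|$ is the Euclidean norm, and with the hyperbolic volume $\mathcal{H}^d_1(\mathrm{d}x)=x_d^{-d}\,\mathrm{d}x$ (which is the $d$-dimensional Hausdorff measure of $d_1$). Fix a point $o\in\mathbb{H}^d$, let $B^d(o,R)$ be the open ball of radius $R$ around $o$, and put $V_1(R)=\mathcal{H}^d_1(B^d(o,R))$. For $\gamma>0$ let $\eta$ be a stationary Poisson process on $\mathbb{H}^d$ with intensity $\gamma$, i.e. a random locally finite subset of $\mathbb{H}^d$ such that for every Borel set $B$ the number of points of $\eta$ in $B$ is Poisson distributed with mean $\gamma\mathcal{H}^d_1(B)$ (almost surely infinite if $\mathcal{H}^d_1(B)=\infty$), and such that the numbers of points in finitely many pairwise disjoint Borel sets are independent. For $x\in\eta\setminus\{o\}$ let $n(x,\eta)$ be the radial nearest neighbour of $x$, i.e. a point of $\eta\cup\{o\}$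 that minimises the distance to $x$ among all $y\in\eta\cup\{o\}$ with $d_1(o,y)<d_1(o,x)$. For $\alpha>0$ and $R>0$ consider the edge-length functional $$\mathcal{L}^{(\alpha)}_{R,\gamma,1}=\sum_{x\in\eta\cap B^d(o,R)} d_1(x,n(x,\eta))^{\alpha}$$ (a point of $\eta$ at $o$, which almost surely does not exist, contributes $0$). Let $\alpha>0$ and $c_0>0$. Then there are constants $c_\ell,c_u>0$ and $r_0>0$, depending only on $d$, $\alpha$ and $c_0$, such that for all $\gamma\ge c_0$ and all $R\ge r_0$ the random variable $\mathcal{L}^{(\alpha)}_{R,\gamma,1}$ is square integrable and $$c_\ell\,\gamma^{1-2\alpha/d}\,V_1(R)\;\le\;\operatorname{Var}\bigl[\mathcal{L}^{(\alpha)}_{R,\gamma,1}\bigr]\;\le\;c_u\,\gamma^{1-2\alpha/d}\,V_1(R).$$ -/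

import Mathlib

open MeasureTheory ProbabilityTheory Topology

noncomputable section

/-- The upper half-space model of the `d`-dimensional hyperbolic space of curvature `-1`: the points
of `ℝ^d` whose last coordinate is positive. -/
@[ext]
structure HypSpace (d : ℕ) [NeZero d] where
  /-- the underlying point of `ℝ^d` -/
  coord : EuclideanSpace ℝ (Fin d)
  pos : 0 < coord ⊤

namespace HypSpace

variable {d : ℕ} [NeZero d]

/-- The last coordinate. -/
def height (x : HypSpace d) : ℝ := x.coord ⊤

theorem height_pos (x : HypSpace d) : 0 < x.height := x.pos

/-- The hyperbolic distance `arcosh (1 + |x - y|² / (2 x_d y_d))`, with `|·|` the Euclidean norm. -/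
instance : Dist (HypSpace d) :=
  ⟨fun x y => Real.arcosh (1 + ‖x.coord - y.coord‖ ^ 2 / (2 * x.height * y.height))⟩

theorem dist_def (x y : HypSpace d) :
    dist x y = Real.arcosh (1 + ‖x.coord - y.coord‖ ^ 2 / (2 * x.height * y.height)) := rfl

theorem one_le_arg (x y : HypSpace d) :
    1 ≤ 1 + ‖x.coord - y.coord‖ ^ 2 / (2 * x.height * y.height) := by
  have := x.height_pos
  have := y.height_pos
  have : 0 ≤ ‖x.coord - y.coord‖ ^ 2 / (2 * x.height * y.height) := by positivity
  linarith

theorem dist_nonneg_aux (x y : HypSpace d) : 0 ≤ dist x y :=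
  Real.arcosh_nonneg (one_le_arg x y)

theorem cosh_dist (x y : HypSpace d) :
    Real.cosh (dist x y) = 1 + ‖x.coord - y.coord‖ ^ 2 / (2 * x.height * y.height) :=
  Real.cosh_arcosh (one_le_arg x y)

theorem sinh_half_dist (x y : HypSpace d) :
    Real.sinh (dist x y / 2) =
      ‖x.coord - y.coord‖ / (2 * (√x.height * √y.height)) := by
  have hx := x.height_pos
  have hy := y.height_pos
  have h0 : 0 ≤ Real.sinh (dist x y / 2) :=
    Real.sinh_nonneg_iff.2 (by have := dist_nonneg_aux x y; linarith)
  rw [← sq_eq_sq₀ h0 (by positivity), div_pow, mul_pow, mul_pow, Real.sq_sqrt hx.le,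
    Real.sq_sqrt hy.le]
  have h1 := cosh_dist x y
  have h2 : Real.cosh (dist x y) = 1 + 2 * Real.sinh (dist x y / 2) ^ 2 := by
    have h3 := Real.cosh_two_mul (dist x y / 2)
    rw [mul_div_cancel₀ _ (two_ne_zero' ℝ), Real.cosh_sq] at h3
    linarith
  have h4 : ‖x.coord - y.coord‖ ^ 2 / (2 ^ 2 * (x.height * y.height)) =
      (‖x.coord - y.coord‖ ^ 2 / (2 * x.height * y.height)) / 2 := by
    field_simp
    try norm_num
  rw [h4]
  linarith

/-- The mirror image of a point in the boundary hyperplane. -/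
def mirror (x : HypSpace d) : EuclideanSpace ℝ (Fin d) :=
  x.coord - EuclideanSpace.single ⊤ (2 * x.height)

theorem norm_sub_mirror_sq (x y : HypSpace d) :
    ‖x.coord - y.mirror‖ ^ 2 = ‖x.coord - y.coord‖ ^ 2 + 4 * (x.height * y.height) := by
  have h : x.coord - y.mirror =
      (x.coord - y.coord) + EuclideanSpace.single ⊤ (2 * y.height) := by
    simp only [mirror]; abel
  rw [h, norm_add_sq_real, EuclideanSpace.inner_single_right, EuclideanSpace.single,
    PiLp.norm_single]
  simp only [height, Real.norm_eq_abs, sq_abs, PiLp.sub_apply, conj_trivial]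
  ring

theorem cosh_half_dist (x y : HypSpace d) :
    Real.cosh (dist x y / 2) =
      ‖x.coord - y.mirror‖ / (2 * (√x.height * √y.height)) := by
  have hx := x.height_pos
  have hy := y.height_pos
  rw [← sq_eq_sq₀ (Real.cosh_pos _).le (by positivity), Real.cosh_sq, sinh_half_dist, div_pow,
    div_pow, norm_sub_mirror_sq, mul_pow, mul_pow, Real.sq_sqrt hx.le, Real.sq_sqrt hy.le]
  field_simp
  ring

theorem norm_sub_mirror_comm (x y : HypSpace d) :
    ‖x.coord - y.mirror‖ = ‖y.coord - x.mirror‖ := by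
  rw [← sq_eq_sq₀ (norm_nonneg _) (norm_nonneg _), norm_sub_mirror_sq, norm_sub_mirror_sq,
    norm_sub_rev, mul_comm x.height]

theorem norm_self_sub_mirror (x : HypSpace d) : ‖x.coord - x.mirror‖ = 2 * x.height := by
  have hx := x.height_pos
  rw [← sq_eq_sq₀ (norm_nonneg _) (by positivity), norm_sub_mirror_sq]
  simp
  ring

theorem dist_triangle_aux (x y z : HypSpace d) : dist x z ≤ dist x y + dist y z := by
  have hx := Real.sqrt_pos.2 x.height_pos
  have hy := Real.sqrt_pos.2 y.height_pos
  have hz := Real.sqrt_pos.2 z.height_pos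
  have hP := EuclideanGeometry.mul_dist_le_mul_dist_add_mul_dist x.coord y.coord z.coord y.mirror
  simp only [dist_eq_norm] at hP
  rw [norm_self_sub_mirror, norm_sub_mirror_comm z y] at hP
  have hle : Real.sinh (dist x z / 2) ≤ Real.sinh (dist x y / 2 + dist y z / 2) := by
    rw [Real.sinh_add, sinh_half_dist, sinh_half_dist, sinh_half_dist, cosh_half_dist,
      cosh_half_dist, div_mul_div_comm, div_mul_div_comm,
      show 2 * (√x.height * √y.height) * (2 * (√y.height * √z.height)) =
        2 * (√x.height * √z.height) * (2 * (√y.height * √y.height)) by ring,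
      Real.mul_self_sqrt y.height_pos.le, ← add_div]
    have := y.height_pos
    rw [div_le_div_iff₀ (by positivity) (by positivity)]
    have h2 : 0 ≤ 2 * (√x.height * √z.height) := by positivity
    nlinarith [mul_le_mul_of_nonneg_left hP h2]
  have := Real.sinh_le_sinh.1 hle
  linarith

/-- The metric space structure, with a topology still to be compared with the Euclidean one. -/
@[reducible]
def metricSpaceAux : MetricSpace (HypSpace d) where
  dist := dist
  dist_self x := by simp [dist_def]
  dist_comm x y := by
    rw [dist_def, dist_def, norm_sub_rev, mul_assoc, mul_assoc, mul_comm x.height]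
  dist_triangle := dist_triangle_aux
  eq_of_dist_eq_zero {x y} h := by
    have h1 := sinh_half_dist x y
    have hx := Real.sqrt_pos.2 x.height_pos
    have hy := Real.sqrt_pos.2 y.height_pos
    rw [h, zero_div, Real.sinh_zero, eq_comm, div_eq_zero_iff] at h1
    rcases h1 with h1 | h1
    · exact HypSpace.ext (sub_eq_zero.1 (norm_eq_zero.1 h1))
    · exact absurd h1 (by positivity)

theorem norm_sub_le (x y : HypSpace d) :
    ‖x.coord - y.coord‖ ≤ 4 * Real.sinh (dist x y / 2) ^ 2 * y.height +
      2 * Real.sinh (dist x y / 2) * y.height := by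
  have hx := x.height_pos
  have hy := y.height_pos
  have hs := sinh_half_dist x y
  have h0 : 0 ≤ Real.sinh (dist x y / 2) :=
    Real.sinh_nonneg_iff.2 (by have := dist_nonneg_aux x y; linarith)
  have he := norm_nonneg (x.coord - y.coord)
  have hxy : x.height ≤ y.height + ‖x.coord - y.coord‖ := by
    have := PiLp.norm_apply_le (x.coord - y.coord) ⊤
    have := (le_abs_self _).trans this
    simp only [PiLp.sub_apply] at this
    simp only [height]
    linarith
  have hsq : ‖x.coord - y.coord‖ ^ 2 =
      4 * Real.sinh (dist x y / 2) ^ 2 * (x.height * y.height) := by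
    rw [hs, div_pow, mul_pow, mul_pow, Real.sq_sqrt hx.le, Real.sq_sqrt hy.le]
    field_simp
    norm_num
  set s := Real.sinh (dist x y / 2)
  set e := ‖x.coord - y.coord‖
  by_contra! hlt
  have h1 : e ^ 2 ≤ 4 * s ^ 2 * ((y.height + e) * y.height) := by
    rw [hsq]; gcongr
  have hA : 0 ≤ 4 * s ^ 2 * y.height := by positivity
  have hB : 0 ≤ 2 * s * y.height := by positivity
  nlinarith [mul_nonneg hA hB, mul_nonneg he hB]

theorem continuous_coord_aux :
    @Continuous (HypSpace d) _ metricSpaceAux.toUniformSpace.toTopologicalSpace _ coord := by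
  let := metricSpaceAux (d := d)
  rw [continuous_iff_continuousAt]
  intro y
  rw [ContinuousAt, tendsto_iff_norm_sub_tendsto_zero]
  have hc : Continuous fun x : HypSpace d =>
      4 * Real.sinh (dist x y / 2) ^ 2 * y.height + 2 * Real.sinh (dist x y / 2) * y.height := by
    have : Continuous fun x : HypSpace d => Real.sinh (dist x y / 2) :=
      Real.continuous_sinh.comp ((continuous_id.dist continuous_const).div_const 2)
    fun_prop
  refine squeeze_zero (fun _ => norm_nonneg _) (fun x => norm_sub_le x y) ?_
  have := hc.tendsto y
  simpa using this

/-- The topology of the half-space as a subset of `ℝ^d`. -/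
instance : TopologicalSpace (HypSpace d) := TopologicalSpace.induced coord inferInstance

theorem continuous_coord : Continuous (coord : HypSpace d → _) := continuous_induced_dom

theorem continuous_height : Continuous (height : HypSpace d → ℝ) :=
  (EuclideanSpace.proj (𝕜 := ℝ) (⊤ : Fin d)).continuous.comp continuous_coord

/-- The hyperbolic metric; its topology is definitionally the Euclidean one. -/
instance : MetricSpace (HypSpace d) :=
  metricSpaceAux.replaceTopology <| by
    refine le_antisymm (continuous_id_iff_le.1 ?_) ?_
    · refine (@continuous_iff_continuous_dist (HypSpace d) (HypSpace d)
        metricSpaceAux.toPseudoMetricSpace _ _).2 ?_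
      change Continuous fun p : HypSpace d × HypSpace d =>
        Real.arcosh (1 + ‖p.1.coord - p.2.coord‖ ^ 2 / (2 * p.1.height * p.2.height))
      refine Real.continuousOn_arcosh.comp_continuous ?_ fun p => one_le_arg p.1 p.2
      refine continuous_const.add (Continuous.div ?_ ?_ ?_)
      · exact ((continuous_coord.comp continuous_fst).sub
          (continuous_coord.comp continuous_snd)).norm.pow 2
      · exact (continuous_const.mul (continuous_height.comp continuous_fst)).mul
          (continuous_height.comp continuous_snd)
      · intro p
        have := p.1.height_pos
        have := p.2.height_pos
        positivity
    · exact continuous_iff_le_induced.1 continuous_coord_aux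

instance : MeasurableSpace (HypSpace d) := borel _

instance : BorelSpace (HypSpace d) := ⟨rfl⟩

/-- The hyperbolic volume, i.e. the Riemannian volume of the metric
`(dx_1² + ⋯ + dx_d²) / x_d²`: it has the density `x_d^{-d}` with respect to Lebesgue measure on the
half-space. It coincides with the (normalised) `d`-dimensional Hausdorff measure. -/
def hypVolume (d : ℕ) [NeZero d] : Measure (HypSpace d) :=
  ((volume : Measure (EuclideanSpace ℝ (Fin d))).comap coord).withDensity
    fun x => ENNReal.ofReal ((x.height ^ d)⁻¹)

/-- The hyperbolic volume of the open ball of radius `R` around `o`. -/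
def ballVolume (o : HypSpace d) (R : ℝ) : ℝ := (hypVolume d).real (Metric.ball o R)

end HypSpace

/-- A Poisson process on `X` with intensity measure `μ`: a random locally finite subset `η` of `X`
(a bounded set contains finitely many of its points) such that the number of points in a Borel set
`B` has the Poisson distribution with mean `μ B` (and is almost surely infinite if `μ B = ∞`), and
such that the numbers of points in disjoint Borel sets are independent. -/
structure IsPoissonProcess {Ω X : Type*} [MeasurableSpace Ω] [MetricSpace X] [MeasurableSpace X]
    (P : Measure Ω) (η : Ω → Set X) (μ : Measure X) : Prop where
  locallyFinite : ∀ ω, ∀ s : Set X, Bornology.IsBounded s → (η ω ∩ s).Finite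
  measurable_count : ∀ B : Set X, MeasurableSet B → Measurable fun ω => (η ω ∩ B).encard
  count_law : ∀ B : Set X, MeasurableSet B → μ B ≠ ⊤ →
    P.map (fun ω => (η ω ∩ B).encard) =
      (poissonMeasure (μ B).toNNReal).map (fun k : ℕ => (k : ℕ∞))
  count_top : ∀ B : Set X, MeasurableSet B → μ B = ⊤ → ∀ᵐ ω ∂P, (η ω ∩ B).encard = ⊤
  indep : ∀ (k : ℕ) (B : Fin k → Set X), (∀ i, MeasurableSet (B i)) →
    Pairwise (fun i j => Disjoint (B i) (B j)) →
    iIndepFun (fun i ω => (η ω ∩ B i).encard) P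

section RadialSpanningTree

variable {X : Type*} [MetricSpace X]

/-- `y` is a radial nearest neighbour of `x`: a point of `ξ ∪ {o}` strictly closer to `o` than `x`
and, among all such points, one with minimal distance to `x`. -/
def IsRadialNearest (o : X) (ξ : Set X) (x y : X) : Prop :=
  (y ∈ ξ ∪ {o} ∧ dist o y < dist o x) ∧
    ∀ z ∈ ξ ∪ {o}, dist o z < dist o x → dist x y ≤ dist x z

open Classical in
/-- The radial nearest neighbour `n(x, ξ)`. The default value `o` is only taken at `x = o` if `ξ` is
locally finite. -/
def radialNearest (o : X) (ξ : Set X) (x : X) : X :=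
  if h : ∃ y, IsRadialNearest o ξ x y then h.choose else o

/-- `ℓ(x, ξ)`, the distance of `x` to its radial nearest neighbour, which is the length of the edge
of the radial spanning tree that leads from `x` towards the root `o`. -/
def radialEdgeLength (o : X) (ξ : Set X) (x : X) : ℝ := dist x (radialNearest o ξ x)

/-- The edge-length functional: the sum of `ℓ(x, ξ) ^ α` over the points `x` of `ξ` in the open ball
of radius `R` around `o` (a finite sum if `ξ` is locally finite). -/
def edgeLengthFunctional (o : X) (α R : ℝ) (ξ : Set X) : ℝ :=
  ∑ᶠ x ∈ ξ ∩ Metric.ball o R, radialEdgeLength o ξ x ^ α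

end RadialSpanningTree

end

/-!
Choose `ρ` with `γ * ρ ^ d = β` constant and divide the ball into cells of size `ρ`, each of which
contains a bounded mean number of points.

For the upper bound, an edge that starts in a cell and is long forces a ball of comparable radius to
be free of points. Hence the contribution of a cell to the functional agrees with a function of the
process near that cell, unless a void occurs whose probability is exponentially small in the volume
of such a ball. So the covariances of the contributions decay fast enough in the distance of the
cells to beat the growth of the volume, and the variance is at most a constant times `ρ ^ (2 * α)`
for each cell.

For the lower bound, place a fork at each point of a separated net: two clusters of points, close to
the start of an edge and both able to receive its end. The edge becomes longer only if both clusters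
are removed, so the second difference of the functional under removal of the clusters is positive,
and the functional has covariance at least a constant times `ρ ^ α` with the product of the two
centred void indicators. These test functions are independent for different points of the net, so
each of them contributes a constant times `ρ ^ (2 * α)` to the variance.
-/

noncomputable section

section HyperbolicFunctions

theorem cosh_le_one_add_of_sq_le_two {s : ℝ} (hs : s ^ 2 ≤ 2) :
    Real.cosh s ≤ 1 + s ^ 2 / 2 * (1 + s ^ 2 / 2) := by
  refine (Real.cosh_le_exp_half_sq s).trans ?_
  have h := Real.abs_exp_sub_one_sub_id_le (x := s ^ 2 / 2)
    (by rw [abs_of_nonneg (by positivity)]; linarith)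
  linarith [(abs_le.1 h).2]

theorem one_add_sq_div_two_le_cosh (s : ℝ) : 1 + s ^ 2 / 2 ≤ Real.cosh s := by
  have h := Real.cosh_two_mul (s / 2)
  rw [mul_div_cancel₀ _ (two_ne_zero' ℝ), Real.cosh_sq] at h
  have h2 : |s / 2| ≤ |Real.sinh (s / 2)| := by
    rw [Real.abs_sinh]
    exact Real.self_le_sinh_iff.2 (abs_nonneg _)
  linarith [sq_le_sq.2 h2]

theorem sinh_sq_le_mul_sq {s : ℝ} (hs : 0 ≤ s) (hs' : s ≤ 1 / 2) :
    Real.sinh s ^ 2 ≤ 49 / 40 * s ^ 2 := by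
  have h2 : s ^ 2 ≤ 1 / 4 := by nlinarith
  have h1 := cosh_le_one_add_of_sq_le_two (s := s) (by linarith)
  have h3 : Real.cosh s ≤ 1 + 9 / 16 * s ^ 2 := by nlinarith [sq_nonneg s]
  rw [Real.sinh_sq]
  nlinarith [sq_nonneg s, Real.one_le_cosh s]

theorem cosh_mul_le_one_add_sinh_sq {s : ℝ} (hs : 0 ≤ s) (hs' : s ≤ 1 / 2) :
    Real.cosh (11 / 10 * s) ≤ 1 + 18 / 25 * Real.sinh s ^ 2 := by
  have h2 : s ^ 2 ≤ 1 / 4 := by nlinarith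
  have h1 := cosh_le_one_add_of_sq_le_two (s := 11 / 10 * s) (by nlinarith)
  have h3 : s ^ 2 ≤ Real.sinh s ^ 2 := by
    gcongr
    exact Real.self_le_sinh_iff.2 hs
  nlinarith [sq_nonneg s]

theorem one_add_sinh_sq_le_cosh_mul {s : ℝ} (hs : 0 ≤ s) (hs' : s ≤ 1 / 2) :
    1 + 1 / 5 * Real.sinh s ^ 2 ≤ Real.cosh (7 / 10 * s) := by
  linarith [sinh_sq_le_mul_sq hs hs', one_add_sq_div_two_le_cosh (7 / 10 * s)]

theorem cosh_le_cosh_iff_of_nonneg {s r : ℝ} (hs : 0 ≤ s) (hr : 0 ≤ r) :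
    Real.cosh s ≤ Real.cosh r ↔ s ≤ r :=
  Real.cosh_strictMonoOn.le_iff_le hs hr

theorem sinh_le_mul_exp (s : ℝ) : Real.sinh s ≤ s * Real.exp s := by
  have h1 := Real.add_one_le_exp (-2 * s)
  have h2 : Real.exp (-s) = Real.exp s * Real.exp (-2 * s) := by rw [← Real.exp_add]; ring_nf
  rw [Real.sinh_eq, h2]
  nlinarith [Real.exp_pos s]

theorem pow_div_factorial_le_two_mul_sinh {s : ℝ} (hs : 0 ≤ s) {n : ℕ} (hn : n ≠ 0) :
    s ^ n / n.factorial ≤ 2 * Real.sinh s := by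
  have hexp := Real.sum_le_exp_of_nonneg hs (n + 1)
  rw [Finset.sum_range_succ] at hexp
  have hone : (1 : ℝ) ≤ ∑ i ∈ Finset.range n, s ^ i / (i.factorial : ℝ) := by
    simpa using Finset.single_le_sum (f := fun i : ℕ => s ^ i / (i.factorial : ℝ))
      (fun i _ => by positivity) (Finset.mem_range.2 (Nat.pos_of_ne_zero hn))
  have : Real.exp (-s) ≤ 1 := Real.exp_le_one_iff.2 (by linarith)
  rw [Real.sinh_eq]
  linarith

end HyperbolicFunctions

section UnitVectors

variable {E : Type*} [NormedAddCommGroup E] [InnerProductSpace ℝ E]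

theorem exists_norm_eq_one_inner_eq_zero [FiniteDimensional ℝ E]
    (hE : 2 ≤ Module.finrank ℝ E) (n : E) :
    ∃ e : E, ‖e‖ = 1 ∧ inner ℝ n e = 0 := by
  have hne : (Submodule.span ℝ {n})ᗮ ≠ ⊥ := by
    intro h
    have h1 : Module.finrank ℝ (Submodule.span ℝ {n}) ≤ 1 :=
      (finrank_span_le_card _).trans (by simp)
    have h2 := Submodule.finrank_add_finrank_orthogonal (Submodule.span ℝ {n})
    rw [h, finrank_bot] at h2
    omega
  obtain ⟨e, he, he0⟩ := Submodule.exists_mem_ne_zero_of_ne_bot hne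
  refine ⟨‖e‖⁻¹ • e, norm_smul_inv_norm he0, ?_⟩
  rw [inner_smul_right, Submodule.mem_orthogonal_singleton_iff_inner_right.1 he, mul_zero]

theorem exists_unit_vectors_inner_eq [FiniteDimensional ℝ E] (hE : 2 ≤ Module.finrank ℝ E) {n : E}
    (hn : ‖n‖ = 1) :
    ∃ v v' : E, ‖v‖ = 1 ∧ ‖v'‖ = 1 ∧ inner ℝ v n = (4 / 5 : ℝ) ∧
      inner ℝ v' n = (4 / 5 : ℝ) ∧ inner ℝ v v' = (7 / 25 : ℝ) := by
  obtain ⟨e, he, hne⟩ := exists_norm_eq_one_inner_eq_zero hE n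
  have hen : inner ℝ e n = 0 := by rw [real_inner_comm, hne]
  have hnn : inner ℝ n n = 1 := inner_self_eq_one_of_norm_eq_one hn
  have hee : inner ℝ e e = 1 := inner_self_eq_one_of_norm_eq_one he
  refine ⟨(4 / 5 : ℝ) • n + (3 / 5 : ℝ) • e, (4 / 5 : ℝ) • n - (3 / 5 : ℝ) • e, ?_, ?_, ?_, ?_, ?_⟩
  all_goals
    try rw [← sq_eq_sq₀ (norm_nonneg _) zero_le_one, ← real_inner_self_eq_norm_sq]
    simp only [inner_add_left, inner_sub_left, inner_add_right, inner_sub_right, inner_smul_left,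
      inner_smul_right, conj_trivial, hnn, hee, hne, hen]
    norm_num1

theorem exists_norm_eq_one_smul_eq [Nontrivial E] (v : E) : ∃ n : E, ‖n‖ = 1 ∧ ‖v‖ • n = v := by
  by_cases hv : v = 0
  · obtain ⟨n, hn⟩ := exists_norm_eq E zero_le_one
    exact ⟨n, hn, by rw [hv, norm_zero, zero_smul]⟩
  · exact ⟨‖v‖⁻¹ • v, norm_smul_inv_norm hv,
      smul_inv_smul₀ (norm_ne_zero_iff.2 hv) v⟩

end UnitVectors

namespace HypSpace

variable {d : ℕ} [NeZero d]

/-! ### Geodesic polar coordinates -/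

/-- The chart of hyperbolic space given by the hyperboloid model with apex at `z`: the spacelike
part of the hyperboloid coordinates of `x`, the timelike one being `cosh (dist x z)`. -/
def chart (z x : HypSpace d) : EuclideanSpace ℝ (Fin d) :=
  x.height⁻¹ • (x.coord - z.coord) + EuclideanSpace.single ⊤ (Real.cosh (dist x z) - 1)

theorem inner_chart (z x y : HypSpace d) :
    inner ℝ (chart z x) (chart z y) =
      Real.cosh (dist x z) * Real.cosh (dist y z) - Real.cosh (dist x y) := by
  have hx := x.height_pos
  have hy := y.height_pos
  have hz := z.height_pos
  have hxy : x.coord - y.coord = (x.coord - z.coord) - (y.coord - z.coord) := by abel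
  have hxtop : (x.coord - z.coord).ofLp ⊤ = x.height - z.height := rfl
  have hytop : (y.coord - z.coord).ofLp ⊤ = y.height - z.height := rfl
  simp only [chart, inner_add_left, inner_add_right, inner_smul_left, inner_smul_right,
    EuclideanSpace.inner_single_left, EuclideanSpace.inner_single_right, conj_trivial,
    hxtop, hytop, PiLp.single_apply, if_true]
  rw [cosh_dist x z, cosh_dist y z, cosh_dist x y, hxy, norm_sub_sq_real (x.coord - z.coord)]
  field_simp
  ring

theorem norm_chart (z x : HypSpace d) : ‖chart z x‖ = Real.sinh (dist x z) := by
  rw [← sq_eq_sq₀ (norm_nonneg _) (Real.sinh_nonneg_iff.2 dist_nonneg),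
    ← real_inner_self_eq_norm_sq, inner_chart, dist_self, Real.cosh_zero, Real.sinh_sq]
  ring

theorem chart_injective (z : HypSpace d) : Function.Injective (chart z) := by
  intro x y hxy
  have hdist : dist x z = dist y z := by
    rw [← Real.sinh_inj, ← norm_chart, ← norm_chart, hxy]
  have hcosh : Real.cosh (dist x y) = Real.cosh 0 := by
    have h := inner_chart z x y
    rw [hxy, real_inner_self_eq_norm_sq, norm_chart, Real.sinh_sq, hdist] at h
    rw [Real.cosh_zero]
    linarith
  exact dist_eq_zero.1 (Real.cosh_injOn dist_nonneg (Set.mem_Ici.2 le_rfl) hcosh)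

theorem chart_surjective (z : HypSpace d) : Function.Surjective (chart z) := by
  intro v
  -- `c` is the timelike coordinate of the point sought, and `h` its height
  obtain ⟨c, hc⟩ : ∃ c, c = √(1 + ‖v‖ ^ 2) := ⟨_, rfl⟩
  have hc2 : ‖v‖ ^ 2 = c ^ 2 - 1 := by rw [hc, Real.sq_sqrt (by positivity)]; ring
  have hcv : 0 < c - v ⊤ := by
    have hvt : v ⊤ ≤ ‖v‖ := (le_abs_self _).trans (PiLp.norm_apply_le v ⊤)
    have : ‖v‖ < c := by
      rw [hc]
      exact Real.lt_sqrt_of_sq_lt (by linarith)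
    linarith
  obtain ⟨h, hh⟩ : ∃ h, h = z.height / (c - v ⊤) := ⟨_, rfl⟩
  have hhpos : 0 < h := hh ▸ div_pos z.height_pos hcv
  have hhz : h * (c - v ⊤) = z.height := by rw [hh]; field_simp
  let p : EuclideanSpace ℝ (Fin d) := z.coord + h • (v - EuclideanSpace.single ⊤ (c - 1))
  have htop : p ⊤ = h := by
    simp only [p, PiLp.add_apply, PiLp.smul_apply, PiLp.sub_apply, PiLp.single_apply,
      if_true, smul_eq_mul, show z.coord ⊤ = z.height from rfl]
    linarith
  let x : HypSpace d := ⟨p, htop ▸ hhpos⟩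
  have hx : x.height = h := htop
  have hcosh : Real.cosh (dist x z) = c := by
    rw [cosh_dist, hx, show x.coord - z.coord = h • (v - EuclideanSpace.single ⊤ (c - 1)) from
      add_sub_cancel_left _ _, norm_smul, mul_pow, norm_sub_sq_real,
      EuclideanSpace.inner_single_right, EuclideanSpace.single, PiLp.norm_single]
    simp only [conj_trivial, Real.norm_eq_abs, sq_abs]
    rw [← hhz, hc2]
    field_simp
    ring
  refine ⟨x, ?_⟩
  rw [chart, hcosh, hx, show x.coord - z.coord = h • (v - EuclideanSpace.single ⊤ (c - 1)) from
    add_sub_cancel_left _ _, inv_smul_smul₀ hhpos.ne', sub_add_cancel]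

/-- The point reached from `z` after following for time `s` the unit speed geodesic with the
initial direction `v`, a unit vector. -/
def polar (z : HypSpace d) (v : EuclideanSpace ℝ (Fin d)) (s : ℝ) : HypSpace d :=
  Function.surjInv (chart_surjective z) (Real.sinh s • v)

theorem chart_polar (z : HypSpace d) (v : EuclideanSpace ℝ (Fin d)) (s : ℝ) :
    chart z (polar z v s) = Real.sinh s • v :=
  Function.surjInv_eq (chart_surjective z) _

theorem exists_eq_polar (z x : HypSpace d) : ∃ v, ‖v‖ = 1 ∧ polar z v (dist x z) = x := by
  obtain ⟨v, hv, hx⟩ := exists_norm_eq_one_smul_eq (chart z x)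
  exact ⟨v, hv, chart_injective z (by rw [chart_polar, ← norm_chart, hx])⟩

variable {z : HypSpace d} {v w : EuclideanSpace ℝ (Fin d)} {s r : ℝ}

theorem dist_polar (hv : ‖v‖ = 1) (hs : 0 ≤ s) : dist (polar z v s) z = s := by
  rw [← Real.sinh_inj, ← norm_chart, chart_polar, norm_smul, hv, mul_one,
    Real.norm_of_nonneg (Real.sinh_nonneg_iff.2 hs)]

/-- The hyperbolic law of cosines. -/
theorem cosh_dist_polar_polar (hv : ‖v‖ = 1) (hw : ‖w‖ = 1) (hs : 0 ≤ s) (hr : 0 ≤ r) :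
    Real.cosh (dist (polar z v s) (polar z w r)) =
      Real.cosh s * Real.cosh r - Real.sinh s * Real.sinh r * inner ℝ v w := by
  have h := inner_chart z (polar z v s) (polar z w r)
  rw [chart_polar, chart_polar, dist_polar hv hs, dist_polar hw hr, inner_smul_left,
    inner_smul_right, conj_trivial] at h
  linarith

theorem cosh_dist_polar_polar_of_eq_radius (hv : ‖v‖ = 1) (hw : ‖w‖ = 1) (hs : 0 ≤ s) :
    Real.cosh (dist (polar z v s) (polar z w s)) = 1 + (1 - inner ℝ v w) * Real.sinh s ^ 2 := by
  rw [cosh_dist_polar_polar hv hw hs hs]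
  linear_combination Real.cosh_sq s

theorem dist_polar_polar_of_eq_direction (hv : ‖v‖ = 1) (hs : 0 ≤ s) (hr : 0 ≤ r) :
    dist (polar z v s) (polar z v r) = |s - r| := by
  refine Real.cosh_injOn dist_nonneg (abs_nonneg (s - r)) ?_
  rw [cosh_dist_polar_polar hv hv hs hr, real_inner_self_eq_norm_sq, hv, Real.cosh_abs,
    Real.cosh_sub]
  ring

theorem exists_dist_eq (o : HypSpace d) (hs : 0 ≤ s) : ∃ x, dist x o = s := by
  obtain ⟨v, hv⟩ := exists_norm_eq (EuclideanSpace ℝ (Fin d)) zero_le_one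
  exact ⟨polar o v s, dist_polar hv hs⟩

/-- The point at distance `s` from `x` on the geodesic from `x` to `o`. -/
def towards (o x : HypSpace d) (s : ℝ) : HypSpace d := polar x (exists_eq_polar x o).choose s

theorem dist_towards (o x : HypSpace d) (hs : 0 ≤ s) : dist (towards o x s) x = s :=
  dist_polar (exists_eq_polar x o).choose_spec.1 hs

theorem dist_root_towards {o x : HypSpace d} (hs : 0 ≤ s) (hsx : s ≤ dist o x) :
    dist o (towards o x s) = dist o x - s := by
  obtain ⟨hv, ho⟩ := (exists_eq_polar x o).choose_spec
  have h := dist_polar_polar_of_eq_direction (z := x) hv dist_nonneg hs (s := dist o x)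
  rwa [ho, abs_of_nonneg (sub_nonneg.2 hsx)] at h

/-! ### The volume of balls -/

theorem coord_injective : Function.Injective (coord : HypSpace d → _) := fun _ _ => HypSpace.ext

theorem measurableEmbedding_coord : MeasurableEmbedding (coord : HypSpace d → _) := by
  have hrange : Set.range (coord : HypSpace d → _) = {x | 0 < x ⊤} :=
    Set.ext fun x => ⟨by rintro ⟨y, rfl⟩; exact y.pos, fun h => ⟨⟨x, h⟩, rfl⟩⟩
  have hopen : IsOpenEmbedding (coord : HypSpace d → _) :=
    ⟨⟨⟨rfl⟩, coord_injective⟩, hrange ▸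
      isOpen_lt continuous_const (EuclideanSpace.proj (𝕜 := ℝ) (⊤ : Fin d)).continuous⟩
  exact hopen.measurableEmbedding

/-- The Euclidean centre of the hyperbolic ball of radius `s` around `z`, which is the Euclidean
ball of radius `z.height * sinh s` around this point. -/
def euclideanCenter (z : HypSpace d) (s : ℝ) : EuclideanSpace ℝ (Fin d) :=
  z.coord + EuclideanSpace.single ⊤ (z.height * (Real.cosh s - 1))

theorem abs_sub_le_norm_sub_euclideanCenter (z : HypSpace d) (s : ℝ)
    (p : EuclideanSpace ℝ (Fin d)) :
    |p ⊤ - z.height * Real.cosh s| ≤ ‖p - euclideanCenter z s‖ := by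
  have htop : (p - euclideanCenter z s) ⊤ = p ⊤ - z.height * Real.cosh s := by
    simp only [euclideanCenter, PiLp.sub_apply, PiLp.add_apply, PiLp.single_apply, if_true, height]
    ring
  exact htop ▸ PiLp.norm_apply_le (p - euclideanCenter z s) ⊤

theorem dist_lt_iff_norm_sub_lt (z x : HypSpace d) (hs : 0 ≤ s) :
    dist x z < s ↔ ‖x.coord - euclideanCenter z s‖ < z.height * Real.sinh s := by
  have hx := x.height_pos
  have hz := z.height_pos
  have hcosh : dist x z < s ↔ Real.cosh (dist x z) < Real.cosh s :=
    (Real.cosh_strictMonoOn.lt_iff_lt dist_nonneg hs).symm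
  have hsub : x.coord - euclideanCenter z s =
      (x.coord - z.coord) - EuclideanSpace.single ⊤ (z.height * (Real.cosh s - 1)) := by
    rw [euclideanCenter]; abel
  have htop : (x.coord - z.coord).ofLp ⊤ = x.height - z.height := rfl
  rw [hcosh, ← sq_lt_sq₀ (norm_nonneg _) (mul_nonneg hz.le (Real.sinh_nonneg_iff.2 hs)), cosh_dist,
    hsub, norm_sub_sq_real (x.coord - z.coord), EuclideanSpace.inner_single_right,
    EuclideanSpace.single, PiLp.norm_single, mul_pow, Real.sinh_sq, conj_trivial, htop,
    Real.norm_eq_abs, sq_abs, ← lt_sub_iff_add_lt', div_lt_iff₀ (by positivity)]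
  constructor <;> intro h <;> nlinarith

theorem height_bounds {x : HypSpace d} (hs : 0 ≤ s) (h : dist x z < s) :
    z.height * Real.exp (-s) ≤ x.height ∧ x.height ≤ z.height * Real.exp s := by
  have habs := (abs_sub_le_norm_sub_euclideanCenter z s x.coord).trans
    ((dist_lt_iff_norm_sub_lt z x hs).1 h).le
  rw [← height, abs_le] at habs
  rw [← Real.cosh_sub_sinh, ← Real.cosh_add_sinh]
  constructor <;> linarith

theorem coord_image_ball (z : HypSpace d) (hs : 0 ≤ s) :
    coord '' Metric.ball z s = Metric.ball (euclideanCenter z s) (z.height * Real.sinh s) := by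
  ext p
  rw [mem_ball_iff_norm]
  refine ⟨?_, fun hp => ?_⟩
  · rintro ⟨x, hx, rfl⟩
    exact (dist_lt_iff_norm_sub_lt z x hs).1 hx
  · have hpos : 0 < p ⊤ := by
      have h1 := (abs_le.1 ((abs_sub_le_norm_sub_euclideanCenter z s p).trans hp.le)).1
      have h2 := mul_pos z.height_pos (Real.exp_pos (-s))
      rw [← Real.cosh_sub_sinh, mul_sub] at h2
      linarith
    exact ⟨⟨p, hpos⟩, (dist_lt_iff_norm_sub_lt z ⟨p, hpos⟩ hs).2 hp, rfl⟩

/-- The Lebesgue measure of the unit ball of `ℝ^d`. -/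
def unitBallVolume (d : ℕ) : ℝ :=
  (volume : Measure (EuclideanSpace ℝ (Fin d))).real (Metric.ball 0 1)

theorem unitBallVolume_pos (d : ℕ) : 0 < unitBallVolume d :=
  ENNReal.toReal_pos (Metric.measure_ball_pos volume _ one_pos).ne' measure_ball_lt_top.ne

theorem comap_volume_ball (z : HypSpace d) (hs : 0 ≤ s) :
    (volume : Measure (EuclideanSpace ℝ (Fin d))).comap coord (Metric.ball z s) =
      ENNReal.ofReal ((z.height * Real.sinh s) ^ d * unitBallVolume d) := by
  have hr : 0 ≤ z.height * Real.sinh s := mul_nonneg z.height_pos.le (Real.sinh_nonneg_iff.2 hs)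
  rw [measurableEmbedding_coord.comap_apply, coord_image_ball z hs, Measure.addHaar_ball _ _ hr,
    finrank_euclideanSpace_fin, ENNReal.ofReal_mul (pow_nonneg hr d), unitBallVolume,
    ofReal_measureReal measure_ball_lt_top.ne]

theorem hypVolume_ball_le (z : HypSpace d) (hs : 0 ≤ s) :
    hypVolume d (Metric.ball z s) ≤
      ENNReal.ofReal (unitBallVolume d * (s * Real.exp (2 * s)) ^ d) := by
  have hz := z.height_pos
  have := Real.sinh_nonneg_iff.2 hs
  have hunit := (unitBallVolume_pos d).le
  rw [hypVolume, withDensity_apply _ measurableSet_ball]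
  calc ∫⁻ x in Metric.ball z s, ENNReal.ofReal ((x.height ^ d)⁻¹)
        ∂(volume : Measure (EuclideanSpace ℝ (Fin d))).comap coord
      ≤ ∫⁻ _ in Metric.ball z s, ENNReal.ofReal (((z.height * Real.exp (-s)) ^ d)⁻¹)
        ∂(volume : Measure (EuclideanSpace ℝ (Fin d))).comap coord := by
        refine setLIntegral_mono measurable_const fun _ hx => ?_
        have := (height_bounds hs hx).1
        gcongr
    _ = ENNReal.ofReal (unitBallVolume d * (Real.exp s * Real.sinh s) ^ d) := by
        rw [setLIntegral_const, comap_volume_ball z hs, ← ENNReal.ofReal_mul (by positivity),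
          Real.exp_neg]
        congr 1
        simp only [mul_pow, inv_pow]
        field_simp
    _ ≤ ENNReal.ofReal (unitBallVolume d * (s * Real.exp (2 * s)) ^ d) := by
        refine ENNReal.ofReal_le_ofReal (mul_le_mul_of_nonneg_left
          (pow_le_pow_left₀ (by positivity) ?_ d) hunit)
        rw [two_mul, Real.exp_add]
        nlinarith [sinh_le_mul_exp s, Real.exp_pos s]

theorem hypVolume_ball_lt_top (z : HypSpace d) (s : ℝ) : hypVolume d (Metric.ball z s) < ⊤ := by
  rcases le_or_gt s 0 with hs | hs
  · rw [Metric.ball_eq_empty.2 hs, measure_empty]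
    exact ENNReal.zero_lt_top
  · exact (hypVolume_ball_le z hs.le).trans_lt ENNReal.ofReal_lt_top

theorem ofReal_sinh_mul_exp_neg_le_hypVolume_ball (z : HypSpace d) (hs : 0 ≤ s) :
    ENNReal.ofReal (unitBallVolume d * (Real.sinh s * Real.exp (-s)) ^ d) ≤
      hypVolume d (Metric.ball z s) := by
  have hz := z.height_pos
  rw [hypVolume, withDensity_apply _ measurableSet_ball]
  calc ENNReal.ofReal (unitBallVolume d * (Real.sinh s * Real.exp (-s)) ^ d)
      = ∫⁻ _ in Metric.ball z s, ENNReal.ofReal (((z.height * Real.exp s) ^ d)⁻¹)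
        ∂(volume : Measure (EuclideanSpace ℝ (Fin d))).comap coord := by
        rw [setLIntegral_const, comap_volume_ball z hs, ← ENNReal.ofReal_mul (by positivity),
          Real.exp_neg]
        congr 1
        simp only [mul_pow, inv_pow]
        field_simp
    _ ≤ _ := by
        refine setLIntegral_mono (ENNReal.measurable_ofReal.comp
          (continuous_height.measurable.pow_const d).inv) fun x hx => ?_
        have := (height_bounds hs hx).2
        have := x.height_pos
        gcongr

theorem ofReal_pow_le_hypVolume_ball_of_le_one (z : HypSpace d) (hs : 0 ≤ s) (hs1 : s ≤ 1) :
    ENNReal.ofReal (unitBallVolume d * (s / 8) ^ d) ≤ hypVolume d (Metric.ball z s) := by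
  refine (ENNReal.ofReal_le_ofReal ?_).trans (ofReal_sinh_mul_exp_neg_le_hypVolume_ball z hs)
  have hunit := (unitBallVolume_pos d).le
  gcongr
  have hexp : (1 / 8 : ℝ) ≤ Real.exp (-s) := by
    have h3 : Real.exp 1 < 8 := Real.exp_one_lt_three.trans (by norm_num)
    rw [Real.exp_neg, one_div]
    exact inv_anti₀ (Real.exp_pos s) ((Real.exp_le_exp.2 hs1).trans h3.le)
  have hsinh : s ≤ Real.sinh s := Real.self_le_sinh_iff.2 hs
  calc s / 8 = s * (1 / 8) := by ring
    _ ≤ Real.sinh s * Real.exp (-s) := by gcongr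

/-- Points of a horocycle through `z`, that is, points with the same height as `z`. -/
theorem exists_horocycle (hd : 2 ≤ d) (z : HypSpace d) :
    ∃ q : ℕ → HypSpace d, q 0 = z ∧
      ∀ k l, Real.sinh (dist (q k) (q l) / 2) = |(k : ℝ) - l| := by
  have hz := z.height_pos
  have : Nontrivial (Fin d) := Fin.nontrivial_iff_two_le.2 hd
  obtain ⟨i, hi⟩ := exists_ne (⊤ : Fin d)
  let p (k : ℕ) : EuclideanSpace ℝ (Fin d) :=
    z.coord + EuclideanSpace.single i (2 * z.height * k)
  have htop (k : ℕ) : p k ⊤ = z.height := by simp [p, hi.symm, height]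
  let q (k : ℕ) : HypSpace d := ⟨p k, (htop k).symm ▸ hz⟩
  have hheight (k : ℕ) : (q k).height = z.height := htop k
  refine ⟨q, by ext1; simp [q, p], fun k l => ?_⟩
  rw [sinh_half_dist, hheight, hheight, show (q k).coord - (q l).coord = p k - p l from rfl,
    add_sub_add_left_eq_sub, EuclideanSpace.single, EuclideanSpace.single, ← PiLp.single_sub,
    PiLp.norm_single, ← mul_sub, norm_mul, Real.norm_of_nonneg (by positivity),
    Real.mul_self_sqrt hz.le, Real.norm_eq_abs]
  field_simp

theorem exists_disjoint_balls_subset_ball (hd : 2 ≤ d) (z : HypSpace d) (hs : 1 ≤ s) :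
    ∃ q : ℕ → HypSpace d, Pairwise (fun k l => Disjoint (Metric.ball (q k) (1 / 2))
        (Metric.ball (q l) (1 / 2))) ∧
      ∀ k : ℕ, k ≤ Real.sinh (s / 4) → Metric.ball (q k) (1 / 2) ⊆ Metric.ball z s := by
  obtain ⟨q, hq0, hq⟩ := exists_horocycle hd z
  refine ⟨q, fun k l hkl => Metric.ball_disjoint_ball ?_, fun k hk => Metric.ball_subset_ball' ?_⟩
  · by_contra! hlt
    have hsinh : Real.sinh (dist (q k) (q l) / 2) < 1 := by
      refine (Real.sinh_lt_sinh.2 (show _ < (1 / 2 : ℝ) by linarith)).trans ?_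
      nlinarith [sinh_sq_le_mul_sq (s := 1 / 2) (by norm_num) le_rfl]
    rw [hq] at hsinh
    have hlt1 : |(k : ℤ) - l| < 1 := by exact_mod_cast hsinh
    rw [Int.abs_lt_one_iff] at hlt1
    omega
  · have hsinh : Real.sinh (dist (q k) z / 2) ≤ Real.sinh (s / 4) := by
      rwa [← hq0, hq, Nat.cast_zero, sub_zero, Nat.abs_cast]
    linarith [Real.sinh_le_sinh.1 hsinh]

/-- A constant for the lower bound `volumeGrowth d * s ^ d` of the volume of balls of radius `s`:
the first term of the minimum serves for `s ≤ 1`, the second one for `1 ≤ s`. -/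
def volumeGrowth (d : ℕ) : ℝ :=
  min (unitBallVolume d / 8 ^ d)
    (unitBallVolume d / 16 ^ d / (4 ^ d * d.factorial * 2))

theorem volumeGrowth_pos (d : ℕ) : 0 < volumeGrowth d := by
  have := unitBallVolume_pos d
  have : 0 < (d.factorial : ℝ) := by exact_mod_cast d.factorial_pos
  unfold volumeGrowth
  positivity

theorem ofReal_pow_le_hypVolume_ball_of_one_le (hd : 2 ≤ d) (z : HypSpace d) (hs : 1 ≤ s) :
    ENNReal.ofReal (volumeGrowth d * s ^ d) ≤ hypVolume d (Metric.ball z s) := by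
  obtain ⟨q, hdisj, hsub⟩ := exists_disjoint_balls_subset_ball hd z hs
  have hsinh : 0 ≤ Real.sinh (s / 4) := Real.sinh_nonneg_iff.2 (by linarith)
  set K := ⌊Real.sinh (s / 4)⌋₊
  let a : ℝ := unitBallVolume d * (1 / 2 / 8) ^ d
  have ha16 : a = unitBallVolume d / 16 ^ d := by
    rw [div_eq_mul_inv, ← inv_pow]
    norm_num [a]
  have ha : 0 ≤ a := mul_nonneg (unitBallVolume_pos d).le (by positivity)
  calc ENNReal.ofReal (volumeGrowth d * s ^ d)
      ≤ ENNReal.ofReal (a * ((s / 4) ^ d / d.factorial / 2)) := by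
        refine ENNReal.ofReal_le_ofReal ((mul_le_mul_of_nonneg_right (min_le_right _ _)
          (by positivity)).trans_eq ?_)
        rw [ha16, div_pow]
        field_simp
    _ ≤ ENNReal.ofReal ((K + 1 : ℕ) * a) := by
        rw [mul_comm]
        gcongr
        push_cast
        linarith [pow_div_factorial_le_two_mul_sinh (show 0 ≤ s / 4 by linarith) (NeZero.ne d),
          Nat.lt_floor_add_one (Real.sinh (s / 4))]
    _ = ∑ _k ∈ Finset.range (K + 1), ENNReal.ofReal a := by
        rw [Finset.sum_const, Finset.card_range, ENNReal.ofReal_mul (by positivity),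
          ENNReal.ofReal_natCast, nsmul_eq_mul]
    _ ≤ ∑ k ∈ Finset.range (K + 1), hypVolume d (Metric.ball (q k) (1 / 2)) :=
        Finset.sum_le_sum fun k _ =>
          ofReal_pow_le_hypVolume_ball_of_le_one _ (by norm_num) (by norm_num)
    _ = hypVolume d (⋃ k ∈ Finset.range (K + 1), Metric.ball (q k) (1 / 2)) :=
        (measure_biUnion_finset (hdisj.set_pairwise _) fun k _ => measurableSet_ball).symm
    _ ≤ hypVolume d (Metric.ball z s) :=
        measure_mono (Set.iUnion₂_subset fun k hk => hsub k
          ((Nat.le_floor_iff hsinh).1 (Nat.lt_succ_iff.1 (Finset.mem_range.1 hk))))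

theorem ofReal_pow_le_hypVolume_ball (hd : 2 ≤ d) (z : HypSpace d) (hs : 0 ≤ s) :
    ENNReal.ofReal (volumeGrowth d * s ^ d) ≤ hypVolume d (Metric.ball z s) := by
  rcases le_or_gt s 1 with hs1 | hs1
  · refine (ENNReal.ofReal_le_ofReal ?_).trans (ofReal_pow_le_hypVolume_ball_of_le_one z hs hs1)
    refine (mul_le_mul_of_nonneg_right (min_le_left _ _) (by positivity)).trans_eq ?_
    rw [div_pow, div_mul_eq_mul_div, mul_div_assoc]
  · exact ofReal_pow_le_hypVolume_ball_of_one_le hd z hs1.le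

section Intensity

variable {γ ρ : ℝ}

theorem hypIntensity_ball_ne_top (γ : ℝ) (z : HypSpace d) (r : ℝ) :
    (ENNReal.ofReal γ • hypVolume d) (Metric.ball z r) ≠ ⊤ := by
  rw [Measure.smul_apply, smul_eq_mul]
  exact ENNReal.mul_ne_top ENNReal.ofReal_ne_top (hypVolume_ball_lt_top _ _).ne

theorem toReal_hypIntensity_ball_le (hγ : 0 ≤ γ) (hρ : 0 ≤ ρ) (hρ1 : ρ ≤ 1) (z : HypSpace d)
    (hs : 0 ≤ s) : ((ENNReal.ofReal γ • hypVolume d) (Metric.ball z (s * ρ))).toReal ≤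
      unitBallVolume d * (γ * ρ ^ d) * (s * Real.exp (2 * s)) ^ d := by
  have hunit := (unitBallVolume_pos d).le
  have hvol := ENNReal.toReal_mono ENNReal.ofReal_ne_top (hypVolume_ball_le z (mul_nonneg hs hρ))
  rw [ENNReal.toReal_ofReal (by positivity)] at hvol
  rw [Measure.smul_apply, smul_eq_mul, ENNReal.toReal_mul, ENNReal.toReal_ofReal hγ]
  calc γ * (hypVolume d (Metric.ball z (s * ρ))).toReal
      ≤ γ * (unitBallVolume d * (s * ρ * Real.exp (2 * s)) ^ d) := by
        gcongr
        exact hvol.trans (by gcongr; exact mul_le_of_le_one_right hs hρ1)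
    _ = unitBallVolume d * (γ * ρ ^ d) * (s * Real.exp (2 * s)) ^ d := by ring

theorem le_toReal_hypIntensity_ball (hd : 2 ≤ d) (hγ : 0 ≤ γ) (hρ : 0 ≤ ρ) (z : HypSpace d)
    (hs : 0 ≤ s) : volumeGrowth d * (γ * ρ ^ d) * s ^ d ≤
      ((ENNReal.ofReal γ • hypVolume d) (Metric.ball z (s * ρ))).toReal := by
  have hgrowth := (volumeGrowth_pos d).le
  have hvol := ENNReal.toReal_mono (hypVolume_ball_lt_top _ _).ne
    (ofReal_pow_le_hypVolume_ball hd z (mul_nonneg hs hρ))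
  rw [ENNReal.toReal_ofReal (by positivity)] at hvol
  rw [Measure.smul_apply, smul_eq_mul, ENNReal.toReal_mul, ENNReal.toReal_ofReal hγ]
  calc volumeGrowth d * (γ * ρ ^ d) * s ^ d = γ * (volumeGrowth d * (s * ρ) ^ d) := by ring
    _ ≤ γ * (hypVolume d (Metric.ball z (s * ρ))).toReal := by gcongr

end Intensity

end HypSpace

section Atoms

variable {X ι : Type*} {A : ι → Set X} {B : Set X}

/-- The part of `B` whose points lie in exactly those sets `A i` for which `i ∈ t`: an atom of the
algebra of subsets of `B` generated by the family `A`. -/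
def setAtom (B : Set X) (A : ι → Set X) (t : Set ι) : Set X := {x ∈ B | {i | x ∈ A i} = t}

theorem setAtom_subset (t : Set ι) : setAtom B A t ⊆ B := fun _ hx => hx.1

theorem measurableSet_setAtom [MeasurableSpace X] [Countable ι] (hB : MeasurableSet B)
    (hA : ∀ i, MeasurableSet (A i)) (t : Set ι) : MeasurableSet (setAtom B A t) := by
  have h : setAtom B A t = B ∩ ⋂ i, {x | x ∈ A i ↔ i ∈ t} := by
    ext x
    simp [setAtom, Set.ext_iff]
  rw [h]
  exact hB.inter (.iInter fun i => (hA i).iff (.const _))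

theorem pairwise_disjoint_setAtom :
    Pairwise fun t t' : Set ι => Disjoint (setAtom B A t) (setAtom B A t') := fun _ _ htt' =>
  Set.disjoint_left.2 fun _ hx hx' => htt' (hx.2.symm.trans hx'.2)

open Classical in
theorem encard_inter_eq_sum_setAtom [Fintype ι] {i : ι} (hAB : A i ⊆ B) (ξ : Set X) :
    (ξ ∩ A i).encard = ∑ t : Set ι, if i ∈ t then (ξ ∩ setAtom B A t).encard else 0 := by
  have h : ξ ∩ A i = ⋃ t : Set ι, if i ∈ t then ξ ∩ setAtom B A t else ∅ := by
    ext x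
    simp only [Set.mem_inter_iff, Set.mem_iUnion, Set.mem_ite_empty_right, setAtom,
      Set.mem_ofPred_eq]
    exact ⟨fun hx => ⟨_, hx.2, hx.1, hAB hx.2, rfl⟩,
      fun ⟨t, hi, hx, _, ht⟩ => ⟨hx, (Set.ext_iff.1 ht i).2 hi⟩⟩
  rw [h, Set.encard_iUnion_of_finite, finsum_eq_sum_of_fintype]
  · refine Finset.sum_congr rfl fun t _ => ?_
    split_ifs <;> simp
  · intro t t' htt'
    refine (pairwise_disjoint_setAtom (B := B) (A := A) htt').mono ?_ ?_ <;>
    · dsimp only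
      split_ifs <;> simp

end Atoms

section RegionSigma

variable {Ω X : Type*} [MeasurableSpace X] {A B B' : Set X}

/-- The number of points of `η` in each measurable subset of the region `B`, as a process indexed
by these subsets. -/
def regionCounts (η : Ω → Set X) (B : Set X) (ω : Ω) (A : {A // MeasurableSet A ∧ A ⊆ B}) : ℕ∞ :=
  (η ω ∩ A.1).encard

/-- The σ-algebra generated by the numbers of points of `η` in the measurable subsets of `B`. -/
@[reducible]
def regionSigma (η : Ω → Set X) (B : Set X) : MeasurableSpace Ω :=
  MeasurableSpace.comap (regionCounts η B) inferInstance

theorem measurable_count_regionSigma (η : Ω → Set X) (hA : MeasurableSet A) (hAB : A ⊆ B) :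
    Measurable[regionSigma η B] fun ω => (η ω ∩ A).encard :=
  (measurable_pi_apply (⟨A, hA, hAB⟩ : {A // MeasurableSet A ∧ A ⊆ B})).comp
    (comap_measurable (regionCounts η B))

theorem regionSigma_le_iff {η : Ω → Set X} {m : MeasurableSpace Ω} :
    regionSigma η B ≤ m ↔ ∀ A, MeasurableSet A → A ⊆ B → Measurable[m] fun ω =>
      (η ω ∩ A).encard := by
  rw [← measurable_iff_comap_le, measurable_pi_iff, Subtype.forall]
  exact ⟨fun h A hA hAB => h A ⟨hA, hAB⟩, fun h A hA => h A hA.1 hA.2⟩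

theorem regionSigma_mono (η : Ω → Set X) (h : B ⊆ B') : regionSigma η B ≤ regionSigma η B' :=
  regionSigma_le_iff.2 fun _ hA hAB => measurable_count_regionSigma η hA (hAB.trans h)

theorem measurableSet_void_regionSigma (η : Ω → Set X) (hA : MeasurableSet A) (hAB : A ⊆ B) :
    MeasurableSet[regionSigma η B] {ω | η ω ∩ A = ∅} := by
  simpa only [Set.preimage, Set.mem_singleton_iff, Set.encard_eq_zero] using
    measurable_count_regionSigma η hA hAB (MeasurableSet.singleton 0)

end RegionSigma

theorem lintegral_sq_poissonMeasure_le (r : NNReal) :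
    ∫⁻ k, (k : ENNReal) ^ 2 ∂poissonMeasure r ≤ ENNReal.ofReal (Real.exp (3 * r)) := by
  have hsum := (hasSum_one_poissonMeasure (4 * r)).mul_left (Real.exp (3 * r))
  rw [mul_one] at hsum
  rw [lintegral_countable', ← hsum.tsum_eq, ENNReal.ofReal_tsum_of_nonneg
    (fun n => by positivity) hsum.summable]
  refine ENNReal.tsum_le_tsum fun k => ?_
  rw [poissonMeasure_singleton, ← ENNReal.ofReal_natCast, ← ENNReal.ofReal_pow (by positivity),
    ← ENNReal.ofReal_mul (by positivity)]
  have hk : (k : ℝ) ^ 2 ≤ 4 ^ k := by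
    calc (k : ℝ) ^ 2 ≤ (2 ^ k) ^ 2 := by gcongr; exact_mod_cast Nat.lt_two_pow_self.le
      _ = 4 ^ k := by rw [← pow_mul, mul_comm, pow_mul]; norm_num
  have hexp : Real.exp (3 * r) * Real.exp (-((4 * r : NNReal) : ℝ)) = Real.exp (-r) := by
    rw [← Real.exp_add]
    push_cast
    ring_nf
  refine ENNReal.ofReal_le_ofReal ?_
  calc (k : ℝ) ^ 2 * (Real.exp (-r) * r ^ k / k.factorial)
      ≤ 4 ^ k * (Real.exp (-r) * r ^ k / k.factorial) := by gcongr
    _ = Real.exp (3 * r) * (Real.exp (-((4 * r : NNReal) : ℝ)) *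
          ((4 * r : NNReal) : ℝ) ^ k / k.factorial) := by
      rw [← hexp, NNReal.coe_mul, mul_pow]
      push_cast
      ring

namespace IsPoissonProcess

variable {Ω X : Type*} [mΩ : MeasurableSpace Ω] [MetricSpace X] [MeasurableSpace X]
  {P : Measure Ω} {η : Ω → Set X} {μ : Measure X}

theorem regionSigma_le (h : IsPoissonProcess P η μ) (B : Set X) : regionSigma η B ≤ mΩ :=
  regionSigma_le_iff.2 fun A hA _ => h.measurable_count A hA

theorem iIndepFun_count (h : IsPoissonProcess P η μ) {ι : Type*} {B : ι → Set X}
    (hB : ∀ i, MeasurableSet (B i)) (hd : Pairwise fun i j => Disjoint (B i) (B j)) :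
    iIndepFun (fun i ω => (η ω ∩ B i).encard) P := by
  rw [iIndepFun_iff_finset]
  intro s
  have e := (Fintype.equivFin s).symm
  refine iIndepFun.of_precomp (g := e) e.surjective ?_
  exact h.indep _ (fun i => B (e i)) (fun i => hB _) fun i j hij =>
    hd fun h => hij (e.injective (Subtype.ext h))

theorem indepFun_count_pi (h : IsPoissonProcess P η μ) {ι κ : Type*} [Finite ι] [Finite κ]
    {A : ι → Set X} {A' : κ → Set X} {B B' : Set X} (hB : MeasurableSet B) (hB' : MeasurableSet B')
    (hd : Disjoint B B') (hA : ∀ i, MeasurableSet (A i)) (hAB : ∀ i, A i ⊆ B)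
    (hA' : ∀ i, MeasurableSet (A' i)) (hAB' : ∀ i, A' i ⊆ B') :
    IndepFun (fun ω i => (η ω ∩ A i).encard) (fun ω i => (η ω ∩ A' i).encard) P := by
  classical
  have := Fintype.ofFinite ι
  have := Fintype.ofFinite κ
  let T : Set ι ⊕ Set κ → Set X := Sum.elim (setAtom B A) (setAtom B' A')
  have hT_meas : ∀ i, MeasurableSet (T i) := by
    rintro (t | t)
    exacts [measurableSet_setAtom hB hA t, measurableSet_setAtom hB' hA' t]
  have hT_disj : Pairwise fun i j => Disjoint (T i) (T j) := by
    rintro (t | t) (t' | t') htt'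
    · exact pairwise_disjoint_setAtom fun h => htt' (congrArg _ h)
    · exact hd.mono (setAtom_subset t) (setAtom_subset t')
    · exact (hd.mono (setAtom_subset t') (setAtom_subset t)).symm
    · exact pairwise_disjoint_setAtom fun h => htt' (congrArg _ h)
  have hT := (h.iIndepFun_count hT_meas hT_disj).indepFun_finset
    (Finset.univ.map .inl) (Finset.univ.map .inr) (by simp [Finset.disjoint_left])
    fun i => h.measurable_count _ (hT_meas i)
  convert hT.comp
    (φ := fun g i => ∑ t : Set ι, if i ∈ t then g ⟨Sum.inl t, by simp⟩ else 0)
    (ψ := fun g i => ∑ t : Set κ, if i ∈ t then g ⟨Sum.inr t, by simp⟩ else 0)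
    .of_discrete .of_discrete using 1
  · ext ω i
    exact encard_inter_eq_sum_setAtom (hAB i) _
  · ext ω i
    exact encard_inter_eq_sum_setAtom (hAB' i) _

theorem indep_regionSigma [IsProbabilityMeasure P] (h : IsPoissonProcess P η μ) {B B' : Set X}
    (hB : MeasurableSet B) (hB' : MeasurableSet B') (hd : Disjoint B B') :
    Indep (regionSigma η B) (regionSigma η B') P :=
  (IndepFun_iff_Indep _ _ _).1 <| IndepFun.process_indepFun_process
    (fun A => h.measurable_count A.1 A.2.1) (fun A => h.measurable_count A.1 A.2.1) fun I J =>
    h.indepFun_count_pi hB hB' hd (fun i : I => i.1.2.1) (fun i => i.1.2.2)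
      (fun j : J => j.1.2.1) fun j => j.1.2.2

theorem measurableSet_void (h : IsPoissonProcess P η μ) {B : Set X} (hB : MeasurableSet B) :
    MeasurableSet {ω | η ω ∩ B = ∅} :=
  h.regionSigma_le B _ (measurableSet_void_regionSigma η hB subset_rfl)

theorem measure_void (h : IsPoissonProcess P η μ) {B : Set X} (hB : MeasurableSet B)
    (hμ : μ B ≠ ⊤) : P {ω | η ω ∩ B = ∅} = ENNReal.ofReal (Real.exp (-(μ B).toReal)) := by
  have hvoid : (fun ω => (η ω ∩ B).encard) ⁻¹' {0} = {ω | η ω ∩ B = ∅} := by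
    ext ω
    simp [Set.encard_eq_zero]
  have hzero : (fun k : ℕ => (k : ℕ∞)) ⁻¹' {0} = {0} := by
    ext k
    simp
  rw [← hvoid, ← Measure.map_apply (h.measurable_count B hB) (.singleton 0),
    h.count_law B hB hμ, Measure.map_apply (measurable_of_countable _) (.singleton 0), hzero,
    poissonMeasure_singleton, pow_zero, Nat.factorial_zero, Nat.cast_one, div_one, mul_one]
  rfl

theorem lintegral_count_sq_le (h : IsPoissonProcess P η μ) {B : Set X} (hB : MeasurableSet B)
    (hμ : μ B ≠ ⊤) :
    ∫⁻ ω, ((η ω ∩ B).encard : ENNReal) ^ 2 ∂P ≤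
      ENNReal.ofReal (Real.exp (3 * (μ B).toReal)) := by
  rw [← lintegral_map (f := fun n : ℕ∞ => (n : ENNReal) ^ 2) (measurable_of_countable _)
    (h.measurable_count B hB), h.count_law B hB hμ, lintegral_map (measurable_of_countable _)
    (measurable_of_countable _)]
  exact lintegral_sq_poissonMeasure_le _

end IsPoissonProcess

section RadialEdge

variable {X : Type*} [MetricSpace X] {o x : X} {ξ ξ' : Set X}

theorem ne_of_dist_lt_dist {z : X} (h : dist o z < dist o x) : x ≠ o := by
  rintro rfl
  rw [dist_self] at h
  exact h.not_ge dist_nonneg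

theorem isRadialNearest_radialNearest (hξ : ∀ r, (ξ ∩ Metric.ball o r).Finite) (hx : x ≠ o) :
    IsRadialNearest o ξ x (radialNearest o ξ x) := by
  have hfin : {z ∈ ξ ∪ {o} | dist o z < dist o x}.Finite := by
    refine ((hξ (dist o x)).union (Set.finite_singleton o)).subset ?_
    rintro z ⟨hz | hz, h⟩
    · exact Or.inl ⟨hz, by rwa [Metric.mem_ball, dist_comm]⟩
    · exact Or.inr hz
  have hex : ∃ y, IsRadialNearest o ξ x y := by
    obtain ⟨y, hy, hmin⟩ := Set.exists_min_image _ (dist x) hfin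
      ⟨o, Or.inr rfl, by rw [dist_self]; exact dist_pos.2 hx.symm⟩
    exact ⟨y, hy, fun z hz hzo => hmin z ⟨hz, hzo⟩⟩
  rw [radialNearest, dif_pos hex]
  exact hex.choose_spec

theorem radialEdgeLength_self (o : X) (ξ : Set X) : radialEdgeLength o ξ o = 0 := by
  have h : ¬ ∃ y, IsRadialNearest o ξ o y := fun ⟨_, hy, _⟩ => ne_of_dist_lt_dist hy.2 rfl
  rw [radialEdgeLength, radialNearest, dif_neg h, dist_self]

theorem radialEdgeLength_nonneg (o : X) (ξ : Set X) (x : X) : 0 ≤ radialEdgeLength o ξ x :=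
  dist_nonneg

theorem radialEdgeLength_lt_iff (hξ : ∀ r, (ξ ∩ Metric.ball o r).Finite) (hx : x ≠ o) {s : ℝ} :
    radialEdgeLength o ξ x < s ↔
      ∃ z ∈ ξ ∪ {o}, dist o z < dist o x ∧ dist x z < s := by
  have h := isRadialNearest_radialNearest hξ hx
  exact ⟨fun hs => ⟨_, h.1.1, h.1.2, hs⟩, fun ⟨z, hz, hzo, hzs⟩ => (h.2 z hz hzo).trans_lt hzs⟩

theorem le_radialEdgeLength_iff (hξ : ∀ r, (ξ ∩ Metric.ball o r).Finite) (hx : x ≠ o) {s : ℝ} :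
    s ≤ radialEdgeLength o ξ x ↔
      ∀ z ∈ ξ ∪ {o}, dist o z < dist o x → s ≤ dist x z := by
  rw [← not_lt, radialEdgeLength_lt_iff hξ hx]
  push Not
  rfl

theorem radialEdgeLength_le_dist (hξ : ∀ r, (ξ ∩ Metric.ball o r).Finite) {z : X} (hz : z ∈ ξ)
    (hzx : dist o z < dist o x) : radialEdgeLength o ξ x ≤ dist x z :=
  (isRadialNearest_radialNearest hξ (ne_of_dist_lt_dist hzx)).2 z (Or.inl hz) hzx

theorem radialEdgeLength_le_dist_root (hξ : ∀ r, (ξ ∩ Metric.ball o r).Finite) :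
    radialEdgeLength o ξ x ≤ dist o x := by
  rcases eq_or_ne x o with rfl | hx
  · rw [radialEdgeLength_self, dist_self]
  · rw [dist_comm]
    refine (isRadialNearest_radialNearest hξ hx).2 o (Or.inr rfl) ?_
    rw [dist_self]
    exact dist_pos.2 hx.symm

theorem finite_union_inter_ball (hξ : ∀ r, (ξ ∩ Metric.ball o r).Finite)
    (hξ' : ∀ r, (ξ' ∩ Metric.ball o r).Finite) (r : ℝ) : ((ξ ∪ ξ') ∩ Metric.ball o r).Finite := by
  rw [Set.union_inter_distrib_right]
  exact (hξ r).union (hξ' r)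

theorem radialEdgeLength_union (hξ : ∀ r, (ξ ∩ Metric.ball o r).Finite)
    (hξ' : ∀ r, (ξ' ∩ Metric.ball o r).Finite) :
    radialEdgeLength o (ξ ∪ ξ') x = min (radialEdgeLength o ξ x) (radialEdgeLength o ξ' x) := by
  rcases eq_or_ne x o with rfl | hx
  · simp only [radialEdgeLength_self, min_self]
  refine eq_of_forall_le_iff fun s => ?_
  rw [le_min_iff, le_radialEdgeLength_iff (finite_union_inter_ball hξ hξ') hx,
    le_radialEdgeLength_iff hξ hx, le_radialEdgeLength_iff hξ' hx]
  refine ⟨fun h => ⟨fun z hz => h z (hz.imp_left Or.inl), fun z hz => h z (hz.imp_left Or.inr)⟩,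
    fun h z hz => ?_⟩
  rcases hz with (hz | hz) | hz
  exacts [h.1 z (Or.inl hz), h.2 z (Or.inl hz), h.1 z (Or.inr hz)]

theorem radialEdgeLength_eq_of_inter_subset (hξ : ∀ r, (ξ ∩ Metric.ball o r).Finite)
    (hsub : ξ' ⊆ ξ) {s : ℝ} (hs : radialEdgeLength o ξ x < s)
    (hloc : ∀ z ∈ ξ, dist o z < dist o x → dist x z < s → z ∈ ξ') :
    radialEdgeLength o ξ' x = radialEdgeLength o ξ x := by
  rcases eq_or_ne x o with rfl | hx
  · simp only [radialEdgeLength_self]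
  have hξ' : ∀ r, (ξ' ∩ Metric.ball o r).Finite := fun r =>
    (hξ r).subset (Set.inter_subset_inter_left _ hsub)
  have h := isRadialNearest_radialNearest hξ hx
  have h' := isRadialNearest_radialNearest hξ' hx
  refine le_antisymm (h'.2 _ ?_ h.1.2) (h.2 _ (h'.1.1.imp_left fun h => hsub h) h'.1.2)
  exact h.1.1.imp_left fun h1 => hloc _ h1 h.1.2 hs

end RadialEdge

section CountingKernel

variable {Ω X : Type*} [MeasurableSpace Ω] [MeasurableSpace X] [MeasurableSingletonClass X]

theorem count_restrict_apply {ξ A : Set X} (hξ : ξ.Finite) (hA : MeasurableSet A) :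
    (Measure.count.restrict ξ) A = ((ξ ∩ A).encard : ENNReal) := by
  rw [Measure.restrict_apply hA, Set.inter_comm,
    Measure.count_apply (hξ.measurableSet.inter hA)]

/-- The kernel that maps `ω` to the counting measure of the finite random set `ξ ω`. -/
def countingKernel (ξ : Ω → Set X) (hfin : ∀ ω, (ξ ω).Finite)
    (hcount : ∀ A, MeasurableSet A → Measurable fun ω => (ξ ω ∩ A).encard) : Kernel Ω X where
  toFun ω := Measure.count.restrict (ξ ω)
  measurable' := by
    refine Measure.measurable_of_measurable_coe _ fun A hA => ?_
    simp_rw [count_restrict_apply (hfin _) hA]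
    exact (measurable_of_countable (fun n : ℕ∞ => (n : ENNReal))).comp (hcount A hA)

variable {ξ : Ω → Set X} {hfin : ∀ ω, (ξ ω).Finite}
  {hcount : ∀ A, MeasurableSet A → Measurable fun ω => (ξ ω ∩ A).encard}

theorem countingKernel_apply (ω : Ω) {A : Set X} (hA : MeasurableSet A) :
    countingKernel ξ hfin hcount ω A = ((ξ ω ∩ A).encard : ENNReal) :=
  count_restrict_apply (hfin ω) hA

theorem lintegral_countingKernel (ω : Ω) (f : X → ENNReal) :
    ∫⁻ x, f x ∂countingKernel ξ hfin hcount ω = ∑ x ∈ (hfin ω).toFinset, f x := by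
  have h : countingKernel ξ hfin hcount ω = Measure.count.restrict (hfin ω).toFinset := by
    rw [(hfin ω).coe_toFinset]
    rfl
  rw [h, lintegral_finset]
  simp only [Measure.count_singleton, mul_one]

instance : IsSFiniteKernel (countingKernel ξ hfin hcount) := by
  classical
  have hmeas (n : ℕ) : MeasurableSet {ω | (ξ ω).encard = n} := by
    simpa only [Set.inter_univ, Set.preimage, Set.mem_singleton_iff] using
      hcount .univ .univ (MeasurableSet.singleton (n : ℕ∞))
  refine ⟨fun n => Kernel.piecewise (hmeas n) (countingKernel ξ hfin hcount) 0, fun n => ?_, ?_⟩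
  · refine ⟨n, ENNReal.natCast_lt_top n, fun ω => ?_⟩
    rw [Kernel.piecewise_apply]
    split_ifs with h
    · rw [countingKernel_apply _ .univ, Set.inter_univ, h, ENat.toENNReal_coe]
    · simp
  · ext ω A hA
    rw [Kernel.sum_apply' _ _ hA, tsum_eq_single (ξ ω).ncard]
    · rw [Kernel.piecewise_apply', if_pos]
      exact (hfin ω).cast_ncard_eq.symm
    · intro m hm
      rw [Kernel.piecewise_apply', if_neg, zero_apply, Measure.coe_zero, Pi.zero_apply]
      rintro (h : (ξ ω).encard = m)
      rw [← (hfin ω).cast_ncard_eq] at h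
      exact hm (by exact_mod_cast h.symm)

theorem measurableSet_inter_nonempty (hfin : ∀ ω, (ξ ω).Finite)
    (hcount : ∀ A, MeasurableSet A → Measurable fun ω => (ξ ω ∩ A).encard) {s : Set (Ω × X)}
    (hs : MeasurableSet s) : MeasurableSet {ω | (ξ ω ∩ Prod.mk ω ⁻¹' s).Nonempty} := by
  have h := (measurableSet_eq_fun (Kernel.measurable_kernel_prodMk_left
    (κ := countingKernel ξ hfin hcount) hs) measurable_zero).compl
  convert h using 1
  ext ω
  rw [Set.mem_compl_iff, Set.mem_ofPred_eq, Set.mem_ofPred_eq,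
    countingKernel_apply _ (measurable_prodMk_left hs), Pi.zero_apply, ENat.toENNReal_eq_zero,
    Set.encard_eq_zero, Set.nonempty_iff_ne_empty]

end CountingKernel

section RegionFunctional

variable {X : Type*} [MetricSpace X] {o : X} {α : ℝ} {S ξ : Set X}

/-- The contribution of the points in `S` to the edge-length functional. -/
def regionFunctional (o : X) (α : ℝ) (S ξ : Set X) : ℝ :=
  ∑ᶠ x ∈ ξ ∩ S, radialEdgeLength o ξ x ^ α

theorem edgeLengthFunctional_eq (o : X) (α R : ℝ) (ξ : Set X) :
    edgeLengthFunctional o α R ξ = regionFunctional o α (Metric.ball o R) ξ := rfl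

theorem regionFunctional_nonneg (o : X) (α : ℝ) (S ξ : Set X) : 0 ≤ regionFunctional o α S ξ :=
  finsum_nonneg fun x => finsum_nonneg fun _ =>
    Real.rpow_nonneg (radialEdgeLength_nonneg o ξ x) _

theorem regionFunctional_inter_ball {R : ℝ} (hξ : ∀ r, (ξ ∩ Metric.ball o r).Finite)
    (hS : S ⊆ Metric.ball o R) :
    regionFunctional o α S (ξ ∩ Metric.ball o R) = regionFunctional o α S ξ := by
  rw [regionFunctional, regionFunctional, Set.inter_assoc, Set.inter_eq_self_of_subset_right hS]
  refine finsum_mem_congr rfl fun x hx => ?_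
  congr 1
  refine radialEdgeLength_eq_of_inter_subset hξ Set.inter_subset_left (lt_add_one _) ?_
  exact fun z hz hzx _ => ⟨hz, Metric.mem_ball'.2 (hzx.trans (Metric.mem_ball'.1 (hS hx.2)))⟩

theorem ofReal_regionFunctional_le {M : ℝ} (hα : 0 ≤ α) (hfin : (ξ ∩ S).Finite)
    (h : ∀ x ∈ ξ ∩ S, radialEdgeLength o ξ x ≤ M) :
    ENNReal.ofReal (regionFunctional o α S ξ) ≤
      ((ξ ∩ S).encard : ENNReal) * ENNReal.ofReal (M ^ α) := by
  have hsum : regionFunctional o α S ξ ≤ ∑ _x ∈ hfin.toFinset, M ^ α := by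
    rw [regionFunctional, finsum_mem_eq_finite_toFinset_sum _ hfin]
    exact Finset.sum_le_sum fun x hx =>
      Real.rpow_le_rpow (radialEdgeLength_nonneg _ _ _) (h x (hfin.mem_toFinset.1 hx)) hα
  refine (ENNReal.ofReal_le_ofReal hsum).trans_eq ?_
  rw [Finset.sum_const, nsmul_eq_mul, ENNReal.ofReal_mul (by positivity), ENNReal.ofReal_natCast,
    hfin.encard_eq_coe_toFinset_card, ENat.toENNReal_coe]

theorem regionFunctional_biUnion {ι : Type*} (T : Finset ι) (C : ι → Set X)
    (hfin : ∀ i ∈ T, (ξ ∩ C i).Finite) (hdisj : (T : Set ι).PairwiseDisjoint C) :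
    regionFunctional o α (⋃ i ∈ T, C i) ξ = ∑ i ∈ T, regionFunctional o α (C i) ξ := by
  unfold regionFunctional
  rw [Set.inter_iUnion₂, ← finsum_mem_coe_finset]
  exact finsum_mem_biUnion (fun i hi j hj hij =>
    (hdisj hi hj hij).mono Set.inter_subset_right Set.inter_subset_right) T.finite_toSet hfin

end RegionFunctional

section Measurability

variable {Ω X : Type*} [MeasurableSpace Ω] [MetricSpace X]

theorem radialEdgeLength_lt_iff_of_finite {o x : X} {ξ : Set X} (hξ : ξ.Finite) {s : ℝ} :
    radialEdgeLength o ξ x < s ↔ x = o ∧ 0 < s ∨ x ≠ o ∧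
      (dist o x < s ∨ (ξ ∩ {z | dist o z < dist o x ∧ dist x z < s}).Nonempty) := by
  rcases eq_or_ne x o with rfl | hx
  · simp [radialEdgeLength_self]
  rw [radialEdgeLength_lt_iff (fun r => hξ.inter_of_left _) hx]
  simp only [hx, false_and, false_or, ne_eq, not_false_eq_true, true_and]
  constructor
  · rintro ⟨z, hz | rfl, hzo, hzs⟩
    exacts [Or.inr ⟨z, hz, hzo, hzs⟩, Or.inl (dist_comm x z ▸ hzs)]
  · rintro (hs | ⟨z, hz, hzo, hzs⟩)
    · exact ⟨o, Or.inr rfl, by rw [dist_self]; exact dist_pos.2 hx.symm, by rwa [dist_comm]⟩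
    · exact ⟨z, Or.inl hz, hzo, hzs⟩

variable [MeasurableSpace X] [SecondCountableTopology X] [BorelSpace X] {ξ : Ω → Set X} {S : Set X}

theorem measurable_radialEdgeLength (o : X) (hfin : ∀ ω, (ξ ω).Finite)
    (hcount : ∀ A, MeasurableSet A → Measurable fun ω => (ξ ω ∩ A).encard) :
    Measurable fun p : Ω × X => radialEdgeLength o (ξ p.1) p.2 := by
  refine measurable_of_Iio fun t => ?_
  have hs : MeasurableSet ({q : (Ω × X) × X | dist o q.2 < dist o q.1.2} ∩
      {q | dist q.1.2 q.2 < t}) :=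
    (measurableSet_lt (by fun_prop) (by fun_prop)).inter
      (measurableSet_lt (by fun_prop) (by fun_prop))
  have hnear := measurableSet_inter_nonempty (ξ := fun p : Ω × X => ξ p.1) (fun p => hfin p.1)
    (fun A hA => (hcount A hA).comp measurable_fst) hs
  have hroot : MeasurableSet {p : Ω × X | p.2 = o} := measurable_snd (.singleton o)
  have hdist : MeasurableSet {p : Ω × X | dist o p.2 < t} :=
    measurableSet_lt (by fun_prop) (by fun_prop)
  simp only [Set.preimage, Set.mem_Iio, radialEdgeLength_lt_iff_of_finite (hfin _)]
  exact (hroot.inter (.const _)).union (hroot.compl.inter (hdist.union hnear))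

theorem measurable_regionFunctional_of_finite (o : X) (α : ℝ) (hS : MeasurableSet S)
    (hfin : ∀ ω, (ξ ω).Finite)
    (hcount : ∀ A, MeasurableSet A → Measurable fun ω => (ξ ω ∩ A).encard) :
    Measurable fun ω => regionFunctional o α S (ξ ω) := by
  classical
  let f (p : Ω × X) : ENNReal :=
    if p.2 ∈ S then ENNReal.ofReal (radialEdgeLength o (ξ p.1) p.2 ^ α) else 0
  have hf : Measurable f := .ite (measurable_snd hS)
    ((measurable_radialEdgeLength o hfin hcount).pow_const α).ennreal_ofReal measurable_const
  have hf_lt (p) : f p ≠ ⊤ := by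
    dsimp only [f]
    split_ifs <;> simp
  convert (hf.lintegral_kernel_prod_right' (κ := countingKernel ξ hfin hcount)).ennreal_toReal
    using 2 with ω
  have hfilter : ((hfin ω).inter_of_left S).toFinset = (hfin ω).toFinset.filter (· ∈ S) := by
    ext x
    simp
  rw [lintegral_countingKernel, ENNReal.toReal_sum fun x _ => hf_lt (ω, x), regionFunctional,
    finsum_mem_eq_finite_toFinset_sum _ ((hfin ω).inter_of_left S), hfilter, Finset.sum_filter]
  refine Finset.sum_congr rfl fun x _ => ?_
  dsimp only [f]
  split_ifs
  · rw [ENNReal.toReal_ofReal (Real.rpow_nonneg (radialEdgeLength_nonneg _ _ _) _)]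
  · rfl

theorem measurable_regionFunctional {o : X} (α : ℝ) {R : ℝ} (hS : MeasurableSet S)
    (hSR : S ⊆ Metric.ball o R) (hfin : ∀ ω r, (ξ ω ∩ Metric.ball o r).Finite)
    (hcount : ∀ A, MeasurableSet A → Measurable fun ω => (ξ ω ∩ A).encard) :
    Measurable fun ω => regionFunctional o α S (ξ ω) := by
  simp_rw [← fun ω => regionFunctional_inter_ball (α := α) (hfin ω) hSR]
  refine measurable_regionFunctional_of_finite o α hS (fun ω => hfin ω R) fun A hA => ?_
  simp_rw [Set.inter_assoc]
  exact hcount _ (measurableSet_ball.inter hA)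

end Measurability

section SeparatedNet

variable {X : Type*} [MetricSpace X]

/-- A finite `s`-separated subset `T` of `A` that is also an `s`-net of `A`: a maximal packing, as
it is used to cut `A` into cells of size `s`. -/
structure IsSeparatedNet (s : ℝ) (A : Set X) (T : Finset X) : Prop where
  subset : ↑T ⊆ A
  separated : (T : Set X).Pairwise fun x y => s ≤ dist x y
  exists_dist_lt : ∀ x ∈ A, ∃ y ∈ T, dist x y < s

theorem exists_isSeparatedNet {s : ℝ} (hs : 0 < s) {A : Set X} {N : ℕ}
    (hN : ∀ T : Finset X, ↑T ⊆ A → (T : Set X).Pairwise (fun x y => s ≤ dist x y) → T.card ≤ N) :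
    ∃ T, IsSeparatedNet s A T := by
  classical
  let cards : Set ℕ :=
    Finset.card '' {T : Finset X | ↑T ⊆ A ∧ (T : Set X).Pairwise fun x y => s ≤ dist x y}
  have hbdd : BddAbove cards := ⟨N, by rintro _ ⟨T, hT, rfl⟩; exact hN T hT.1 hT.2⟩
  have hne : cards.Nonempty := ⟨0, ∅, by simp, rfl⟩
  obtain ⟨T, ⟨hTA, hT⟩, hcard⟩ := Nat.sSup_mem hne hbdd
  refine ⟨T, hTA, hT, fun x hx => ?_⟩
  by_contra! hfar
  have hxT : x ∉ T := fun h => (hfar x h).not_gt (by rwa [dist_self])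
  have hins : (insert x T).card ∈ cards := by
    refine ⟨insert x T, ⟨?_, ?_⟩, rfl⟩
    · rw [Finset.coe_insert]
      exact Set.insert_subset hx hTA
    · rw [Finset.coe_insert, Set.pairwise_insert_of_notMem (Finset.mem_coe.not.2 hxT)]
      exact ⟨hT, fun y hy => ⟨hfar y hy, dist_comm x y ▸ hfar y hy⟩⟩
  have hle := le_csSup hbdd hins
  rw [← hcard, Finset.card_insert_of_notMem hxT] at hle
  exact (Nat.lt_succ_self _).not_ge hle

end SeparatedNet

namespace HypSpace

section Packing

variable {d : ℕ} [NeZero d] {o x : HypSpace d} {s r R : ℝ}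

instance : SecondCountableTopology (HypSpace d) :=
  (Topology.IsEmbedding.mk ⟨rfl⟩ coord_injective).secondCountableTopology

theorem card_mul_le_of_disjoint_balls {ι : Type*} (hd : 2 ≤ d) (hs : 0 ≤ s) (T : Finset ι)
    (p : ι → HypSpace d) {A : Set (HypSpace d)}
    (hdisj : (T : Set ι).PairwiseDisjoint fun i => Metric.ball (p i) s)
    (hA : ∀ i ∈ T, Metric.ball (p i) s ⊆ A) :
    T.card * ENNReal.ofReal (volumeGrowth d * s ^ d) ≤ hypVolume d A := by
  calc T.card * ENNReal.ofReal (volumeGrowth d * s ^ d)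
      = ∑ _i ∈ T, ENNReal.ofReal (volumeGrowth d * s ^ d) := by simp
    _ ≤ ∑ i ∈ T, hypVolume d (Metric.ball (p i) s) :=
        Finset.sum_le_sum fun i _ => ofReal_pow_le_hypVolume_ball hd _ hs
    _ = hypVolume d (⋃ i ∈ T, Metric.ball (p i) s) :=
        (measure_biUnion_finset hdisj fun i _ => measurableSet_ball).symm
    _ ≤ hypVolume d A := measure_mono (Set.iUnion₂_subset hA)

theorem pairwiseDisjoint_ball_of_separated {T : Finset (HypSpace d)}
    (hT : (T : Set (HypSpace d)).Pairwise fun y z => s ≤ dist y z) :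
    (T : Set (HypSpace d)).PairwiseDisjoint fun y => Metric.ball y (s / 2) := fun y hy z hz hyz =>
  Metric.ball_disjoint_ball (by linarith [hT hy hz hyz])

theorem card_mul_le_of_separated (hd : 2 ≤ d) (hs : 0 ≤ s) {T : Finset (HypSpace d)}
    (hT : (T : Set (HypSpace d)).Pairwise fun y z => s ≤ dist y z)
    (hTx : ↑T ⊆ Metric.ball x r) :
    T.card * ENNReal.ofReal (volumeGrowth d * (s / 2) ^ d) ≤
      hypVolume d (Metric.ball x (r + s / 2)) := by
  refine card_mul_le_of_disjoint_balls hd (by positivity) T id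
    (pairwiseDisjoint_ball_of_separated hT) fun y hy => Metric.ball_subset_ball' ?_
  rw [id, add_comm]
  gcongr
  exact (Metric.mem_ball.1 (hTx hy)).le

theorem exists_ball_subset_inter_ball (hs : 0 ≤ s) (hsR : s ≤ 2 * R) {y : HypSpace d}
    (hy : y ∈ Metric.ball o R) :
    ∃ m, Metric.ball m (s / 4) ⊆ Metric.ball y (s / 2) ∩ Metric.ball o R := by
  rw [Metric.mem_ball'] at hy
  rcases le_or_gt (s / 4) (dist o y) with h | h
  · have hs4 : 0 ≤ s / 4 := by positivity
    refine ⟨towards o y (s / 4), Set.subset_inter (Metric.ball_subset_ball' ?_)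
      (Metric.ball_subset_ball' ?_)⟩
    · linarith [dist_towards o y hs4]
    · rw [dist_comm _ o]
      linarith [dist_root_towards hs4 h]
  · refine ⟨y, Set.subset_inter (Metric.ball_subset_ball (by linarith))
      (Metric.ball_subset_ball' ?_)⟩
    rw [dist_comm]
    linarith

theorem card_mul_le_of_separated_of_subset_ball (hd : 2 ≤ d) (hs : 0 ≤ s) (hsR : s ≤ 2 * R)
    {T : Finset (HypSpace d)} (hTo : ↑T ⊆ Metric.ball o R)
    (hT : (T : Set (HypSpace d)).Pairwise fun y z => s ≤ dist y z) :
    T.card * ENNReal.ofReal (volumeGrowth d * (s / 4) ^ d) ≤ hypVolume d (Metric.ball o R) := by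
  choose! m hm using fun y (hy : y ∈ Metric.ball o R) => exists_ball_subset_inter_ball hs hsR hy
  refine card_mul_le_of_disjoint_balls hd (by positivity) T m (fun y hy z hz hyz => ?_)
    fun y hy => (hm y (hTo hy)).trans Set.inter_subset_right
  exact (pairwiseDisjoint_ball_of_separated hT hy hz hyz).mono
    ((hm y (hTo hy)).trans Set.inter_subset_left) ((hm z (hTo hz)).trans Set.inter_subset_left)

theorem exists_isSeparatedNet_of_subset_ball (hd : 2 ≤ d) (hs : 0 < s) {A : Set (HypSpace d)}
    (hA : A ⊆ Metric.ball o R) : ∃ T, IsSeparatedNet s A T := by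
  have hpos : 0 < volumeGrowth d * (s / 2) ^ d := by have := volumeGrowth_pos d; positivity
  refine exists_isSeparatedNet hs
    (N := ⌈(hypVolume d (Metric.ball o (R + s / 2))).toReal / (volumeGrowth d * (s / 2) ^ d)⌉₊)
    fun T hTA hT => ?_
  have hcard := ENNReal.toReal_mono (hypVolume_ball_lt_top o _).ne
    (card_mul_le_of_separated hd hs.le hT (hTA.trans hA))
  rw [ENNReal.toReal_mul, ENNReal.toReal_ofReal hpos.le, ENNReal.toReal_natCast] at hcard
  exact_mod_cast ((le_div_iff₀ hpos).2 hcard).trans (Nat.le_ceil _)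

end Packing

/-- The rate at which the influence of a cell decays with the scale `k`, for a process with `β`
points per cell on average. Its fourth power bounds the void probability at scale `k`; the
subtraction is truncated, so that the rate is `1` for `k ≤ 1`. -/
def voidDecay (d : ℕ) (β : ℝ) (k : ℕ) : ℝ :=
  Real.exp (-(volumeGrowth d * β / 4 * ((k - 1 : ℕ) : ℝ) ^ 2))

theorem voidDecay_pos (d : ℕ) (β : ℝ) (k : ℕ) : 0 < voidDecay d β k := Real.exp_pos _

theorem voidDecay_zero (d : ℕ) (β : ℝ) : voidDecay d β 0 = 1 := by simp [voidDecay]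

theorem voidDecay_pow_four (d : ℕ) (β : ℝ) (k : ℕ) :
    voidDecay d β k ^ 4 = Real.exp (-(volumeGrowth d * β * ((k - 1 : ℕ) : ℝ) ^ 2)) := by
  rw [voidDecay, ← Real.exp_nat_mul]
  push_cast
  ring_nf

section StoppingBalls

variable {d : ℕ} [NeZero d] {o x : HypSpace d} {ρ : ℝ} {k : ℕ} {ξ : Set (HypSpace d)}

/-- The `k`-th stopping ball at `x` at scale `ρ`. A point of `ξ` in it bounds the edge lengths at
all points near `x` by `2 k ρ`. -/
def stopBall (o : HypSpace d) (ρ : ℝ) (x : HypSpace d) (k : ℕ) : Set (HypSpace d) :=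
  Metric.ball (towards o x (k * ρ)) ((k - 1) * ρ)

/-- The edges at points near `x` need not end at scale `k`: the `k`-th stopping ball contains no
point of `ξ`, and the root is not near either. -/
def IsVoid (o : HypSpace d) (ρ : ℝ) (x : HypSpace d) (k : ℕ) (ξ : Set (HypSpace d)) : Prop :=
  k * ρ ≤ dist o x ∧ ξ ∩ stopBall o ρ x k = ∅

theorem isVoid_zero (hρ : 0 ≤ ρ) : IsVoid o ρ x 0 ξ := by
  refine ⟨by simp [dist_nonneg], ?_⟩
  rw [stopBall, Metric.ball_eq_empty.2 (by simpa using hρ), Set.inter_empty]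

theorem setOf_isVoid_zero {Ω : Type*} (hρ : 0 ≤ ρ) (η : Ω → Set (HypSpace d)) :
    {ω | IsVoid o ρ x 0 (η ω)} = Set.univ :=
  Set.eq_univ_of_forall fun _ => isVoid_zero hρ

theorem exists_not_isVoid (hρ : 0 < ρ) (o x : HypSpace d) (ξ : Set (HypSpace d)) :
    ∃ k, ¬ IsVoid o ρ x k ξ := by
  obtain ⟨k, hk⟩ := exists_nat_gt (dist o x / ρ)
  exact ⟨k, fun h => h.1.not_gt ((div_lt_iff₀ hρ).1 hk)⟩

theorem exists_isVoid_not_isVoid_succ (hρ : 0 < ρ) (o x : HypSpace d) (ξ : Set (HypSpace d)) :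
    ∃ k, IsVoid o ρ x k ξ ∧ ¬ IsVoid o ρ x (k + 1) ξ := by
  by_contra! h
  obtain ⟨k, hk⟩ := exists_not_isVoid hρ o x ξ
  exact hk (Nat.rec (isVoid_zero hρ.le) h k)

theorem radialEdgeLength_lt_of_not_isVoid (hρ : 0 < ρ)
    (hξ : ∀ r, (ξ ∩ Metric.ball o r).Finite) (hk : ¬ IsVoid o ρ x k ξ) {y : HypSpace d}
    (hy : dist y x < ρ) : radialEdgeLength o ξ y < 2 * k * ρ := by
  rcases Nat.eq_zero_or_pos k with rfl | hk0
  · exact absurd (isVoid_zero hρ.le) hk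
  have hk1 : (1 : ℝ) ≤ k := by exact_mod_cast hk0
  rcases lt_or_ge (dist o x) (k * ρ) with hroot | hroot
  · refine (radialEdgeLength_le_dist_root hξ).trans_lt ?_
    nlinarith [dist_triangle_right o y x]
  · obtain ⟨z, hz, hzb⟩ : (ξ ∩ stopBall o ρ x k).Nonempty :=
      Set.nonempty_iff_ne_empty.2 fun he => hk ⟨hroot, he⟩
    have hkρ : 0 ≤ k * ρ := by positivity
    have hcx := dist_towards o x hkρ
    have hoc := dist_root_towards hkρ hroot
    rw [stopBall, Metric.mem_ball'] at hzb
    refine (radialEdgeLength_le_dist hξ hz ?_).trans_lt ?_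
    · linarith [dist_triangle o (towards o x (k * ρ)) z, dist_triangle o y x]
    · linarith [dist_triangle y x z, dist_triangle_left x z (towards o x (k * ρ))]

theorem stopBall_subset (hρ : 0 ≤ ρ) : stopBall o ρ x k ⊆ Metric.ball x ((2 * k + 1) * ρ) := by
  refine Metric.ball_subset_ball' ?_
  rw [dist_towards o x (by positivity)]
  linarith

theorem disjoint_stopBall (hρ : 0 ≤ ρ) : Disjoint (stopBall o ρ x k) (Metric.ball x ρ) := by
  refine Metric.ball_disjoint_ball ?_
  rw [dist_towards o x (by positivity)]
  linarith

theorem measurableSet_isVoid {Ω : Type*} {η : Ω → Set (HypSpace d)} {B : Set (HypSpace d)}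
    (hB : stopBall o ρ x k ⊆ B) :
    MeasurableSet[regionSigma η B] {ω | IsVoid o ρ x k (η ω)} :=
  @MeasurableSet.inter _ (_) _ _ (@MeasurableSet.const _ (_) _)
    (measurableSet_void_regionSigma η measurableSet_ball hB)

theorem measure_isVoid_le {Ω : Type*} [MeasurableSpace Ω] {P : Measure Ω} [IsProbabilityMeasure P]
    {η : Ω → Set (HypSpace d)} {γ : ℝ} (hd : 2 ≤ d)
    (hη : IsPoissonProcess P η (ENNReal.ofReal γ • hypVolume d)) (hγ : 0 ≤ γ) (hρ : 0 ≤ ρ)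
    (o x : HypSpace d) (k : ℕ) :
    P {ω | IsVoid o ρ x k (η ω)} ≤
      ENNReal.ofReal (voidDecay d (γ * ρ ^ d) k ^ 4) := by
  rw [voidDecay_pow_four]
  rcases le_or_gt k 1 with hk | hk
  · rw [Nat.sub_eq_zero_of_le hk]
    simpa using prob_le_one
  obtain ⟨j, rfl⟩ := Nat.exists_eq_add_of_lt hk
  have hradius : (((1 + j + 1 : ℕ) : ℝ) - 1) * ρ = ((1 + j : ℕ) : ℝ) * ρ := by push_cast; ring
  have hj : (1 : ℝ) ≤ ((1 + j : ℕ) : ℝ) := by exact_mod_cast Nat.le_add_right 1 j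
  refine (measure_mono fun ω h => h.2).trans
    ((hη.measure_void measurableSet_ball (hypIntensity_ball_ne_top γ _ _)).trans_le
      (ENNReal.ofReal_le_ofReal (Real.exp_le_exp.2 (neg_le_neg ?_))))
  rw [hradius, Nat.add_sub_cancel]
  have hβ : 0 ≤ volumeGrowth d * (γ * ρ ^ d) := by have := volumeGrowth_pos d; positivity
  exact (mul_le_mul_of_nonneg_left (pow_le_pow_right₀ hj hd) hβ).trans
    (le_toReal_hypIntensity_ball hd hγ hρ _ (by positivity))

end StoppingBalls

end HypSpace

theorem exists_pairwiseDisjoint_refinement {ι X : Type*} [MeasurableSpace X] (T : Finset ι)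
    {f : ι → Set X} (hf : ∀ i, MeasurableSet (f i)) :
    ∃ Q : ι → Set X, (∀ i, MeasurableSet (Q i)) ∧ (∀ i, Q i ⊆ f i) ∧
      (T : Set ι).PairwiseDisjoint Q ∧ ⋃ i ∈ T, Q i = ⋃ i ∈ T, f i := by
  classical
  let _ : LinearOrder ι := linearOrderOfSTO WellOrderingRel
  let earlier (i : ι) : Finset ι := T.filter (· < i)
  have hdisj {i j : ι} (hi : i ∈ T) (hij : i < j) :
      Disjoint (f i \ ⋃ l ∈ earlier i, f l) (f j \ ⋃ l ∈ earlier j, f l) :=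
    Set.disjoint_left.2 fun x hx hx' =>
      hx'.2 (Set.mem_biUnion (Finset.mem_filter.2 ⟨hi, hij⟩) hx.1)
  refine ⟨fun i => f i \ ⋃ l ∈ earlier i, f l,
    fun i => (hf i).diff (Finset.measurableSet_biUnion _ fun l _ => hf l),
    fun i => Set.sdiff_subset, fun i hi j hj hij => ?_,
    (Set.iUnion₂_mono fun i _ => Set.sdiff_subset).antisymm fun x hx => ?_⟩
  · exact hij.lt_or_gt.elim (hdisj hi) fun h => (hdisj hj h).symm
  · obtain ⟨i, hi, hxi⟩ := Set.mem_iUnion₂.1 hx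
    obtain ⟨m, hm, hmin⟩ := Finset.exists_min_image (T.filter (x ∈ f ·)) id
      ⟨i, Finset.mem_filter.2 ⟨hi, hxi⟩⟩
    rw [Finset.mem_filter] at hm
    refine Set.mem_biUnion hm.1 ⟨hm.2, fun hearlier => ?_⟩
    obtain ⟨l, hl, hxl⟩ := Set.mem_iUnion₂.1 hearlier
    rw [Finset.mem_filter] at hl
    exact (hmin l (Finset.mem_filter.2 ⟨hl.1, hxl⟩)).not_gt hl.2

section Covariance

variable {Ω : Type*} [MeasurableSpace Ω] {P : Measure Ω} {F F' : Ω → ℝ} {V V' : Set Ω}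

theorem setIntegral_mul_le_of_setIntegral_sq_le (hF : MemLp F 2 P) (hF' : MemLp F' 2 P)
    {D r : ℝ} (hr : 0 < r) (hFD : ∫ ω in V, F ω ^ 2 ∂P ≤ D * r ^ 2)
    (hFD' : ∫ ω, F' ω ^ 2 ∂P ≤ D) : ∫ ω in V, F ω * F' ω ∂P ≤ D * r := by
  have hsq : ∀ ω, F ω * F' ω ≤ (2 * r)⁻¹ * F ω ^ 2 + r / 2 * F' ω ^ 2 := fun ω => by
    have h : (2 * r)⁻¹ * F ω ^ 2 + r / 2 * F' ω ^ 2 - F ω * F' ω =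
        (2 * r)⁻¹ * (F ω - r * F' ω) ^ 2 := by
      field_simp
      ring
    have : 0 ≤ (2 * r)⁻¹ * (F ω - r * F' ω) ^ 2 := by positivity
    linarith
  have hsqF := (hF.integrable_sq.const_mul (2 * r)⁻¹).integrableOn (s := V)
  have hsqF' := (hF'.integrable_sq.const_mul (r / 2)).integrableOn (s := V)
  calc ∫ ω in V, F ω * F' ω ∂P
      ≤ ∫ ω in V, ((2 * r)⁻¹ * F ω ^ 2 + r / 2 * F' ω ^ 2) ∂P :=
        setIntegral_mono (hF.integrable_mul hF').integrableOn (hsqF.add hsqF') hsq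
    _ = (2 * r)⁻¹ * ∫ ω in V, F ω ^ 2 ∂P + r / 2 * ∫ ω in V, F' ω ^ 2 ∂P := by
        rw [integral_add hsqF hsqF', integral_const_mul, integral_const_mul]
    _ ≤ (2 * r)⁻¹ * (D * r ^ 2) + r / 2 * D := by
        gcongr
        exact (setIntegral_le_integral hF'.integrable_sq (.of_forall fun ω => sq_nonneg _)).trans
          hFD'
    _ = D * r := by
        field_simp
        ring

theorem covariance_le_of_indepFun_indicator_compl [IsProbabilityMeasure P] (hF : MemLp F 2 P)
    (hF' : MemLp F' 2 P) (hF0 : 0 ≤ F) (hF0' : 0 ≤ F') (hV : MeasurableSet V)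
    (hV' : MeasurableSet V') (hind : IndepFun (Vᶜ.indicator F) (V'ᶜ.indicator F') P) :
    cov[F, F'; P] ≤ ∫ ω in V, F ω * F' ω ∂P + ∫ ω in V', F' ω * F ω ∂P := by
  have iF := hF.integrable one_le_two
  have iF' := hF'.integrable one_le_two
  have iG := iF.indicator hV.compl
  have iG' := iF'.indicator hV'.compl
  have iV : Integrable (V.indicator fun ω => F ω * F' ω) P :=
    (hF.integrable_mul hF').indicator hV
  have iV' : Integrable (V'.indicator fun ω => F' ω * F ω) P :=
    (hF'.integrable_mul hF).indicator hV'
  have iGG : Integrable (fun ω => Vᶜ.indicator F ω * V'ᶜ.indicator F' ω) P :=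
    hind.integrable_mul iG iG'
  have hpoint : ∀ ω, F ω * F' ω ≤ Vᶜ.indicator F ω * V'ᶜ.indicator F' ω +
      (V.indicator (fun ω => F ω * F' ω) ω + V'.indicator (fun ω => F' ω * F ω) ω) := fun ω => by
    have h : 0 ≤ F ω * F' ω := mul_nonneg (hF0 ω) (hF0' ω)
    by_cases hω : ω ∈ V <;> by_cases hω' : ω ∈ V' <;> simp [hω, hω', mul_comm (F' ω), h]
  have hprod : ∫ ω, Vᶜ.indicator F ω * V'ᶜ.indicator F' ω ∂P ≤ (∫ ω, F ω ∂P) * ∫ ω, F' ω ∂P := by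
    rw [hind.integral_fun_mul_eq_mul_integral iG.1 iG'.1]
    exact mul_le_mul
      (integral_mono iG iF fun ω => Set.indicator_le_self' (fun _ _ => hF0 ω) ω)
      (integral_mono iG' iF' fun ω => Set.indicator_le_self' (fun _ _ => hF0' ω) ω)
      (integral_nonneg (Set.indicator_nonneg fun ω _ => hF0' ω)) (integral_nonneg hF0)
  have hmono := integral_mono (hF.integrable_mul hF') (iGG.add (iV.add iV')) hpoint
  rw [integral_add' iGG (iV.add iV'), integral_add' iV iV', integral_indicator hV,
    integral_indicator hV'] at hmono
  rw [covariance_eq_sub hF hF']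
  simp only [Pi.mul_apply] at hmono ⊢
  linarith

end Covariance

namespace IsPoissonProcess

variable {Ω X : Type*} [MeasurableSpace Ω] [MetricSpace X] [MeasurableSpace X]
  {P : Measure Ω} {η : Ω → Set X} {μ : Measure X}

theorem finite_inter_ball (h : IsPoissonProcess P η μ) (o : X) (ω : Ω) (r : ℝ) :
    (η ω ∩ Metric.ball o r).Finite :=
  h.locallyFinite ω _ Metric.isBounded_ball

variable [SecondCountableTopology X] [BorelSpace X] {o : X} {R : ℝ} {S : Set X}

theorem measurable_regionFunctional_inter (h : IsPoissonProcess P η μ) (α : ℝ) {B : Set X}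
    (hS : MeasurableSet S) (hSR : S ⊆ Metric.ball o R) (hB : MeasurableSet B) :
    Measurable[regionSigma η B] fun ω => regionFunctional o α S (η ω ∩ B) := by
  refine @_root_.measurable_regionFunctional _ _ (regionSigma η B) _ _ _ _ (fun ω => η ω ∩ B) S o α
    R hS hSR (fun ω r => ?_) fun A hA => ?_
  · exact (h.finite_inter_ball o ω r).subset (Set.inter_subset_inter_left _ Set.inter_subset_left)
  · simp_rw [Set.inter_assoc]
    exact measurable_count_regionSigma η (hB.inter hA) Set.inter_subset_left

theorem measurable_regionFunctional (h : IsPoissonProcess P η μ) (α : ℝ) (hS : MeasurableSet S)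
    (hSR : S ⊆ Metric.ball o R) : Measurable fun ω => regionFunctional o α S (η ω) :=
  _root_.measurable_regionFunctional α hS hSR (h.finite_inter_ball o) h.measurable_count

end IsPoissonProcess

namespace HypSpace

section CellMoments

variable {d : ℕ} [NeZero d] {o x : HypSpace d} {α ρ γ : ℝ} {Q ξ : Set (HypSpace d)} {Ω : Type*}
  [MeasurableSpace Ω] {P : Measure Ω} {η : Ω → Set (HypSpace d)}

theorem summable_exp_mul_voidDecay (d : ℕ) {β : ℝ} (hβ : 0 < β) (b : ℝ) :
    Summable fun k : ℕ => Real.exp (b * k) * voidDecay d β k := by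
  have ha : 0 < volumeGrowth d * β / 4 := by have := volumeGrowth_pos d; positivity
  generalize hb : |b| + 1 = B
  refine .of_nonneg_of_le (fun k => mul_nonneg (Real.exp_pos _).le (voidDecay_pos d β k).le)
    (fun k => ?_) (Real.summable_exp_neg_nat.mul_left
      (Real.exp (B + B ^ 2 / (4 * (volumeGrowth d * β / 4)))))
  rw [voidDecay, ← Real.exp_add, ← Real.exp_add, Real.exp_le_exp]
  generalize volumeGrowth d * β / 4 = a at ha
  have hk : (k : ℝ) ≤ ((k - 1 : ℕ) : ℝ) + 1 := by exact_mod_cast le_tsub_add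
  have hB : 0 ≤ B := hb ▸ by positivity
  have hsquare : B * ((k - 1 : ℕ) : ℝ) - a * ((k - 1 : ℕ) : ℝ) ^ 2 ≤ B ^ 2 / (4 * a) := by
    rw [le_div_iff₀ (by positivity)]
    nlinarith [sq_nonneg (2 * a * ((k - 1 : ℕ) : ℝ) - B)]
  nlinarith [mul_le_mul_of_nonneg_left hk hB, le_abs_self b, Nat.cast_nonneg (α := ℝ) k]

theorem summable_rpow_mul_voidDecay_sq (d : ℕ) {α β : ℝ} (hα : 0 ≤ α) (hβ : 0 < β) :
    Summable fun k : ℕ => (2 * ((k : ℝ) + 1)) ^ (2 * α) * voidDecay d β k ^ 2 := by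
  refine .of_nonneg_of_le (fun k => by positivity) (fun k => ?_)
    ((summable_exp_mul_voidDecay d hβ (2 * α)).mul_left (2 ^ (2 * α)))
  have hexp : ((k : ℝ) + 1) ^ (2 * α) ≤ Real.exp (2 * α * k) := by
    rw [mul_comm (2 * α), Real.exp_mul]
    exact Real.rpow_le_rpow (by positivity) (Real.add_one_le_exp _) (by positivity)
  have hdecay : voidDecay d β k ≤ 1 := by
    have := volumeGrowth_pos d
    exact Real.exp_le_one_iff.2 (neg_nonpos.2 (by positivity))
  rw [Real.mul_rpow two_pos.le (by positivity), mul_assoc]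
  gcongr
  exact pow_le_of_le_one (voidDecay_pos d β k).le hdecay two_ne_zero

/-- A bound for the second moment of the number of points in a ball of radius at most `1`, for a
process with `β` points per cell on average. -/
def countMoment (d : ℕ) (β : ℝ) : ℝ := Real.exp (3 * (unitBallVolume d * β * Real.exp 2 ^ d))

/-- A bound for the second moment of the contribution of a cell to the edge-length functional, in
units of the cell size, for a process with `β` points per cell on average. -/
def cellMoment (d : ℕ) (α β : ℝ) : ℝ :=
  countMoment d β * ∑' k : ℕ, (2 * ((k : ℝ) + 1)) ^ (2 * α) * voidDecay d β k ^ 2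

theorem cellMoment_pos (d : ℕ) {α β : ℝ} (hα : 0 ≤ α) (hβ : 0 < β) : 0 < cellMoment d α β := by
  have hpos (k : ℕ) : 0 < (2 * ((k : ℝ) + 1)) ^ (2 * α) * voidDecay d β k ^ 2 := by
    have := voidDecay_pos d β k
    positivity
  exact mul_pos (Real.exp_pos _)
    ((summable_rpow_mul_voidDecay_sq d hα hβ).tsum_pos (fun k => (hpos k).le) 0 (hpos 0))

theorem sq_regionFunctional_le (hα : 0 ≤ α) (hρ : 0 < ρ)
    (hξ : ∀ r, (ξ ∩ Metric.ball o r).Finite) (hQ : Q ⊆ Metric.ball x ρ) :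
    ∃ k : ℕ, IsVoid o ρ x k ξ ∧ ENNReal.ofReal (regionFunctional o α Q ξ) ^ 2 ≤
      ENNReal.ofReal ((2 * (k + 1) * ρ) ^ (2 * α)) *
        ((ξ ∩ Metric.ball x ρ).encard : ENNReal) ^ 2 := by
  obtain ⟨k, hk, hk1⟩ := exists_isVoid_not_isVoid_succ hρ o x ξ
  have hfin : (ξ ∩ Q).Finite := (hξ (ρ + dist x o)).subset
    (Set.inter_subset_inter_right _ (hQ.trans (Metric.ball_subset_ball' le_rfl)))
  have hedge : ∀ y ∈ ξ ∩ Q, radialEdgeLength o ξ y ≤ 2 * (k + 1) * ρ := fun y hy =>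
    mod_cast (radialEdgeLength_lt_of_not_isVoid hρ hξ hk1 (hQ hy.2)).le
  refine ⟨k, hk, ?_⟩
  calc ENNReal.ofReal (regionFunctional o α Q ξ) ^ 2
      ≤ (((ξ ∩ Q).encard : ENNReal) * ENNReal.ofReal ((2 * (k + 1) * ρ) ^ α)) ^ 2 := by
        gcongr
        exact ofReal_regionFunctional_le hα hfin hedge
    _ ≤ (((ξ ∩ Metric.ball x ρ).encard : ENNReal) *
          ENNReal.ofReal ((2 * (k + 1) * ρ) ^ α)) ^ 2 := by gcongr
    _ = _ := by
        rw [mul_pow, mul_comm, ← ENNReal.ofReal_pow (by positivity), mul_comm 2 α,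
          Real.rpow_mul (by positivity), Real.rpow_two]

theorem lintegral_count_ball_sq_le (hη : IsPoissonProcess P η (ENNReal.ofReal γ • hypVolume d))
    (hγ : 0 ≤ γ) (hρ : 0 ≤ ρ) (hρ1 : ρ ≤ 1) (x : HypSpace d) :
    ∫⁻ ω, ((η ω ∩ Metric.ball x ρ).encard : ENNReal) ^ 2 ∂P ≤
      ENNReal.ofReal (countMoment d (γ * ρ ^ d)) := by
  have hvol := toReal_hypIntensity_ball_le (d := d) hγ hρ hρ1 x zero_le_one
  rw [one_mul, one_mul, mul_one] at hvol
  exact (hη.lintegral_count_sq_le measurableSet_ball (hypIntensity_ball_ne_top γ x ρ)).trans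
    (ENNReal.ofReal_le_ofReal (Real.exp_le_exp.2 (by gcongr)))

theorem measure_isVoid_inter_isVoid_le [IsProbabilityMeasure P] (hd : 2 ≤ d)
    (hη : IsPoissonProcess P η (ENNReal.ofReal γ • hypVolume d)) (hγ : 0 ≤ γ) (hρ : 0 ≤ ρ)
    (o x : HypSpace d) (j k : ℕ) :
    P ({ω | IsVoid o ρ x j (η ω)} ∩ {ω | IsVoid o ρ x k (η ω)}) ≤
      ENNReal.ofReal (voidDecay d (γ * ρ ^ d) j ^ 2 * voidDecay d (γ * ρ ^ d) k ^ 2) := by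
  have hj := (voidDecay_pos d (γ * ρ ^ d) j).le
  have hk := (voidDecay_pos d (γ * ρ ^ d) k).le
  rcases le_total (voidDecay d (γ * ρ ^ d) j) (voidDecay d (γ * ρ ^ d) k) with h | h
  · calc _ ≤ ENNReal.ofReal (voidDecay d (γ * ρ ^ d) j ^ 4) :=
          (measure_mono Set.inter_subset_left).trans (measure_isVoid_le hd hη hγ hρ o x j)
      _ ≤ _ := ENNReal.ofReal_le_ofReal (by rw [pow_add _ 2 2]; gcongr)
  · calc _ ≤ ENNReal.ofReal (voidDecay d (γ * ρ ^ d) k ^ 4) :=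
          (measure_mono Set.inter_subset_right).trans (measure_isVoid_le hd hη hγ hρ o x k)
      _ ≤ _ := ENNReal.ofReal_le_ofReal (by rw [pow_add _ 2 2]; gcongr)

/-- The void events at `x` depend only on the points outside the ball around `x`, hence they are
independent of the number of points in this ball. -/
theorem setLIntegral_isVoid_count_sq [IsProbabilityMeasure P] {μ : Measure (HypSpace d)}
    (hη : IsPoissonProcess P η μ) (hρ : 0 ≤ ρ) (o x : HypSpace d) (j k : ℕ) :
    ∫⁻ ω in {ω | IsVoid o ρ x j (η ω)} ∩ {ω | IsVoid o ρ x k (η ω)},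
        ((η ω ∩ Metric.ball x ρ).encard : ENNReal) ^ 2 ∂P =
      P ({ω | IsVoid o ρ x j (η ω)} ∩ {ω | IsVoid o ρ x k (η ω)}) *
        ∫⁻ ω, ((η ω ∩ Metric.ball x ρ).encard : ENNReal) ^ 2 ∂P := by
  have hvoid (k : ℕ) :
      MeasurableSet[regionSigma η (Metric.ball x ρ)ᶜ] {ω | IsVoid o ρ x k (η ω)} :=
    measurableSet_isVoid (disjoint_stopBall hρ).subset_compl_right
  have hinter := @MeasurableSet.inter _ (_) _ _ (hvoid j) (hvoid k)
  have hcount : Measurable[regionSigma η (Metric.ball x ρ)] fun ω =>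
      ((η ω ∩ Metric.ball x ρ).encard : ENNReal) ^ 2 :=
    (measurable_of_countable (fun n : ℕ∞ => (n : ENNReal) ^ 2)).comp
      (measurable_count_regionSigma η measurableSet_ball subset_rfl)
  have hind := hη.indep_regionSigma (measurableSet_ball (x := x) (ε := ρ)).compl
    measurableSet_ball disjoint_compl_left
  have hmul := lintegral_mul_eq_lintegral_mul_lintegral_of_independent_measurableSpace
    (hη.regionSigma_le _) (hη.regionSigma_le _) hind
    (@Measurable.indicator _ _ (_) _ _ _ _ (@measurable_const _ _ _ (_) (1 : ENNReal)) hinter)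
    hcount
  have hinter' := hη.regionSigma_le _ _ hinter
  rw [lintegral_indicator_const hinter', one_mul] at hmul
  rw [← hmul, ← lintegral_indicator hinter']
  classical
  refine lintegral_congr fun ω => ?_
  rw [Set.indicator_apply, Set.indicator_apply, ite_mul, one_mul, zero_mul]

theorem measurableSet_isVoid_of_isPoissonProcess {μ : Measure (HypSpace d)}
    (hη : IsPoissonProcess P η μ) (o : HypSpace d) (ρ : ℝ) (x : HypSpace d) (k : ℕ) :
    MeasurableSet {ω | IsVoid o ρ x k (η ω)} :=
  hη.regionSigma_le Set.univ _ (measurableSet_isVoid (Set.subset_univ _))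

theorem setLIntegral_sq_regionFunctional_le [IsProbabilityMeasure P] (hd : 2 ≤ d)
    (hη : IsPoissonProcess P η (ENNReal.ofReal γ • hypVolume d)) (hα : 0 ≤ α) (hγ : 0 < γ)
    (hρ : 0 < ρ) (hρ1 : ρ ≤ 1) (hQ : Q ⊆ Metric.ball x ρ) (j : ℕ) :
    ∫⁻ ω in {ω | IsVoid o ρ x j (η ω)}, ENNReal.ofReal (regionFunctional o α Q (η ω)) ^ 2 ∂P ≤
      ENNReal.ofReal (cellMoment d α (γ * ρ ^ d) * ρ ^ (2 * α) *
        voidDecay d (γ * ρ ^ d) j ^ 2) := by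
  let V (k : ℕ) : Set Ω := {ω | IsVoid o ρ x k (η ω)}
  let N (ω : Ω) : ENNReal := ((η ω ∩ Metric.ball x ρ).encard : ENNReal) ^ 2
  let w (k : ℕ) : ENNReal := ENNReal.ofReal ((2 * (k + 1) * ρ) ^ (2 * α))
  have hV (k : ℕ) : MeasurableSet (V k) := measurableSet_isVoid_of_isPoissonProcess hη o ρ x k
  have hN : Measurable N := (measurable_of_countable (fun n : ℕ∞ => (n : ENNReal) ^ 2)).comp
    (hη.measurable_count _ measurableSet_ball)
  generalize hβ : γ * ρ ^ d = β
  have hβ0 : 0 < β := hβ ▸ by positivity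
  calc ∫⁻ ω in V j, ENNReal.ofReal (regionFunctional o α Q (η ω)) ^ 2 ∂P
      ≤ ∫⁻ ω in V j, ∑' k, (V k).indicator (fun ω => w k * N ω) ω ∂P := by
        refine lintegral_mono fun ω => ?_
        obtain ⟨k, hk, hle⟩ := sq_regionFunctional_le hα hρ (hη.finite_inter_ball o ω) hQ
        refine (hle.trans_eq ?_).trans (ENNReal.le_tsum k)
        exact (Set.indicator_of_mem (show ω ∈ V k from hk) fun ω => w k * N ω).symm
    _ = ∑' k, w k * ∫⁻ ω in V k ∩ V j, N ω ∂P := by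
        rw [lintegral_tsum fun k => ((hN.const_mul _).indicator (hV k)).aemeasurable]
        simp_rw [setLIntegral_indicator (hV _), lintegral_const_mul _ hN]
    _ ≤ ∑' k : ℕ, w k * (ENNReal.ofReal (voidDecay d β k ^ 2 * voidDecay d β j ^ 2) *
          ENNReal.ofReal (countMoment d β)) := by
        refine ENNReal.tsum_le_tsum fun k => ?_
        rw [setLIntegral_isVoid_count_sq hη hρ.le, ← hβ]
        gcongr
        · exact measure_isVoid_inter_isVoid_le hd hη hγ.le hρ.le o x k j
        · exact lintegral_count_ball_sq_le hη hγ.le hρ.le hρ1 x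
    _ = ∑' k : ℕ, ENNReal.ofReal (countMoment d β * ρ ^ (2 * α) * voidDecay d β j ^ 2 *
          ((2 * ((k : ℝ) + 1)) ^ (2 * α) * voidDecay d β k ^ 2)) := by
        refine tsum_congr fun k => ?_
        rw [← ENNReal.ofReal_mul (by positivity), ← ENNReal.ofReal_mul (by positivity),
          Real.mul_rpow (by positivity) hρ.le]
        ring_nf
    _ = ENNReal.ofReal (cellMoment d α β * ρ ^ (2 * α) * voidDecay d β j ^ 2) := by
        have hcount : 0 < countMoment d β := Real.exp_pos _
        rw [← ENNReal.ofReal_tsum_of_nonneg (fun k => by positivity)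
          ((summable_rpow_mul_voidDecay_sq d hα hβ0).mul_left _), tsum_mul_left, cellMoment]
        ring_nf

end CellMoments

section CellCovariance

variable {d : ℕ} [NeZero d] {o x y : HypSpace d} {α ρ γ : ℝ} {Q Q' : Set (HypSpace d)}
  {Ω : Type*} [MeasurableSpace Ω] {P : Measure Ω} {η : Ω → Set (HypSpace d)}

theorem measurable_regionFunctional_of_subset_ball {μ : Measure (HypSpace d)}
    (hη : IsPoissonProcess P η μ) (o : HypSpace d) (α : ℝ) (hQm : MeasurableSet Q)
    (hQ : Q ⊆ Metric.ball x ρ) : Measurable fun ω => regionFunctional o α Q (η ω) :=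
  hη.measurable_regionFunctional α hQm (hQ.trans (Metric.ball_subset_ball' le_rfl))

theorem regionFunctional_inter_ball_of_not_isVoid {ξ : Set (HypSpace d)} {k : ℕ} (hρ : 0 < ρ)
    (hξ : ∀ r, (ξ ∩ Metric.ball o r).Finite) (hQ : Q ⊆ Metric.ball x ρ)
    (hk : ¬ IsVoid o ρ x k ξ) :
    regionFunctional o α Q (ξ ∩ Metric.ball x ((2 * k + 1) * ρ)) = regionFunctional o α Q ξ := by
  have hball : Metric.ball x ρ ⊆ Metric.ball x ((2 * k + 1) * ρ) :=
    Metric.ball_subset_ball (by nlinarith [Nat.cast_nonneg (α := ℝ) k])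
  rw [regionFunctional, regionFunctional, Set.inter_assoc,
    Set.inter_eq_self_of_subset_right (hQ.trans hball)]
  refine finsum_mem_congr rfl fun z hz => ?_
  congr 1
  refine radialEdgeLength_eq_of_inter_subset hξ Set.inter_subset_left
    (radialEdgeLength_lt_of_not_isVoid hρ hξ hk (hQ hz.2)) fun v hv _ hzv => ⟨hv, ?_⟩
  have hzx : dist z x < ρ := hQ hz.2
  rw [Metric.mem_ball]
  linarith [dist_triangle_left v x z]

theorem measurable_indicator_regionFunctional {μ : Measure (HypSpace d)}
    (hη : IsPoissonProcess P η μ) (o : HypSpace d) (α : ℝ) (hρ : 0 < ρ) (hQm : MeasurableSet Q)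
    (hQ : Q ⊆ Metric.ball x ρ) (k : ℕ) :
    Measurable[regionSigma η (Metric.ball x ((2 * k + 1) * ρ))]
      ({ω | IsVoid o ρ x k (η ω)}ᶜ.indicator fun ω => regionFunctional o α Q (η ω)) := by
  have hlocal : ({ω | IsVoid o ρ x k (η ω)}ᶜ.indicator fun ω => regionFunctional o α Q (η ω)) =
      {ω | IsVoid o ρ x k (η ω)}ᶜ.indicator fun ω =>
        regionFunctional o α Q (η ω ∩ Metric.ball x ((2 * k + 1) * ρ)) :=
    Set.indicator_congr fun ω hω =>
      (regionFunctional_inter_ball_of_not_isVoid hρ (hη.finite_inter_ball o ω) hQ hω).symm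
  rw [hlocal]
  exact @Measurable.indicator _ _ (_) _ _ _ _
    (hη.measurable_regionFunctional_inter α hQm (hQ.trans (Metric.ball_subset_ball' le_rfl))
      measurableSet_ball)
    (@MeasurableSet.compl _ _ (_) (measurableSet_isVoid (stopBall_subset hρ.le)))

variable [IsProbabilityMeasure P]

theorem memLp_regionFunctional (hd : 2 ≤ d)
    (hη : IsPoissonProcess P η (ENNReal.ofReal γ • hypVolume d)) (hα : 0 ≤ α) (hγ : 0 < γ)
    (hρ : 0 < ρ) (hρ1 : ρ ≤ 1) (hQm : MeasurableSet Q) (hQ : Q ⊆ Metric.ball x ρ) :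
    MemLp (fun ω => regionFunctional o α Q (η ω)) 2 P := by
  have hmeas := measurable_regionFunctional_of_subset_ball hη o α hQm hQ
  have hle := setLIntegral_sq_regionFunctional_le (o := o) hd hη hα hγ hρ hρ1 hQ 0
  rw [setOf_isVoid_zero hρ.le η, Measure.restrict_univ] at hle
  refine (memLp_two_iff_integrable_sq hmeas.aestronglyMeasurable).2
    ⟨(hmeas.pow_const 2).aestronglyMeasurable, ?_⟩
  rw [hasFiniteIntegral_iff_ofReal (.of_forall fun ω => sq_nonneg _)]
  simp_rw [ENNReal.ofReal_pow (regionFunctional_nonneg o α Q _)]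
  exact hle.trans_lt ENNReal.ofReal_lt_top

theorem setIntegral_sq_regionFunctional_le (hd : 2 ≤ d)
    (hη : IsPoissonProcess P η (ENNReal.ofReal γ • hypVolume d)) (hα : 0 ≤ α) (hγ : 0 < γ)
    (hρ : 0 < ρ) (hρ1 : ρ ≤ 1) (hQm : MeasurableSet Q) (hQ : Q ⊆ Metric.ball x ρ) (k : ℕ) :
    ∫ ω in {ω | IsVoid o ρ x k (η ω)}, regionFunctional o α Q (η ω) ^ 2 ∂P ≤
      cellMoment d α (γ * ρ ^ d) * ρ ^ (2 * α) * voidDecay d (γ * ρ ^ d) k ^ 2 := by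
  have hD := cellMoment_pos d hα (show 0 < γ * ρ ^ d by positivity)
  have hmeas := measurable_regionFunctional_of_subset_ball hη o α hQm hQ
  rw [integral_eq_lintegral_of_nonneg_ae (.of_forall fun ω => sq_nonneg _)
    (hmeas.pow_const 2).aestronglyMeasurable]
  simp_rw [ENNReal.ofReal_pow (regionFunctional_nonneg o α Q _)]
  exact ENNReal.toReal_le_of_le_ofReal (by positivity)
    (setLIntegral_sq_regionFunctional_le hd hη hα hγ hρ hρ1 hQ k)

theorem setIntegral_mul_regionFunctional_le (hd : 2 ≤ d)
    (hη : IsPoissonProcess P η (ENNReal.ofReal γ • hypVolume d)) (hα : 0 ≤ α) (hγ : 0 < γ)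
    (hρ : 0 < ρ) (hρ1 : ρ ≤ 1) (hQm : MeasurableSet Q) (hQ : Q ⊆ Metric.ball x ρ)
    (hQm' : MeasurableSet Q') (hQ' : Q' ⊆ Metric.ball y ρ) (k : ℕ) :
    ∫ ω in {ω | IsVoid o ρ x k (η ω)},
        regionFunctional o α Q (η ω) * regionFunctional o α Q' (η ω) ∂P ≤
      cellMoment d α (γ * ρ ^ d) * ρ ^ (2 * α) * voidDecay d (γ * ρ ^ d) k := by
  have hQ'D := setIntegral_sq_regionFunctional_le (o := o) hd hη hα hγ hρ hρ1 hQm' hQ' 0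
  rw [setOf_isVoid_zero hρ.le η, Measure.restrict_univ, voidDecay_zero, one_pow, mul_one] at hQ'D
  exact setIntegral_mul_le_of_setIntegral_sq_le
    (memLp_regionFunctional hd hη hα hγ hρ hρ1 hQm hQ)
    (memLp_regionFunctional hd hη hα hγ hρ hρ1 hQm' hQ') (voidDecay_pos d _ k)
    (setIntegral_sq_regionFunctional_le hd hη hα hγ hρ hρ1 hQm hQ k) hQ'D

theorem covariance_regionFunctional_le (hd : 2 ≤ d)
    (hη : IsPoissonProcess P η (ENNReal.ofReal γ • hypVolume d)) (hα : 0 ≤ α) (hγ : 0 < γ)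
    (hρ : 0 < ρ) (hρ1 : ρ ≤ 1) (hQm : MeasurableSet Q) (hQ : Q ⊆ Metric.ball x ρ)
    (hQm' : MeasurableSet Q') (hQ' : Q' ⊆ Metric.ball y ρ) :
    cov[fun ω => regionFunctional o α Q (η ω), fun ω => regionFunctional o α Q' (η ω); P] ≤
      2 * (cellMoment d α (γ * ρ ^ d) * ρ ^ (2 * α)) *
        voidDecay d (γ * ρ ^ d) ⌊dist x y / (6 * ρ)⌋₊ := by
  generalize hk : ⌊dist x y / (6 * ρ)⌋₊ = k
  have hind : IndepFun
      ({ω | IsVoid o ρ x k (η ω)}ᶜ.indicator fun ω => regionFunctional o α Q (η ω))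
      ({ω | IsVoid o ρ y k (η ω)}ᶜ.indicator fun ω => regionFunctional o α Q' (η ω)) P := by
    rcases Nat.eq_zero_or_pos k with rfl | hk0
    · simp only [setOf_isVoid_zero hρ.le η, Set.compl_univ, Set.indicator_empty]
      exact indepFun_const_left _ _
    · have hk1 : (1 : ℝ) ≤ k := by exact_mod_cast hk0
      have hfloor := Nat.floor_le (show 0 ≤ dist x y / (6 * ρ) by positivity)
      rw [hk, le_div_iff₀ (by positivity)] at hfloor
      have hdisj : Disjoint (Metric.ball x ((2 * k + 1) * ρ)) (Metric.ball y ((2 * k + 1) * ρ)) :=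
        Metric.ball_disjoint_ball (by nlinarith)
      rw [IndepFun_iff_Indep]
      exact indep_of_indep_of_le
        (hη.indep_regionSigma measurableSet_ball measurableSet_ball hdisj)
        (measurable_indicator_regionFunctional hη o α hρ hQm hQ k).comap_le
        (measurable_indicator_regionFunctional hη o α hρ hQm' hQ' k).comap_le
  have hcov := covariance_le_of_indepFun_indicator_compl
    (memLp_regionFunctional hd hη hα hγ hρ hρ1 hQm hQ)
    (memLp_regionFunctional hd hη hα hγ hρ hρ1 hQm' hQ')
    (fun ω => regionFunctional_nonneg o α Q (η ω)) (fun ω => regionFunctional_nonneg o α Q' (η ω))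
    (measurableSet_isVoid_of_isPoissonProcess hη o ρ x k)
    (measurableSet_isVoid_of_isPoissonProcess hη o ρ y k) hind
  linarith [setIntegral_mul_regionFunctional_le (o := o) hd hη hα hγ hρ hρ1 hQm hQ hQm' hQ' k,
    setIntegral_mul_regionFunctional_le (o := o) hd hη hα hγ hρ hρ1 hQm' hQ' hQm hQ k]

end CellCovariance

section UpperBound

variable {d : ℕ} [NeZero d] {o : HypSpace d} {α ρ γ R : ℝ} {T : Finset (HypSpace d)}
  {Q : HypSpace d → Set (HypSpace d)}

/-- The factor by which the covariances of a cell with all cells exceed the second moment of a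
cell, for a process with `β` points per cell on average: the rates at which the covariances decay,
weighted with the numbers of cells at the corresponding distances. -/
def shellSum (d : ℕ) (β : ℝ) : ℝ :=
  unitBallVolume d / volumeGrowth d * (14 * Real.exp 14) ^ d *
    ∑' k : ℕ, Real.exp (13 * d * k) * voidDecay d β k

theorem shellSum_pos (d : ℕ) {β : ℝ} (hβ : 0 < β) : 0 < shellSum d β := by
  have := volumeGrowth_pos d
  have := unitBallVolume_pos d
  have hpos (k : ℕ) : 0 < Real.exp (13 * d * k) * voidDecay d β k :=
    mul_pos (Real.exp_pos _) (voidDecay_pos d β k)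
  have := (summable_exp_mul_voidDecay d hβ (13 * d)).tsum_pos (fun k => (hpos k).le) 0 (hpos 0)
  unfold shellSum
  positivity

theorem card_shell_le (hd : 2 ≤ d) (hρ : 0 < ρ) (hρ1 : ρ ≤ 1)
    (hT : (T : Set (HypSpace d)).Pairwise fun y z => ρ ≤ dist y z) (x : HypSpace d) (k : ℕ) :
    ((T.filter fun y => ⌊dist x y / (6 * ρ)⌋₊ = k).card : ℝ) ≤
      unitBallVolume d / volumeGrowth d * (14 * Real.exp 14) ^ d * Real.exp (13 * d * k) := by
  have hgrowth := volumeGrowth_pos d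
  have hunit := unitBallVolume_pos d
  set shell := T.filter fun y => ⌊dist x y / (6 * ρ)⌋₊ = k
  have hshell : ↑shell ⊆ Metric.ball x ((k + 1) * (6 * ρ)) := fun y hy => by
    have hlt := Nat.lt_floor_add_one (dist x y / (6 * ρ))
    rw [(Finset.mem_filter.1 hy).2, div_lt_iff₀ (by positivity)] at hlt
    exact Metric.mem_ball'.2 hlt
  have hcard := (card_mul_le_of_separated hd hρ.le
    (hT.mono (Finset.coe_subset.2 (Finset.filter_subset _ _))) hshell).trans
    (hypVolume_ball_le x (by positivity))
  rw [← ENNReal.ofReal_natCast, ← ENNReal.ofReal_mul (by positivity),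
    ENNReal.ofReal_le_ofReal_iff (by positivity)] at hcard
  set s := (k + 1) * (6 * ρ) + ρ / 2 with hs
  have hradius : s * Real.exp (2 * s) ≤ ρ / 2 * (14 * Real.exp 14 * Real.exp (13 * k)) := by
    have hexp : (k : ℝ) + 1 ≤ Real.exp k := Real.add_one_le_exp _
    calc s * Real.exp (2 * s) ≤ (7 * Real.exp k * ρ) * Real.exp (12 * k + 14) := by
          gcongr <;> nlinarith [Nat.cast_nonneg (α := ℝ) k]
      _ = ρ / 2 * (14 * Real.exp 14 * Real.exp (13 * k)) := by
          rw [Real.exp_add, show (13 : ℝ) * k = k + 12 * k by ring, Real.exp_add]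
          ring
  have hexp : Real.exp (13 * d * k) = Real.exp (13 * k) ^ d := by
    rw [← Real.exp_nat_mul]
    ring_nf
  have hpos : 0 < volumeGrowth d * (ρ / 2) ^ d := by positivity
  refine le_of_mul_le_mul_right ?_ hpos
  calc (shell.card : ℝ) * (volumeGrowth d * (ρ / 2) ^ d)
      ≤ unitBallVolume d * (ρ / 2 * (14 * Real.exp 14 * Real.exp (13 * k))) ^ d :=
        hcard.trans (by gcongr)
    _ = _ := by
        rw [mul_pow, mul_pow (14 * Real.exp 14), ← hexp]
        field_simp

theorem sum_voidDecay_le {β : ℝ} (hd : 2 ≤ d) (hβ : 0 < β) (hρ : 0 < ρ) (hρ1 : ρ ≤ 1)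
    (hT : (T : Set (HypSpace d)).Pairwise fun y z => ρ ≤ dist y z) (x : HypSpace d) :
    ∑ y ∈ T, voidDecay d β ⌊dist x y / (6 * ρ)⌋₊ ≤ shellSum d β := by
  classical
  have := volumeGrowth_pos d
  have := unitBallVolume_pos d
  let shells := T.image fun y => ⌊dist x y / (6 * ρ)⌋₊
  rw [Finset.sum_comp (voidDecay d β) fun y => ⌊dist x y / (6 * ρ)⌋₊, shellSum]
  calc ∑ k ∈ shells, (T.filter fun y => ⌊dist x y / (6 * ρ)⌋₊ = k).card • voidDecay d β k
      ≤ ∑ k ∈ shells, unitBallVolume d / volumeGrowth d * (14 * Real.exp 14) ^ d *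
          (Real.exp (13 * d * k) * voidDecay d β k) := by
        refine Finset.sum_le_sum fun k _ => ?_
        rw [nsmul_eq_mul, ← mul_assoc]
        exact mul_le_mul_of_nonneg_right (card_shell_le hd hρ hρ1 hT x k) (voidDecay_pos d β k).le
    _ = unitBallVolume d / volumeGrowth d * (14 * Real.exp 14) ^ d *
          ∑ k ∈ shells, Real.exp (13 * d * k) * voidDecay d β k := by rw [Finset.mul_sum]
    _ ≤ _ := by
        gcongr
        exact (summable_exp_mul_voidDecay d hβ (13 * d)).sum_le_tsum _ fun k _ =>
          (mul_pos (Real.exp_pos _) (voidDecay_pos d β k)).le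

/-- A decomposition of the ball of radius `R` into measurable cells `Q y` of size `ρ` around the
points `y` of a separated net `T`. -/
structure IsCellDecomposition (o : HypSpace d) (ρ R : ℝ) (T : Finset (HypSpace d))
    (Q : HypSpace d → Set (HypSpace d)) : Prop where
  isSeparatedNet : IsSeparatedNet ρ (Metric.ball o R) T
  measurableSet : ∀ y, MeasurableSet (Q y)
  subset_ball : ∀ y, Q y ⊆ Metric.ball y ρ
  pairwiseDisjoint : (T : Set (HypSpace d)).PairwiseDisjoint Q
  iUnion_eq : ⋃ y ∈ T, Q y = Metric.ball o R

theorem exists_isCellDecomposition (hd : 2 ≤ d) (hρ : 0 < ρ) (o : HypSpace d) (R : ℝ) :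
    ∃ T Q, IsCellDecomposition o ρ R T Q := by
  obtain ⟨T, hT⟩ := exists_isSeparatedNet_of_subset_ball (A := Metric.ball o R) hd hρ subset_rfl
  obtain ⟨Q, hQm, hQsub, hQdisj, hQU⟩ := exists_pairwiseDisjoint_refinement T
    (f := fun y => Metric.ball y ρ ∩ Metric.ball o R)
    fun y => measurableSet_ball.inter measurableSet_ball
  refine ⟨T, Q, hT, hQm, fun y => (hQsub y).trans Set.inter_subset_left, hQdisj, ?_⟩
  rw [hQU]
  refine (Set.iUnion₂_subset fun _ _ => Set.inter_subset_right).antisymm fun x hx => ?_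
  obtain ⟨y, hy, hxy⟩ := hT.exists_dist_lt x hx
  exact Set.mem_biUnion (Finset.mem_coe.2 hy) ⟨hxy, hx⟩

theorem IsCellDecomposition.edgeLengthFunctional_eq (h : IsCellDecomposition o ρ R T Q)
    {ξ : Set (HypSpace d)} (hξ : ∀ r, (ξ ∩ Metric.ball o r).Finite) :
    edgeLengthFunctional o α R ξ = ∑ y ∈ T, regionFunctional o α (Q y) ξ := by
  rw [_root_.edgeLengthFunctional_eq, ← h.iUnion_eq]
  refine regionFunctional_biUnion T Q (fun y hy => (hξ R).subset ?_) h.pairwiseDisjoint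
  exact Set.inter_subset_inter_right _ (h.iUnion_eq ▸ Set.subset_biUnion_of_mem hy)

theorem IsCellDecomposition.card_mul_le (h : IsCellDecomposition o ρ R T Q) (hd : 2 ≤ d)
    (hρ : 0 ≤ ρ) (hR : ρ ≤ 2 * R) :
    (T.card : ℝ) * (volumeGrowth d * (ρ / 4) ^ d) ≤ ballVolume o R := by
  have hgrowth := volumeGrowth_pos d
  have hcard := ENNReal.toReal_mono (hypVolume_ball_lt_top o R).ne
    (card_mul_le_of_separated_of_subset_ball hd hρ hR h.isSeparatedNet.subset
      h.isSeparatedNet.separated)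
  rwa [ENNReal.toReal_mul, ENNReal.toReal_ofReal (by positivity), ENNReal.toReal_natCast] at hcard

variable {Ω : Type*} [MeasurableSpace Ω] {P : Measure Ω} [IsProbabilityMeasure P]
  {η : Ω → Set (HypSpace d)}

theorem memLp_edgeLengthFunctional (hd : 2 ≤ d)
    (hη : IsPoissonProcess P η (ENNReal.ofReal γ • hypVolume d)) (hα : 0 ≤ α) (hγ : 0 < γ)
    (o : HypSpace d) (R : ℝ) : MemLp (fun ω => edgeLengthFunctional o α R (η ω)) 2 P := by
  obtain ⟨T, Q, hQ⟩ := exists_isCellDecomposition hd one_pos o R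
  simp_rw [hQ.edgeLengthFunctional_eq (hη.finite_inter_ball o _)]
  exact memLp_finsetSum _ fun y _ =>
    memLp_regionFunctional hd hη hα hγ one_pos le_rfl (hQ.measurableSet y) (hQ.subset_ball y)

/-- The constant in the upper bound for the variance, for a process with `β` points per cell on
average. -/
def varianceUpperConst (d : ℕ) (α β : ℝ) : ℝ :=
  2 * cellMoment d α β * shellSum d β / (volumeGrowth d * (1 / 4) ^ d)

theorem varianceUpperConst_pos (d : ℕ) {β : ℝ} (hα : 0 ≤ α) (hβ : 0 < β) :
    0 < varianceUpperConst d α β := by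
  have := cellMoment_pos d hα hβ
  have := shellSum_pos d hβ
  have := volumeGrowth_pos d
  unfold varianceUpperConst
  positivity

theorem variance_edgeLengthFunctional_le (hd : 2 ≤ d)
    (hη : IsPoissonProcess P η (ENNReal.ofReal γ • hypVolume d)) (hα : 0 ≤ α) (hγ : 0 < γ)
    (hρ : 0 < ρ) (hρ1 : ρ ≤ 1) (hR : ρ ≤ 2 * R) (o : HypSpace d) :
    Var[fun ω => edgeLengthFunctional o α R (η ω); P] ≤
      varianceUpperConst d α (γ * ρ ^ d) * (ρ ^ (2 * α) / ρ ^ d) * ballVolume o R := by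
  obtain ⟨T, Q, hQ⟩ := exists_isCellDecomposition hd hρ o R
  simp_rw [hQ.edgeLengthFunctional_eq (hη.finite_inter_ball o _)]
  rw [variance_fun_sum' fun y _ => memLp_regionFunctional hd hη hα hγ hρ hρ1 (hQ.measurableSet y)
    (hQ.subset_ball y), varianceUpperConst]
  have hcov (x y : HypSpace d) := covariance_regionFunctional_le (o := o) hd hη hα hγ hρ hρ1
    (hQ.measurableSet x) (hQ.subset_ball x) (hQ.measurableSet y) (hQ.subset_ball y)
  have hβ : 0 < γ * ρ ^ d := by positivity
  generalize γ * ρ ^ d = β at hcov hβ ⊢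
  have hmoment := cellMoment_pos d hα hβ
  have hshell := shellSum_pos d hβ
  have hgrowth := volumeGrowth_pos d
  set D := cellMoment d α β * ρ ^ (2 * α) with hD
  calc ∑ x ∈ T, ∑ y ∈ T, cov[fun ω => regionFunctional o α (Q x) (η ω),
        fun ω => regionFunctional o α (Q y) (η ω); P]
      ≤ ∑ x ∈ T, ∑ y ∈ T, 2 * D * voidDecay d β ⌊dist x y / (6 * ρ)⌋₊ :=
        Finset.sum_le_sum fun x _ => Finset.sum_le_sum fun y _ => hcov x y
    _ ≤ ∑ _x ∈ T, 2 * D * shellSum d β := by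
        refine Finset.sum_le_sum fun x _ => ?_
        rw [← Finset.mul_sum]
        gcongr
        exact sum_voidDecay_le hd hβ hρ hρ1 hQ.isSeparatedNet.separated x
    _ = T.card * (volumeGrowth d * (ρ / 4) ^ d) *
          (2 * D * shellSum d β / (volumeGrowth d * (ρ / 4) ^ d)) := by
        rw [Finset.sum_const, nsmul_eq_mul]
        field_simp
    _ ≤ ballVolume o R * (2 * D * shellSum d β / (volumeGrowth d * (ρ / 4) ^ d)) := by
        gcongr
        exact hQ.card_mul_le hd hρ.le hR
    _ = _ := by
        rw [hD, show ρ / 4 = 1 / 4 * ρ by ring, mul_pow]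
        field_simp

end UpperBound

end HypSpace

section SecondDifference

variable {X : Type*} [MetricSpace X] {o z : X} {ξ A B S U W : Set X} {α : ℝ}

theorem regionFunctional_eq_add (h : ((A ∪ B) ∩ S).Finite)
    (hloc : ∀ x ∈ A \ B, radialEdgeLength o A x = radialEdgeLength o (A ∪ B) x) :
    regionFunctional o α S A = ∑ᶠ x ∈ A ∩ B ∩ S, radialEdgeLength o A x ^ α +
      ∑ᶠ x ∈ (A \ B) ∩ S, radialEdgeLength o (A ∪ B) x ^ α := by
  have hA : (A ∩ S).Finite := h.subset (Set.inter_subset_inter_left _ Set.subset_union_left)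
  rw [regionFunctional, ← finsum_mem_inter_add_sdiff (t := B) hA, Set.inter_right_comm,
    Set.inter_sdiff_right_comm]
  congr 1
  exact finsum_mem_congr rfl fun x hx => by rw [hloc x hx.1]

theorem regionFunctional_union_eq_add (h : ((A ∪ B) ∩ S).Finite) :
    regionFunctional o α S (A ∪ B) = ∑ᶠ x ∈ A ∩ B ∩ S, radialEdgeLength o (A ∪ B) x ^ α +
      ∑ᶠ x ∈ (A \ B) ∩ S, radialEdgeLength o (A ∪ B) x ^ α +
      ∑ᶠ x ∈ (B \ A) ∩ S, radialEdgeLength o (A ∪ B) x ^ α := by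
  have hA : (A ∩ S).Finite := h.subset (Set.inter_subset_inter_left _ Set.subset_union_left)
  rw [regionFunctional, ← finsum_mem_inter_add_sdiff (t := A) h, Set.inter_right_comm,
    Set.union_inter_cancel_left, Set.inter_sdiff_right_comm, Set.union_sdiff_left,
    ← finsum_mem_inter_add_sdiff (t := B) hA, Set.inter_right_comm, Set.inter_sdiff_right_comm]

theorem max_radialEdgeLength_rpow (hA : ∀ r, (A ∩ Metric.ball o r).Finite)
    (hB : ∀ r, (B ∩ Metric.ball o r).Finite) (x : X) :
    max (radialEdgeLength o A x) (radialEdgeLength o B x) ^ α =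
      radialEdgeLength o A x ^ α + radialEdgeLength o B x ^ α -
        radialEdgeLength o (A ∪ B) x ^ α := by
  rw [radialEdgeLength_union hA hB]
  rcases le_total (radialEdgeLength o A x) (radialEdgeLength o B x) with h | h
  · rw [min_eq_left h, max_eq_right h, add_sub_cancel_left]
  · rw [min_eq_right h, max_eq_left h, add_sub_cancel_right]

theorem radialEdgeLength_anti (hB : ∀ r, (B ∩ Metric.ball o r).Finite) (hAB : A ⊆ B) (x : X) :
    radialEdgeLength o B x ≤ radialEdgeLength o A x := by
  have hA (r : ℝ) : (A ∩ Metric.ball o r).Finite :=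
    (hB r).subset (Set.inter_subset_inter_left _ hAB)
  rw [← Set.union_eq_self_of_subset_left hAB, radialEdgeLength_union hA hB]
  exact min_le_left _ _

theorem regionFunctional_modular (hA : ∀ r, (A ∩ Metric.ball o r).Finite)
    (hB : ∀ r, (B ∩ Metric.ball o r).Finite) (hS : ((A ∪ B) ∩ S).Finite)
    (hAB : ∀ x ∈ A \ B, radialEdgeLength o A x = radialEdgeLength o (A ∪ B) x)
    (hBA : ∀ x ∈ B \ A, radialEdgeLength o B x = radialEdgeLength o (A ∪ B) x) :
    regionFunctional o α S (A ∪ B) - regionFunctional o α S A - regionFunctional o α S B +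
        regionFunctional o α S (A ∩ B) =
      ∑ᶠ x ∈ A ∩ B ∩ S, (radialEdgeLength o (A ∩ B) x ^ α -
        max (radialEdgeLength o A x) (radialEdgeLength o B x) ^ α) := by
  have hY : (A ∩ B ∩ S).Finite :=
    hS.subset (Set.inter_subset_inter_left _ (Set.inter_subset_left.trans Set.subset_union_left))
  have hB' := regionFunctional_eq_add (α := α) (by rwa [Set.union_comm] at hS)
    (by rwa [Set.union_comm] at hBA)
  rw [Set.inter_comm B, Set.union_comm B] at hB'
  rw [regionFunctional_union_eq_add hS, regionFunctional_eq_add hS hAB, hB', regionFunctional]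
  simp_rw [max_radialEdgeLength_rpow hA hB, finsum_mem_eq_finite_toFinset_sum _ hY,
    Finset.sum_sub_distrib, Finset.sum_add_distrib]
  ring

/-- The second difference of the edge-length functional under removal of the points in two sets. -/
def secondDifference (o : X) (α : ℝ) (S U W ξ : Set X) : ℝ :=
  regionFunctional o α S ξ - regionFunctional o α S (ξ ∩ Wᶜ) - regionFunctional o α S (ξ ∩ Uᶜ) +
    regionFunctional o α S (ξ ∩ (U ∪ W)ᶜ)

theorem secondDifference_of_left_empty (h : ξ ∩ U = ∅) : secondDifference o α S U W ξ = 0 := by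
  have hU : ξ ∩ Uᶜ = ξ :=
    Set.inter_eq_left.2 (Set.disjoint_iff_inter_eq_empty.2 h).subset_compl_right
  have hUW : ξ ∩ (U ∪ W)ᶜ = ξ ∩ Wᶜ := by rw [Set.compl_union, ← Set.inter_assoc, hU]
  rw [secondDifference, hU, hUW]
  ring

theorem secondDifference_comm : secondDifference o α S U W ξ = secondDifference o α S W U ξ := by
  rw [secondDifference, secondDifference, Set.union_comm]
  ring

theorem secondDifference_of_right_empty (h : ξ ∩ W = ∅) : secondDifference o α S U W ξ = 0 := by
  rw [secondDifference_comm, secondDifference_of_left_empty h]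

theorem secondDifference_eq_finsum (hξ : ∀ r, (ξ ∩ Metric.ball o r).Finite)
    (hS : (ξ ∩ S).Finite) (hUW : Disjoint U W)
    (hU : ∀ x ∈ ξ ∩ U, radialEdgeLength o (ξ ∩ Wᶜ) x = radialEdgeLength o ξ x)
    (hW : ∀ x ∈ ξ ∩ W, radialEdgeLength o (ξ ∩ Uᶜ) x = radialEdgeLength o ξ x) :
    secondDifference o α S U W ξ =
      ∑ᶠ x ∈ ξ ∩ (U ∪ W)ᶜ ∩ S, (radialEdgeLength o (ξ ∩ (U ∪ W)ᶜ) x ^ α -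
        max (radialEdgeLength o (ξ ∩ Wᶜ) x) (radialEdgeLength o (ξ ∩ Uᶜ) x) ^ α) := by
  have hunion : ξ ∩ Wᶜ ∪ ξ ∩ Uᶜ = ξ := by
    rw [← Set.inter_union_distrib_left, ← Set.compl_inter, hUW.symm.inter_eq, Set.compl_empty,
      Set.inter_univ]
  have hinter : ξ ∩ Wᶜ ∩ (ξ ∩ Uᶜ) = ξ ∩ (U ∪ W)ᶜ := by
    rw [← Set.inter_inter_distrib_left, ← Set.compl_union, Set.union_comm]
  have hfin (C : Set X) (r : ℝ) : (ξ ∩ C ∩ Metric.ball o r).Finite :=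
    (hξ r).subset (Set.inter_subset_inter_left _ Set.inter_subset_left)
  have h := regionFunctional_modular (α := α) (hfin Wᶜ) (hfin Uᶜ) (S := S) (by rwa [hunion])
    (fun x hx => ?_) (fun x hx => ?_)
  · rwa [hunion, hinter] at h
  · rw [hunion, hU x ⟨hx.1.1, by_contra fun hxU => hx.2 ⟨hx.1.1, hxU⟩⟩]
  · rw [hunion, hW x ⟨hx.1.1, by_contra fun hxW => hx.2 ⟨hx.1.1, hxW⟩⟩]

theorem le_secondDifference (hα : 0 ≤ α) (hξ : ∀ r, (ξ ∩ Metric.ball o r).Finite)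
    (hS : (ξ ∩ S).Finite) (hUW : Disjoint U W)
    (hU : ∀ x ∈ ξ ∩ U, radialEdgeLength o (ξ ∩ Wᶜ) x = radialEdgeLength o ξ x)
    (hW : ∀ x ∈ ξ ∩ W, radialEdgeLength o (ξ ∩ Uᶜ) x = radialEdgeLength o ξ x)
    (hz : z ∈ ξ ∩ (U ∪ W)ᶜ ∩ S) :
    radialEdgeLength o (ξ ∩ (U ∪ W)ᶜ) z ^ α -
        max (radialEdgeLength o (ξ ∩ Wᶜ) z) (radialEdgeLength o (ξ ∩ Uᶜ) z) ^ α ≤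
      secondDifference o α S U W ξ := by
  have hY : (ξ ∩ (U ∪ W)ᶜ ∩ S).Finite :=
    hS.subset (Set.inter_subset_inter_left _ Set.inter_subset_left)
  have hfin (C : Set X) (r : ℝ) : (ξ ∩ C ∩ Metric.ball o r).Finite :=
    (hξ r).subset (Set.inter_subset_inter_left _ Set.inter_subset_left)
  have hmax (x : X) : max (radialEdgeLength o (ξ ∩ Wᶜ) x) (radialEdgeLength o (ξ ∩ Uᶜ) x) ≤
      radialEdgeLength o (ξ ∩ (U ∪ W)ᶜ) x :=
    max_le
      (radialEdgeLength_anti (hfin _) (by gcongr; exact Set.subset_union_right) x)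
      (radialEdgeLength_anti (hfin _) (by gcongr; exact Set.subset_union_left) x)
  have hnonneg (x : X) : 0 ≤ radialEdgeLength o (ξ ∩ (U ∪ W)ᶜ) x ^ α -
      max (radialEdgeLength o (ξ ∩ Wᶜ) x) (radialEdgeLength o (ξ ∩ Uᶜ) x) ^ α :=
    sub_nonneg.2 (Real.rpow_le_rpow (le_max_of_le_left (radialEdgeLength_nonneg _ _ _)) (hmax x) hα)
  rw [secondDifference_eq_finsum hξ hS hUW hU hW, finsum_mem_eq_finite_toFinset_sum _ hY]
  exact Finset.single_le_sum (fun x _ => hnonneg x) (hY.mem_toFinset.2 hz)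

end SecondDifference

namespace HypSpace

variable {d : ℕ} [NeZero d] {o z t u w x : HypSpace d} {ρ α : ℝ} {ξ S : Set (HypSpace d)}

/-- A fork: a point `z`, two points `u` and `w` at distance `ρ` from `z` that are closer to the root
`o` and far from each other, and a point `t` further towards the root and close to both `u` and `w`.
If a process has points near these four positions only, then the edge at `z` ends at `u` or `w`
unless both are removed, whereas the edges at `u` and `w` end at `t` in any case. -/
structure IsFork (o z t u w : HypSpace d) (ρ : ℝ) : Prop where
  pos : 0 < ρ
  root : 4 * ρ ≤ dist o z
  dist_t : dist t z = 6 / 5 * ρ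
  root_t : dist o t = dist o z - 6 / 5 * ρ
  dist_u : dist u z = ρ
  dist_w : dist w z = ρ
  root_u : dist o u ≤ dist o z - 3 / 10 * ρ
  root_w : dist o w ≤ dist o z - 3 / 10 * ρ
  dist_ut : dist u t ≤ 9 / 10 * ρ
  dist_wt : dist w t ≤ 9 / 10 * ρ
  dist_uw : 11 / 10 * ρ ≤ dist u w

theorem dist_polar_le_of_inner_eq {n v : EuclideanSpace ℝ (Fin d)} (hn : ‖n‖ = 1) (hv : ‖v‖ = 1)
    (hvn : inner ℝ v n = 4 / 5) (hρ : 0 ≤ ρ) (hρ' : ρ ≤ 1 / 2) :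
    dist (polar z v ρ) (polar z n ρ) ≤ 7 / 10 * ρ := by
  rw [← cosh_le_cosh_iff_of_nonneg dist_nonneg (by positivity),
    cosh_dist_polar_polar_of_eq_radius hv hn hρ, hvn]
  norm_num1
  exact one_add_sinh_sq_le_cosh_mul hρ hρ'

theorem le_dist_polar_of_inner_eq {v v' : EuclideanSpace ℝ (Fin d)} (hv : ‖v‖ = 1) (hv' : ‖v'‖ = 1)
    (hvv' : inner ℝ v v' = 7 / 25) (hρ : 0 ≤ ρ) (hρ' : ρ ≤ 1 / 2) :
    11 / 10 * ρ ≤ dist (polar z v ρ) (polar z v' ρ) := by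
  rw [← cosh_le_cosh_iff_of_nonneg (by positivity) dist_nonneg,
    cosh_dist_polar_polar_of_eq_radius hv hv' hρ, hvv']
  norm_num1
  exact cosh_mul_le_one_add_sinh_sq hρ hρ'

theorem exists_isFork (hd : 2 ≤ d) (o z : HypSpace d) (hρ : 0 < ρ) (hρ1 : ρ ≤ 1 / 2)
    (hr : 4 * ρ ≤ dist o z) : ∃ t u w, IsFork o z t u w ρ := by
  obtain ⟨n, hn, ho⟩ := exists_eq_polar z o
  obtain ⟨v, v', hv, hv', hvn, hvn', hvv'⟩ := exists_unit_vectors_inner_eq (by simpa using hd) hn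
  have hdir {s r : ℝ} (hs : 0 ≤ s) (hr : 0 ≤ r) : dist (polar z n s) (polar z n r) = |s - r| :=
    dist_polar_polar_of_eq_direction hn hs hr
  have hu := dist_polar_le_of_inner_eq (z := z) hn hv hvn hρ.le hρ1
  have hw := dist_polar_le_of_inner_eq (z := z) hn hv' hvn' hρ.le hρ1
  have hroot {s : ℝ} (hs : 0 ≤ s) (hsz : s ≤ dist o z) : dist o (polar z n s) = dist o z - s := by
    have h := hdir (s := dist o z) dist_nonneg hs
    rwa [ho, abs_of_nonneg (sub_nonneg.2 hsz)] at h
  have hop := hroot hρ.le (by linarith)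
  have hpt : dist (polar z n ρ) (polar z n (6 / 5 * ρ)) = 1 / 5 * ρ := by
    rw [hdir hρ.le (by positivity), abs_of_nonpos (by linarith)]
    ring
  exact ⟨polar z n (6 / 5 * ρ), polar z v ρ, polar z v' ρ,
    { pos := hρ
      root := hr
      dist_t := dist_polar hn (by positivity)
      root_t := hroot (by positivity) (by linarith)
      dist_u := dist_polar hv hρ.le
      dist_w := dist_polar hv' hρ.le
      root_u := by linarith [dist_triangle_right o (polar z v ρ) (polar z n ρ)]
      root_w := by linarith [dist_triangle_right o (polar z v' ρ) (polar z n ρ)]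
      dist_ut := by linarith [dist_triangle (polar z v ρ) (polar z n ρ) (polar z n (6 / 5 * ρ))]
      dist_wt := by linarith [dist_triangle (polar z v' ρ) (polar z n ρ) (polar z n (6 / 5 * ρ))]
      dist_uw := le_dist_polar_of_inner_eq hv hv' hvv' hρ.le hρ1 }⟩

/-- The small ball occupied by one cluster of points of a fork. -/
def cluster (x : HypSpace d) (ρ : ℝ) : Set (HypSpace d) := Metric.ball x (ρ / 100)

theorem measurableSet_cluster (x : HypSpace d) (ρ : ℝ) : MeasurableSet (cluster x ρ) :=
  measurableSet_ball

theorem mem_cluster : x ∈ cluster z ρ ↔ dist x z < ρ / 100 := Iff.rfl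

/-- The part of the ball of radius `2 * ρ` around `z` outside the four clusters of a fork. -/
def forkGap (z t u w : HypSpace d) (ρ : ℝ) : Set (HypSpace d) :=
  Metric.ball z (2 * ρ) \ (cluster u ρ ∪ cluster w ρ ∪ (cluster t ρ ∪ cluster z ρ))

namespace IsFork

theorem swap (h : IsFork o z t u w ρ) : IsFork o z t w u ρ :=
  ⟨h.pos, h.root, h.dist_t, h.root_t, h.dist_w, h.dist_u, h.root_w, h.root_u, h.dist_wt, h.dist_ut,
    by rw [dist_comm]; exact h.dist_uw⟩

theorem disjoint_uw (h : IsFork o z t u w ρ) : Disjoint (cluster u ρ) (cluster w ρ) :=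
  Metric.ball_disjoint_ball (by linarith [h.pos, h.dist_uw])

theorem disjoint_uz (h : IsFork o z t u w ρ) : Disjoint (cluster u ρ) (cluster z ρ) :=
  Metric.ball_disjoint_ball (by linarith [h.pos, h.dist_u])

theorem disjoint_tz (h : IsFork o z t u w ρ) : Disjoint (cluster t ρ) (cluster z ρ) :=
  Metric.ball_disjoint_ball (by linarith [h.pos, h.dist_t])

theorem disjoint_ut (h : IsFork o z t u w ρ) : Disjoint (cluster u ρ) (cluster t ρ) :=
  Metric.ball_disjoint_ball (by
    linarith [h.pos, h.dist_u, h.dist_t, dist_triangle t u z, dist_comm t u])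

theorem notMem_cluster_union (h : IsFork o z t u w ρ) (hx : x ∈ cluster z ρ) :
    x ∉ cluster u ρ ∪ cluster w ρ := by
  rintro (hxu | hxw)
  exacts [Set.disjoint_left.1 h.disjoint_uz hxu hx, Set.disjoint_left.1 h.swap.disjoint_uz hxw hx]

theorem ne_root (h : IsFork o z t u w ρ) (hx : x ∈ cluster z ρ) : x ≠ o := by
  rintro rfl
  rw [mem_cluster] at hx
  linarith [h.root, h.pos]

theorem radialEdgeLength_eq (h : IsFork o z t u w ρ)
    (hξ : ∀ r, (ξ ∩ Metric.ball o r).Finite) (ht : (ξ ∩ cluster t ρ).Nonempty) :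
    ∀ x ∈ ξ ∩ cluster u ρ,
      radialEdgeLength o (ξ ∩ (cluster w ρ)ᶜ) x = radialEdgeLength o ξ x := by
  rintro x ⟨-, hxu⟩
  obtain ⟨t', ht', htt⟩ := ht
  rw [mem_cluster] at hxu htt
  have hρ := h.pos
  have hroot : dist o t' < dist o x := by
    linarith [dist_triangle_right o t' t, dist_triangle o x u, dist_triangle o u z, h.root_t,
      h.dist_u, dist_comm t t']
  have hlen : radialEdgeLength o ξ x < 19 / 20 * ρ := by
    refine (radialEdgeLength_le_dist hξ ht' hroot).trans_lt ?_
    linarith [dist_triangle x u t', dist_triangle u t t', h.dist_ut, dist_comm t t']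
  refine radialEdgeLength_eq_of_inter_subset hξ Set.inter_subset_left hlen
    fun y hy _ hxy => ⟨hy, fun hyw => ?_⟩
  rw [mem_cluster] at hyw
  linarith [dist_triangle u x w, dist_triangle x y w, h.dist_uw, dist_comm u x]

theorem radialEdgeLength_le (h : IsFork o z t u w ρ)
    (hξ : ∀ r, (ξ ∩ Metric.ball o r).Finite) (hu : (ξ ∩ cluster u ρ).Nonempty)
    (hx : x ∈ cluster z ρ) : radialEdgeLength o (ξ ∩ (cluster w ρ)ᶜ) x ≤ 21 / 20 * ρ := by
  obtain ⟨u', hu', huu⟩ := hu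
  have hw : u' ∉ cluster w ρ := Set.disjoint_left.1 h.disjoint_uw huu
  rw [mem_cluster] at hx huu
  have hρ := h.pos
  have hroot : dist o u' < dist o x := by
    linarith [dist_triangle o u u', dist_triangle o x z, h.root_u, dist_comm u u']
  refine (radialEdgeLength_le_dist (fun r => (hξ r).subset fun y hy => ⟨hy.1.1, hy.2⟩)
    (⟨hu', hw⟩ : u' ∈ ξ ∩ (cluster w ρ)ᶜ) hroot).trans ?_
  linarith [dist_triangle x z u', dist_triangle z u u', h.dist_u, dist_comm u u', dist_comm z u]

theorem le_radialEdgeLength (h : IsFork o z t u w ρ) (hξ : ∀ r, (ξ ∩ Metric.ball o r).Finite)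
    (hgap : ξ ∩ forkGap z t u w ρ = ∅) (hx : x ∈ cluster z ρ)
    (hmin : ∀ y ∈ ξ ∩ cluster z ρ, dist o x ≤ dist o y) :
    23 / 20 * ρ ≤ radialEdgeLength o (ξ ∩ (cluster u ρ ∪ cluster w ρ)ᶜ) x := by
  have hρ := h.pos
  rw [le_radialEdgeLength_iff (fun r => (hξ r).subset fun y hy => ⟨hy.1.1, hy.2⟩) (h.ne_root hx)]
  rw [mem_cluster] at hx
  rintro y (⟨hyξ, hyuw⟩ | rfl) hyx
  · have hyz : y ∉ cluster z ρ := fun hyz => (hmin y ⟨hyξ, hyz⟩).not_gt hyx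
    by_cases hyt : y ∈ cluster t ρ
    · rw [mem_cluster] at hyt
      linarith [dist_triangle t y z, dist_triangle y x z, h.dist_t, dist_comm t y, dist_comm x y]
    · have hyball : y ∉ Metric.ball z (2 * ρ) := fun hyball =>
        Set.eq_empty_iff_forall_notMem.1 hgap y
          ⟨hyξ, hyball, fun hc => hc.elim hyuw fun hc => hc.elim hyt hyz⟩
      rw [Metric.mem_ball, not_lt] at hyball
      linarith [dist_triangle y x z, dist_comm x y]
  · linarith [h.root, dist_triangle y x z, dist_comm y x]

theorem le_secondDifference (h : IsFork o z t u w ρ) (hα : 0 ≤ α)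
    (hξ : ∀ r, (ξ ∩ Metric.ball o r).Finite) (hS : (ξ ∩ S).Finite)
    (hzS : cluster z ρ ⊆ S) (hu : (ξ ∩ cluster u ρ).Nonempty) (hw : (ξ ∩ cluster w ρ).Nonempty)
    (ht : (ξ ∩ cluster t ρ).Nonempty) (hz : (ξ ∩ cluster z ρ).Nonempty)
    (hgap : ξ ∩ forkGap z t u w ρ = ∅) :
    (23 / 20 * ρ) ^ α - (21 / 20 * ρ) ^ α ≤
      secondDifference o α S (cluster u ρ) (cluster w ρ) ξ := by
  have hρ := h.pos
  obtain ⟨x, ⟨hxξ, hxz⟩, hmin⟩ := Set.exists_min_image _ (dist o)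
    (hS.subset (Set.inter_subset_inter_right _ hzS)) hz
  refine le_trans (sub_le_sub ?_ ?_) (_root_.le_secondDifference hα hξ hS h.disjoint_uw
    (h.radialEdgeLength_eq hξ ht) (h.swap.radialEdgeLength_eq hξ ht)
    ⟨⟨hxξ, h.notMem_cluster_union hxz⟩, hzS hxz⟩)
  · exact Real.rpow_le_rpow (by positivity) (h.le_radialEdgeLength hξ hgap hxz hmin) hα
  · exact Real.rpow_le_rpow (le_max_of_le_left (radialEdgeLength_nonneg _ _ _))
      (max_le (h.radialEdgeLength_le hξ hu hxz) (h.swap.radialEdgeLength_le hξ hw hxz)) hα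

end IsFork

end HypSpace

section VoidTest

variable {Ω X : Type*} {η : Ω → Set X} {U W B : Set X} {V : Set Ω}

theorem setOf_inter_nonempty_eq_compl (η : Ω → Set X) (B : Set X) :
    {ω | (η ω ∩ B).Nonempty} = {ω | η ω ∩ B = ∅}ᶜ :=
  Set.ext fun _ => Set.nonempty_iff_ne_empty

theorem measurableSet_nonempty_regionSigma [MeasurableSpace X] (η : Ω → Set X)
    (hU : MeasurableSet U) (hUB : U ⊆ B) :
    MeasurableSet[regionSigma η B] {ω | (η ω ∩ U).Nonempty} := by
  rw [setOf_inter_nonempty_eq_compl]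
  exact @MeasurableSet.compl _ _ (_) (measurableSet_void_regionSigma η hU hUB)

variable [mΩ : MeasurableSpace Ω] {P : Measure Ω}

/-- The centred indicator function of the event that there is no point in `U`. -/
def voidDeviation (P : Measure Ω) (η : Ω → Set X) (U : Set X) (ω : Ω) : ℝ :=
  {ω | η ω ∩ U = ∅}.indicator 1 ω - P.real {ω | η ω ∩ U = ∅}

theorem abs_voidDeviation_le [IsProbabilityMeasure P] (η : Ω → Set X) (U : Set X) (ω : Ω) :
    |voidDeviation P η U ω| ≤ 1 := by
  have hnonneg : 0 ≤ P.real {ω | η ω ∩ U = ∅} := measureReal_nonneg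
  have hle : P.real {ω | η ω ∩ U = ∅} ≤ 1 := measureReal_le_one
  rw [voidDeviation, abs_le]
  by_cases h : ω ∈ {ω | η ω ∩ U = ∅}
  · rw [Set.indicator_of_mem h, Pi.one_apply]
    constructor <;> linarith
  · rw [Set.indicator_of_notMem h]
    constructor <;> linarith

theorem voidDeviation_of_nonempty (P : Measure Ω) {ω : Ω} (h : (η ω ∩ U).Nonempty) :
    voidDeviation P η U ω = -P.real {ω | η ω ∩ U = ∅} := by
  rw [voidDeviation, Set.indicator_of_notMem (show ω ∉ {ω | η ω ∩ U = ∅} from h.ne_empty), zero_sub]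

theorem measurable_voidDeviation [MeasurableSpace X] (P : Measure Ω) (η : Ω → Set X)
    (hU : MeasurableSet U) (hUB : U ⊆ B) : Measurable[regionSigma η B] (voidDeviation P η U) :=
  @Measurable.sub_const _ _ _ _ _ (_) _ (@Measurable.indicator _ _ (_) _ _ _ _
    (@measurable_const _ _ _ (_) _) (measurableSet_void_regionSigma η hU hUB)) _

/-- The product of the void deviations of `U` and `W` on the event `V`. Integration against it turns
a functional of the process into its second difference with respect to `U` and `W`. -/
def voidTest (P : Measure Ω) (η : Ω → Set X) (V : Set Ω) (U W : Set X) (ω : Ω) : ℝ :=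
  V.indicator 1 ω * voidDeviation P η U ω * voidDeviation P η W ω

theorem voidTest_comm (P : Measure Ω) (η : Ω → Set X) (V : Set Ω) (U W : Set X) :
    voidTest P η V U W = voidTest P η V W U :=
  funext fun _ => mul_right_comm _ _ _

theorem abs_voidTest_le [IsProbabilityMeasure P] (η : Ω → Set X) (V : Set Ω) (U W : Set X)
    (ω : Ω) : |voidTest P η V U W ω| ≤ 1 := by
  have hV : |V.indicator (1 : Ω → ℝ) ω| ≤ 1 := by
    by_cases hω : ω ∈ V <;> simp [hω]
  rw [voidTest, abs_mul, abs_mul]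
  exact mul_le_one₀ (mul_le_one₀ hV (abs_nonneg _) (abs_voidDeviation_le _ _ _)) (abs_nonneg _)
    (abs_voidDeviation_le _ _ _)

theorem voidTest_of_mem {ω : Ω} (hV : ω ∈ V) (hU : (η ω ∩ U).Nonempty) (hW : (η ω ∩ W).Nonempty) :
    voidTest P η V U W ω = P.real {ω | η ω ∩ U = ∅} * P.real {ω | η ω ∩ W = ∅} := by
  rw [voidTest, Set.indicator_of_mem hV, voidDeviation_of_nonempty P hU,
    voidDeviation_of_nonempty P hW, Pi.one_apply, one_mul, neg_mul_neg]

theorem voidTest_of_notMem {ω : Ω} (hV : ω ∉ V) : voidTest P η V U W ω = 0 := by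
  rw [voidTest, Set.indicator_of_notMem hV, zero_mul, zero_mul]

theorem measurable_indicator_mul_voidDeviation [MeasurableSpace X] (P : Measure Ω)
    (hV : MeasurableSet[regionSigma η B] V) (hU : MeasurableSet U) (hUB : U ⊆ B) :
    Measurable[regionSigma η B] fun ω => V.indicator 1 ω * voidDeviation P η U ω :=
  @Measurable.mul _ _ _ _ _ (_) _ _ (@Measurable.indicator _ _ (_) _ _ _ _
    (@measurable_const _ _ _ (_) _) hV) (measurable_voidDeviation P η hU hUB)

theorem measurable_voidTest [MeasurableSpace X] (P : Measure Ω)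
    (hV : MeasurableSet[regionSigma η B] V) (hU : MeasurableSet U) (hUB : U ⊆ B)
    (hW : MeasurableSet W) (hWB : W ⊆ B) : Measurable[regionSigma η B] (voidTest P η V U W) :=
  @Measurable.mul _ _ _ _ _ (_) _ _ (measurable_indicator_mul_voidDeviation P hV hU hUB)
    (measurable_voidDeviation P η hW hWB)

end VoidTest

namespace IsPoissonProcess

variable {Ω X : Type*} [mΩ : MeasurableSpace Ω] [MetricSpace X] [MeasurableSpace X]
  {P : Measure Ω} {η : Ω → Set X} {μ : Measure X} {o : X} {α R : ℝ} {U W B : Set X} {V : Set Ω}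

theorem measureReal_void (h : IsPoissonProcess P η μ) (hB : MeasurableSet B) (hμ : μ B ≠ ⊤) :
    P.real {ω | η ω ∩ B = ∅} = Real.exp (-(μ B).toReal) := by
  rw [measureReal_def, h.measure_void hB hμ, ENNReal.toReal_ofReal (Real.exp_pos _).le]

theorem measureReal_iInter_nonempty {ι : Type*} [Fintype ι] (h : IsPoissonProcess P η μ)
    {K : ι → Set X} (hK : ∀ i, MeasurableSet (K i))
    (hKd : Pairwise fun i j => Disjoint (K i) (K j)) :
    P.real (⋂ i, {ω | (η ω ∩ K i).Nonempty}) = ∏ i, P.real {ω | (η ω ∩ K i).Nonempty} := by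
  have hne (i : ι) : {ω | (η ω ∩ K i).Nonempty} = (fun ω => (η ω ∩ K i).encard) ⁻¹' {0}ᶜ := by
    ext ω
    simp [Set.nonempty_iff_ne_empty]
  have hprod := (h.iIndepFun_count hK hKd).measure_inter_preimage_eq_mul Finset.univ
    (sets := fun _ => {0}ᶜ) fun _ _ => MeasurableSet.of_discrete
  simp only [measureReal_def, ← ENNReal.toReal_prod, hne]
  simpa using congrArg ENNReal.toReal hprod

section Integrability

variable [SecondCountableTopology X] [BorelSpace X]

theorem integrable_regionFunctional_inter (h : IsPoissonProcess P η μ) (hα : 0 ≤ α)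
    (hμ : μ (Metric.ball o R) ≠ ⊤) (hB : MeasurableSet B) :
    Integrable (fun ω => regionFunctional o α (Metric.ball o R) (η ω ∩ B)) P := by
  refine ⟨((h.measurable_regionFunctional_inter α measurableSet_ball subset_rfl hB).mono
    (h.regionSigma_le _) le_rfl).aestronglyMeasurable, ?_⟩
  rw [hasFiniteIntegral_iff_ofReal (Filter.Eventually.of_forall fun ω =>
    regionFunctional_nonneg _ _ _ _)]
  have hcount : Measurable fun ω => ((η ω ∩ Metric.ball o R).encard : ENNReal) ^ 2 :=
    (measurable_of_countable (fun n : ℕ∞ => (n : ENNReal) ^ 2)).comp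
      (h.measurable_count _ measurableSet_ball)
  have hfin (ω : Ω) (r : ℝ) : (η ω ∩ B ∩ Metric.ball o r).Finite :=
    (h.finite_inter_ball o ω r).subset (Set.inter_subset_inter_left _ Set.inter_subset_left)
  calc ∫⁻ ω, ENNReal.ofReal (regionFunctional o α (Metric.ball o R) (η ω ∩ B)) ∂P
      ≤ ∫⁻ ω, ((η ω ∩ Metric.ball o R).encard : ENNReal) ^ 2 * ENNReal.ofReal (R ^ α) ∂P := by
        refine lintegral_mono fun ω => ?_
        have hedge : ∀ x ∈ η ω ∩ B ∩ Metric.ball o R, radialEdgeLength o (η ω ∩ B) x ≤ R :=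
          fun x hx => (radialEdgeLength_le_dist_root (hfin ω)).trans
            (by rw [dist_comm]; exact (Metric.mem_ball.1 hx.2).le)
        refine (ofReal_regionFunctional_le hα (hfin ω R) hedge).trans (mul_le_mul_left ?_ _)
        refine (ENat.toENNReal_le.2 (Set.encard_le_encard (Set.inter_subset_inter_left _
          Set.inter_subset_left))).trans ?_
        rw [(h.finite_inter_ball o ω R).encard_eq_coe_toFinset_card]
        exact_mod_cast Nat.le_self_pow two_ne_zero _
    _ < ⊤ := by
        rw [lintegral_mul_const _ hcount]
        exact ENNReal.mul_lt_top ((h.lintegral_count_sq_le measurableSet_ball hμ).trans_lt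
          ENNReal.ofReal_lt_top) ENNReal.ofReal_lt_top

theorem integrable_secondDifference (h : IsPoissonProcess P η μ) (hα : 0 ≤ α)
    (hμ : μ (Metric.ball o R) ≠ ⊤) (hU : MeasurableSet U) (hW : MeasurableSet W) :
    Integrable (fun ω => secondDifference o α (Metric.ball o R) U W (η ω)) P := by
  have hfull := h.integrable_regionFunctional_inter hα hμ .univ
  simp only [Set.inter_univ] at hfull
  exact ((hfull.sub (h.integrable_regionFunctional_inter hα hμ hW.compl)).sub
    (h.integrable_regionFunctional_inter hα hμ hU.compl)).add
    (h.integrable_regionFunctional_inter hα hμ (hU.union hW).compl)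

end Integrability

variable [IsProbabilityMeasure P]

theorem indepFun_of_regionSigma (h : IsPoissonProcess P η μ) {B' : Set X} (hB : MeasurableSet B)
    (hB' : MeasurableSet B') (hd : Disjoint B B') {f g : Ω → ℝ} (hf : Measurable[regionSigma η B] f)
    (hg : Measurable[regionSigma η B'] g) : IndepFun f g P :=
  (IndepFun_iff_Indep f g P).2 (indep_of_indep_of_le_left (indep_of_indep_of_le_right
    (h.indep_regionSigma hB hB' hd) hg.comap_le) hf.comap_le)

theorem integral_voidDeviation (h : IsPoissonProcess P η μ) (hU : MeasurableSet U) :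
    ∫ ω, voidDeviation P η U ω ∂P = 0 := by
  have hm := h.measurableSet_void hU
  simp only [voidDeviation]
  have hind : Integrable ({ω | η ω ∩ U = ∅}.indicator (1 : Ω → ℝ)) P :=
    (integrable_const (1 : ℝ)).indicator hm
  rw [integral_sub hind (integrable_const _),
    integral_indicator_one hm, integral_const, probReal_univ, one_smul, sub_self]

theorem integral_mul_voidDeviation (h : IsPoissonProcess P η μ) (hU : MeasurableSet U) {Y : Ω → ℝ}
    (hY : Measurable[regionSigma η Uᶜ] Y) : ∫ ω, Y ω * voidDeviation P η U ω ∂P = 0 := by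
  have hdev := measurable_voidDeviation P η hU subset_rfl
  have hind := h.indepFun_of_regionSigma hU.compl hU disjoint_compl_left hY hdev
  rw [hind.integral_fun_mul_eq_mul_integral
    (hY.mono (h.regionSigma_le _) le_rfl).aestronglyMeasurable
    (hdev.mono (h.regionSigma_le _) le_rfl).aestronglyMeasurable, h.integral_voidDeviation hU,
    mul_zero]

theorem integral_mul_voidTest_eq_zero (h : IsPoissonProcess P η μ) (hU : MeasurableSet U)
    (hW : MeasurableSet W) (hUW : Disjoint U W) (hV : MeasurableSet[regionSigma η (U ∪ W)ᶜ] V)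
    {Y : Ω → ℝ} (hY : Measurable[regionSigma η Wᶜ] Y) :
    ∫ ω, Y ω * voidTest P η V U W ω ∂P = 0 := by
  have hWc : (U ∪ W)ᶜ ⊆ Wᶜ := Set.compl_subset_compl.2 Set.subset_union_right
  have hYV := @Measurable.mul _ _ _ _ _ (_) _ _ hY (measurable_indicator_mul_voidDeviation P
    (regionSigma_mono η hWc _ hV) hU hUW.subset_compl_right)
  rw [← h.integral_mul_voidDeviation hW hYV]
  exact integral_congr_ae (.of_forall fun ω => (mul_assoc (Y ω) _ _).symm)

theorem integrable_mul_voidTest (h : IsPoissonProcess P η μ) (hU : MeasurableSet U)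
    (hW : MeasurableSet W) (hV : MeasurableSet V) {Y : Ω → ℝ} (hY : Integrable Y P) :
    Integrable (fun ω => Y ω * voidTest P η V U W ω) P := by
  have hdev {A : Set X} (hA : MeasurableSet A) : Measurable (voidDeviation P η A) :=
    (measurable_voidDeviation P η hA subset_rfl).mono (h.regionSigma_le _) le_rfl
  have htest : Measurable (voidTest P η V U W) :=
    ((measurable_const.indicator hV).mul (hdev hU)).mul (hdev hW)
  exact hY.mul_bdd htest.aestronglyMeasurable
    (Filter.Eventually.of_forall (abs_voidTest_le η V U W))

section RegionFunctional

variable [SecondCountableTopology X] [BorelSpace X]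

theorem integral_mul_voidTest_eq (h : IsPoissonProcess P η μ) (hα : 0 ≤ α)
    (hμ : μ (Metric.ball o R) ≠ ⊤) (hU : MeasurableSet U) (hW : MeasurableSet W)
    (hUW : Disjoint U W) (hV : MeasurableSet[regionSigma η (U ∪ W)ᶜ] V) :
    ∫ ω, regionFunctional o α (Metric.ball o R) (η ω) * voidTest P η V U W ω ∂P =
      ∫ ω, secondDifference o α (Metric.ball o R) U W (η ω) * voidTest P η V U W ω ∂P := by
  let G (B : Set X) (ω : Ω) : ℝ :=
    regionFunctional o α (Metric.ball o R) (η ω ∩ B) * voidTest P η V U W ω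
  have hmeas {B : Set X} (hB : MeasurableSet B) :
      Measurable[regionSigma η B] fun ω => regionFunctional o α (Metric.ball o R) (η ω ∩ B) :=
    h.measurable_regionFunctional_inter α measurableSet_ball subset_rfl hB
  have hG {B : Set X} (hB : MeasurableSet B) : Integrable (G B) P :=
    h.integrable_mul_voidTest hU hW (h.regionSigma_le _ _ hV)
      (h.integrable_regionFunctional_inter hα hμ hB)
  have hzeroW : ∫ ω, G Wᶜ ω ∂P = 0 :=
    h.integral_mul_voidTest_eq_zero hU hW hUW hV (hmeas hW.compl)
  have hzeroU : ∫ ω, G Uᶜ ω ∂P = 0 := by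
    simp only [G, voidTest_comm P η V U W]
    exact h.integral_mul_voidTest_eq_zero hW hU hUW.symm (by rwa [Set.union_comm]) (hmeas hU.compl)
  have hzeroUW : ∫ ω, G (U ∪ W)ᶜ ω ∂P = 0 :=
    h.integral_mul_voidTest_eq_zero hU hW hUW hV ((hmeas (hU.union hW).compl).mono
      (regionSigma_mono η (Set.compl_subset_compl.2 Set.subset_union_right)) le_rfl)
  have hsplit : (fun ω => secondDifference o α (Metric.ball o R) U W (η ω) *
      voidTest P η V U W ω) = G Set.univ - G Wᶜ - G Uᶜ + G (U ∪ W)ᶜ := by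
    ext ω
    simp only [secondDifference, Pi.add_apply, Pi.sub_apply, G, Set.inter_univ]
    ring
  have hsub := (hG .univ).sub (hG hW.compl)
  rw [hsplit, integral_add' (hsub.sub (hG hU.compl)) (hG (hU.union hW).compl),
    integral_sub' hsub (hG hU.compl), integral_sub' (hG .univ) (hG hW.compl), hzeroW, hzeroU,
    hzeroUW]
  simp only [G, Set.inter_univ, sub_zero, add_zero]

theorem le_integral_mul_voidTest (h : IsPoissonProcess P η μ) (hα : 0 ≤ α)
    (hμ : μ (Metric.ball o R) ≠ ⊤) (hU : MeasurableSet U) (hW : MeasurableSet W)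
    (hUW : Disjoint U W) (hV : MeasurableSet[regionSigma η (U ∪ W)ᶜ] V) {g : ℝ}
    (hg : ∀ ω ∈ V, (η ω ∩ U).Nonempty → (η ω ∩ W).Nonempty →
      g ≤ secondDifference o α (Metric.ball o R) U W (η ω)) :
    g * (P.real {ω | η ω ∩ U = ∅} * P.real {ω | η ω ∩ W = ∅}) *
        P.real (V ∩ {ω | (η ω ∩ U).Nonempty} ∩ {ω | (η ω ∩ W).Nonempty}) ≤
      ∫ ω, regionFunctional o α (Metric.ball o R) (η ω) * voidTest P η V U W ω ∂P := by
  have hVm : MeasurableSet V := h.regionSigma_le _ _ hV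
  have hne {B : Set X} (hB : MeasurableSet B) : MeasurableSet {ω | (η ω ∩ B).Nonempty} :=
    h.regionSigma_le _ _ (measurableSet_nonempty_regionSigma η hB subset_rfl)
  have hgood := (hVm.inter (hne hU)).inter (hne hW)
  rw [h.integral_mul_voidTest_eq hα hμ hU hW hUW hV, mul_comm, ← smul_eq_mul,
    ← integral_indicator_const _ hgood]
  refine integral_mono ((integrable_const _).indicator hgood) (h.integrable_mul_voidTest hU hW hVm
    (h.integrable_secondDifference hα hμ hU hW)) fun ω => ?_
  dsimp only
  rcases (η ω ∩ U).eq_empty_or_nonempty with hu | hu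
  · rw [secondDifference_of_left_empty hu, zero_mul, Set.indicator_of_notMem]
    exact fun hω => hω.1.2.ne_empty hu
  rcases (η ω ∩ W).eq_empty_or_nonempty with hw | hw
  · rw [secondDifference_of_right_empty hw, zero_mul, Set.indicator_of_notMem]
    exact fun hω => hω.2.ne_empty hw
  by_cases hω : ω ∈ V
  · rw [Set.indicator_of_mem (Set.mem_inter (Set.mem_inter hω hu) hw),
      voidTest_of_mem hω hu hw]
    exact mul_le_mul_of_nonneg_right (hg ω hω hu hw) (by positivity)
  · rw [Set.indicator_of_notMem fun hc => hω hc.1.1, voidTest_of_notMem hω, mul_zero]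

end RegionFunctional

theorem measureReal_nonempty (h : IsPoissonProcess P η μ) (hB : MeasurableSet B) (hμ : μ B ≠ ⊤) :
    P.real {ω | (η ω ∩ B).Nonempty} = 1 - Real.exp (-(μ B).toReal) := by
  rw [setOf_inter_nonempty_eq_compl, probReal_compl_eq_one_sub (h.measurableSet_void hB),
    h.measureReal_void hB hμ]

theorem measureReal_void_inter_nonempty {ι : Type*} [Fintype ι] (h : IsPoissonProcess P η μ)
    {K : ι → Set X} {E : Set X} (hK : ∀ i, MeasurableSet (K i)) (hE : MeasurableSet E)
    (hKd : Pairwise fun i j => Disjoint (K i) (K j)) (hEd : Disjoint E (⋃ i, K i)) :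
    P.real ({ω | η ω ∩ E = ∅} ∩ ⋂ i, {ω | (η ω ∩ K i).Nonempty}) =
      P.real {ω | η ω ∩ E = ∅} * ∏ i, P.real {ω | (η ω ∩ K i).Nonempty} := by
  have hindep := (Indep_iff _ _ P).1 (h.indep_regionSigma hE (MeasurableSet.iUnion hK) hEd)
    {ω | η ω ∩ E = ∅} (⋂ i, {ω | (η ω ∩ K i).Nonempty})
    (measurableSet_void_regionSigma η hE subset_rfl)
    (@MeasurableSet.iInter _ _ (_) _ _ fun i =>
      measurableSet_nonempty_regionSigma η (hK i) (Set.subset_iUnion K i))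
  rw [measureReal_def, hindep, ENNReal.toReal_mul, ← measureReal_def, ← measureReal_def,
    h.measureReal_iInter_nonempty hK hKd]

end IsPoissonProcess

theorem card_mul_sq_le_variance {Ω ι : Type*} [MeasurableSpace Ω] {P : Measure Ω}
    [IsProbabilityMeasure P] {F : Ω → ℝ} (hF : MemLp F 2 P) {T : Finset ι} {H : ι → Ω → ℝ}
    (hm : ∀ i ∈ T, Measurable (H i)) (h1 : ∀ i ∈ T, ∀ ω, |H i ω| ≤ 1)
    (h0 : ∀ i ∈ T, ∫ ω, H i ω ∂P = 0)
    (hind : (T : Set ι).Pairwise fun i j => IndepFun (H i) (H j) P) {e : ℝ} (he : 0 ≤ e)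
    (hcov : ∀ i ∈ T, e ≤ ∫ ω, F ω * H i ω ∂P) : T.card * e ^ 2 ≤ Var[F; P] := by
  have hmem : ∀ i ∈ T, MemLp (H i) 2 P := fun i hi =>
    MemLp.of_bound (hm i hi).aestronglyMeasurable 1 (Filter.Eventually.of_forall (h1 i hi))
  have hsum : MemLp (∑ i ∈ T, H i) 2 P := memLp_finsetSum' _ hmem
  have hvar : Var[∑ i ∈ T, H i; P] ≤ T.card := by
    rw [IndepFun.variance_sum hmem hind, ← nsmul_one, ← Finset.sum_const]
    refine Finset.sum_le_sum fun i hi => ?_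
    calc Var[H i; P] ≤ ∫ ω, (H i ^ 2) ω ∂P :=
          variance_le_expectation_sq (hm i hi).aestronglyMeasurable
      _ ≤ ∫ _ω, (1 : ℝ) ∂P := integral_mono (hmem i hi).integrable_sq (integrable_const _)
          fun ω => (sq_le_one_iff_abs_le_one _).2 (h1 i hi ω)
      _ = 1 := by rw [integral_const, probReal_univ, one_smul]
  have hcovsum : T.card * e ≤ cov[F, ∑ i ∈ T, H i; P] := by
    rw [covariance_sum_right' hmem hF, ← nsmul_eq_mul, ← Finset.sum_const]
    refine Finset.sum_le_sum fun i hi => ?_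
    rw [covariance_eq_sub hF (hmem i hi), h0 i hi, mul_zero, sub_zero]
    exact hcov i hi
  -- `0 ≤ Var[F - e ∑ H i]`, where `e` is the optimal coefficient for these bounds
  have hdiff := variance_nonneg (fun ω => F ω - (e • ∑ i ∈ T, H i) ω) P
  rw [variance_fun_sub hF (hsum.const_smul e), covariance_smul_right, variance_smul] at hdiff
  nlinarith [mul_le_mul_of_nonneg_left hcovsum he, mul_le_mul_of_nonneg_left hvar (sq_nonneg e)]

namespace HypSpace

variable {d : ℕ} [NeZero d] {o x z t u w : HypSpace d} {γ ρ α R : ℝ}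

section ForkTest

variable {Ω : Type*} {η : Ω → Set (HypSpace d)} {B : Set (HypSpace d)}

/-- The event that the clusters at `t` and `z` of a fork are occupied and its gap is empty. -/
def forkEvent (η : Ω → Set (HypSpace d)) (z t u w : HypSpace d) (ρ : ℝ) : Set Ω :=
  {ω | η ω ∩ forkGap z t u w ρ = ∅} ∩
    ({ω | (η ω ∩ cluster t ρ).Nonempty} ∩ {ω | (η ω ∩ cluster z ρ).Nonempty})

theorem measurableSet_forkGap (z t u w : HypSpace d) (ρ : ℝ) :
    MeasurableSet (forkGap z t u w ρ) :=
  measurableSet_ball.diff (((measurableSet_cluster u ρ).union (measurableSet_cluster w ρ)).union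
    ((measurableSet_cluster t ρ).union (measurableSet_cluster z ρ)))

theorem measurableSet_forkEvent (hgap : forkGap z t u w ρ ⊆ B) (ht : cluster t ρ ⊆ B)
    (hz : cluster z ρ ⊆ B) : MeasurableSet[regionSigma η B] (forkEvent η z t u w ρ) :=
  @MeasurableSet.inter _ (_) _ _
    (measurableSet_void_regionSigma η (measurableSet_forkGap z t u w ρ) hgap)
    (@MeasurableSet.inter _ (_) _ _
      (measurableSet_nonempty_regionSigma η (measurableSet_cluster t ρ) ht)
      (measurableSet_nonempty_regionSigma η (measurableSet_cluster z ρ) hz))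

namespace IsFork

theorem cluster_subset (h : IsFork o z t u w ρ) (hx : dist x z ≤ 6 / 5 * ρ) :
    cluster x ρ ⊆ Metric.ball z (2 * ρ) :=
  Metric.ball_subset_ball' (by linarith [h.pos])

theorem cluster_u_subset (h : IsFork o z t u w ρ) : cluster u ρ ⊆ Metric.ball z (2 * ρ) :=
  h.cluster_subset (by linarith [h.dist_u, h.pos])

theorem cluster_t_subset (h : IsFork o z t u w ρ) : cluster t ρ ⊆ Metric.ball z (2 * ρ) :=
  h.cluster_subset h.dist_t.le

theorem cluster_z_subset (h : IsFork o z t u w ρ) : cluster z ρ ⊆ Metric.ball z (2 * ρ) :=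
  h.cluster_subset (by linarith [dist_self z, h.pos])

theorem pairwise_disjoint (h : IsFork o z t u w ρ) :
    Pairwise fun i j : Fin 4 => Disjoint (cluster (![u, w, t, z] i) ρ)
      (cluster (![u, w, t, z] j) ρ) := by
  have huw := h.disjoint_uw
  have hut := h.disjoint_ut
  have huz := h.disjoint_uz
  have hwt := h.swap.disjoint_ut
  have hwz := h.swap.disjoint_uz
  have htz := h.disjoint_tz
  intro i j
  revert i j
  simp [Fin.forall_fin_succ, huw, hut, huz, hwt, hwz, htz, huw.symm, hut.symm, huz.symm, hwt.symm,
    hwz.symm, htz.symm]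

theorem measurableSet_forkEvent_compl (h : IsFork o z t u w ρ) :
    MeasurableSet[regionSigma η (cluster u ρ ∪ cluster w ρ)ᶜ] (forkEvent η z t u w ρ) :=
  measurableSet_forkEvent (fun _ hy hc => hy.2 (Or.inl hc))
    (Set.disjoint_union_right.2 ⟨h.disjoint_ut.symm, h.swap.disjoint_ut.symm⟩).subset_compl_right
    (Set.disjoint_union_right.2 ⟨h.disjoint_uz.symm, h.swap.disjoint_uz.symm⟩).subset_compl_right

end IsFork

theorem disjoint_forkGap_cluster (z t u w : HypSpace d) (ρ : ℝ) (i : Fin 4) :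
    Disjoint (forkGap z t u w ρ) (cluster (![u, w, t, z] i) ρ) := by
  refine Set.disjoint_sdiff_left.mono_right ?_
  fin_cases i
  exacts [fun y hy => Or.inl (Or.inl hy), fun y hy => Or.inl (Or.inr hy),
    fun y hy => Or.inr (Or.inl hy), fun y hy => Or.inr (Or.inr hy)]

theorem forkEvent_inter_nonempty_eq (η : Ω → Set (HypSpace d)) (z t u w : HypSpace d) (ρ : ℝ) :
    forkEvent η z t u w ρ ∩ {ω | (η ω ∩ cluster u ρ).Nonempty} ∩
        {ω | (η ω ∩ cluster w ρ).Nonempty} =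
      {ω | η ω ∩ forkGap z t u w ρ = ∅} ∩
        ⋂ i, {ω | (η ω ∩ cluster (![u, w, t, z] i) ρ).Nonempty} := by
  ext ω
  simp only [forkEvent, Set.mem_inter_iff, Set.mem_iInter, Fin.forall_fin_succ, Set.mem_ofPred_eq]
  simp only [Fin.isValue, Matrix.cons_val_zero, Fin.succ_zero_eq_one, Matrix.cons_val_one,
    Fin.succ_one_eq_two, Matrix.cons_val, Fin.reduceSucc, IsEmpty.forall_iff, and_true]
  tauto

variable [MeasurableSpace Ω] {P : Measure Ω}

/-- The test function attached to a fork: a bounded centred function of the process near `z` that is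
positively correlated with the edge-length functional. -/
def forkTest (P : Measure Ω) (η : Ω → Set (HypSpace d)) (z t u w : HypSpace d) (ρ : ℝ) : Ω → ℝ :=
  voidTest P η (forkEvent η z t u w ρ) (cluster u ρ) (cluster w ρ)

theorem IsFork.measurable_forkTest (P : Measure Ω) (η : Ω → Set (HypSpace d))
    (h : IsFork o z t u w ρ) :
    Measurable[regionSigma η (Metric.ball z (2 * ρ))] (forkTest P η z t u w ρ) :=
  measurable_voidTest P
    (measurableSet_forkEvent Set.sdiff_subset h.cluster_t_subset h.cluster_z_subset)
    (measurableSet_cluster u ρ) h.cluster_u_subset (measurableSet_cluster w ρ)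
    h.swap.cluster_u_subset

/-- Lower bound for the probability that the gap, or one of the clusters, of a fork is empty, when
`γ * ρ ^ d = β`. -/
def voidProbBound (d : ℕ) (β : ℝ) : ℝ :=
  Real.exp (-(unitBallVolume d * β * (2 * Real.exp (2 * 2)) ^ d))

/-- Lower bound for the probability that a cluster of a fork is occupied, when `γ * ρ ^ d = β`. -/
def occupiedProbBound (d : ℕ) (β : ℝ) : ℝ :=
  1 - Real.exp (-(volumeGrowth d * β * (1 / 100) ^ d))

theorem occupiedProbBound_pos (d : ℕ) {β : ℝ} (hβ : 0 < β) : 0 < occupiedProbBound d β := by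
  have := volumeGrowth_pos d
  exact sub_pos.2 (Real.exp_lt_one_iff.2 (neg_lt_zero.2 (by positivity)))

theorem voidProbBound_le (hη : IsPoissonProcess P η (ENNReal.ofReal γ • hypVolume d)) (hγ : 0 ≤ γ)
    (hρ : 0 ≤ ρ) (hρ1 : ρ ≤ 1) (hB : MeasurableSet B) (hBz : B ⊆ Metric.ball z (2 * ρ)) :
    voidProbBound d (γ * ρ ^ d) ≤ P.real {ω | η ω ∩ B = ∅} := by
  have hball := hypIntensity_ball_ne_top γ z (2 * ρ)
  rw [hη.measureReal_void hB (ne_top_of_le_ne_top hball (measure_mono hBz)), voidProbBound]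
  gcongr
  exact (ENNReal.toReal_mono hball (measure_mono hBz)).trans
    (toReal_hypIntensity_ball_le hγ hρ hρ1 z zero_le_two)

variable [IsProbabilityMeasure P]

theorem occupiedProbBound_le (hd : 2 ≤ d)
    (hη : IsPoissonProcess P η (ENNReal.ofReal γ • hypVolume d)) (hγ : 0 ≤ γ) (hρ : 0 ≤ ρ)
    (x : HypSpace d) :
    occupiedProbBound d (γ * ρ ^ d) ≤ P.real {ω | (η ω ∩ cluster x ρ).Nonempty} := by
  rw [hη.measureReal_nonempty (measurableSet_cluster x ρ) (hypIntensity_ball_ne_top γ x _),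
    occupiedProbBound, cluster, show ρ / 100 = 1 / 100 * ρ by ring]
  gcongr
  exact le_toReal_hypIntensity_ball hd hγ hρ x (by norm_num)

namespace IsFork

theorem integral_forkTest (h : IsFork o z t u w ρ) {μ : Measure (HypSpace d)}
    (hη : IsPoissonProcess P η μ) : ∫ ω, forkTest P η z t u w ρ ω ∂P = 0 := by
  have hzero := hη.integral_mul_voidTest_eq_zero (measurableSet_cluster u ρ)
    (measurableSet_cluster w ρ) h.disjoint_uw h.measurableSet_forkEvent_compl
    (Y := 1) (@measurable_const _ _ _ (_) _)
  simpa only [Pi.one_apply, one_mul, forkTest] using hzero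

theorem le_measureReal_forkEvent (h : IsFork o z t u w ρ) (hd : 2 ≤ d)
    (hη : IsPoissonProcess P η (ENNReal.ofReal γ • hypVolume d)) (hγ : 0 < γ) (hρ1 : ρ ≤ 1) :
    voidProbBound d (γ * ρ ^ d) * occupiedProbBound d (γ * ρ ^ d) ^ 4 ≤
      P.real (forkEvent η z t u w ρ ∩ {ω | (η ω ∩ cluster u ρ).Nonempty} ∩
        {ω | (η ω ∩ cluster w ρ).Nonempty}) := by
  have hρ := h.pos
  have hgap := measurableSet_forkGap z t u w ρ
  have hocc := occupiedProbBound_pos d (β := γ * ρ ^ d) (by positivity)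
  rw [forkEvent_inter_nonempty_eq, hη.measureReal_void_inter_nonempty
    (fun i => measurableSet_cluster _ ρ) hgap h.pairwise_disjoint
    (Set.disjoint_iUnion_right.2 (disjoint_forkGap_cluster z t u w ρ))]
  gcongr
  · exact voidProbBound_le hη hγ.le hρ.le hρ1 hgap Set.sdiff_subset
  · simpa only [Finset.prod_const, Finset.card_univ, Fintype.card_fin] using
      Finset.prod_le_prod (s := Finset.univ) (fun _ _ => hocc.le)
        fun i _ => occupiedProbBound_le hd hη hγ.le hρ.le (![u, w, t, z] i)

end IsFork

/-- Lower bound for the correlation between the edge-length functional and a fork test function, in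
units of `ρ ^ α`, when `γ * ρ ^ d = β`. -/
def forkCorrelation (d : ℕ) (α β : ℝ) : ℝ :=
  ((23 / 20) ^ α - (21 / 20) ^ α) * (voidProbBound d β ^ 3 * occupiedProbBound d β ^ 4)

theorem forkCorrelation_pos (d : ℕ) {β : ℝ} (hα : 0 < α) (hβ : 0 < β) :
    0 < forkCorrelation d α β := by
  have hpow : (21 / 20 : ℝ) ^ α < (23 / 20) ^ α :=
    Real.rpow_lt_rpow (by norm_num) (by norm_num) hα
  exact mul_pos (sub_pos.2 hpow)
    (mul_pos (pow_pos (Real.exp_pos _) 3) (pow_pos (occupiedProbBound_pos d hβ) 4))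

theorem IsFork.forkCorrelation_mul_rpow_le (h : IsFork o z t u w ρ) (hd : 2 ≤ d)
    (hη : IsPoissonProcess P η (ENNReal.ofReal γ • hypVolume d)) (hα : 0 ≤ α) (hγ : 0 < γ)
    (hρ1 : ρ ≤ 1) (hzR : cluster z ρ ⊆ Metric.ball o R) :
    forkCorrelation d α (γ * ρ ^ d) * ρ ^ α ≤
      ∫ ω, edgeLengthFunctional o α R (η ω) * forkTest P η z t u w ρ ω ∂P := by
  have hρ := h.pos
  have hu := measurableSet_cluster u ρ
  have hw := measurableSet_cluster w ρ
  have hg : 0 ≤ (23 / 20 * ρ) ^ α - (21 / 20 * ρ) ^ α :=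
    sub_nonneg.2 (Real.rpow_le_rpow (by positivity) (by linarith) hα)
  have hvoid : 0 < voidProbBound d (γ * ρ ^ d) := Real.exp_pos _
  have hocc := occupiedProbBound_pos d (β := γ * ρ ^ d) (by positivity)
  calc forkCorrelation d α (γ * ρ ^ d) * ρ ^ α
      = ((23 / 20 * ρ) ^ α - (21 / 20 * ρ) ^ α) *
          (voidProbBound d (γ * ρ ^ d) * voidProbBound d (γ * ρ ^ d)) *
          (voidProbBound d (γ * ρ ^ d) * occupiedProbBound d (γ * ρ ^ d) ^ 4) := by
        rw [forkCorrelation, Real.mul_rpow (by norm_num) hρ.le, Real.mul_rpow (by norm_num) hρ.le]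
        ring
    _ ≤ ((23 / 20 * ρ) ^ α - (21 / 20 * ρ) ^ α) *
          (P.real {ω | η ω ∩ cluster u ρ = ∅} * P.real {ω | η ω ∩ cluster w ρ = ∅}) *
          P.real (forkEvent η z t u w ρ ∩ {ω | (η ω ∩ cluster u ρ).Nonempty} ∩
            {ω | (η ω ∩ cluster w ρ).Nonempty}) := by
        gcongr
        · exact voidProbBound_le hη hγ.le hρ.le hρ1 hu h.cluster_u_subset
        · exact voidProbBound_le hη hγ.le hρ.le hρ1 hw h.swap.cluster_u_subset
        · exact h.le_measureReal_forkEvent hd hη hγ hρ1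
    _ ≤ _ := hη.le_integral_mul_voidTest hα (hypIntensity_ball_ne_top γ o R) hu hw h.disjoint_uw
        h.measurableSet_forkEvent_compl fun ω hω hu hw => h.le_secondDifference hα
          (hη.finite_inter_ball o ω) (hη.finite_inter_ball o ω R) hzR hu hw hω.2.1 hω.2.2 hω.1

end ForkTest

section LowerBound

theorem exists_dist_le_of_mem_ball (hρ : 0 ≤ ρ) (hR : 8 * ρ ≤ R) (hx : x ∈ Metric.ball o R) :
    ∃ a, 4 * ρ ≤ dist o a ∧ dist o a ≤ R - 2 * ρ ∧ dist x a ≤ 8 * ρ := by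
  rw [Metric.mem_ball, dist_comm] at hx
  rcases lt_or_ge (dist o x) (4 * ρ) with hnear | hfar
  · obtain ⟨a, ha⟩ := exists_dist_eq o (show 0 ≤ 4 * ρ by positivity)
    rw [dist_comm] at ha
    exact ⟨a, ha.ge, by linarith, by linarith [dist_triangle x o a, dist_comm x o]⟩
  rcases le_or_gt (dist o x) (R - 2 * ρ) with hle | hgt
  · exact ⟨x, hfar, hle, by rw [dist_self]; positivity⟩
  · have hroot := dist_root_towards (show 0 ≤ 2 * ρ by positivity) (by linarith : 2 * ρ ≤ dist o x)
    have hstep := dist_towards o x (show 0 ≤ 2 * ρ by positivity)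
    exact ⟨towards o x (2 * ρ), by linarith, by linarith, by rw [dist_comm]; linarith⟩

theorem ballVolume_le_card_mul (hρ : 0 ≤ ρ) (hρ1 : ρ ≤ 1) (hR : 8 * ρ ≤ R)
    {T : Finset (HypSpace d)}
    (hT : IsSeparatedNet (4 * ρ) {x | 4 * ρ ≤ dist o x ∧ dist o x ≤ R - 2 * ρ} T) :
    ballVolume o R ≤ T.card * (unitBallVolume d * (12 * Real.exp 24) ^ d * ρ ^ d) := by
  have hcover : Metric.ball o R ⊆ ⋃ y ∈ T, Metric.ball y (12 * ρ) := fun x hx => by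
    obtain ⟨a, ha, ha', hxa⟩ := exists_dist_le_of_mem_ball hρ hR hx
    obtain ⟨y, hy, hay⟩ := hT.exists_dist_lt a ⟨ha, ha'⟩
    exact Set.mem_biUnion (Finset.mem_coe.2 hy)
      (Metric.mem_ball.2 (by linarith [dist_triangle x a y]))
  have hball (y : HypSpace d) : (hypVolume d).real (Metric.ball y (12 * ρ)) ≤
      unitBallVolume d * (12 * Real.exp 24) ^ d * ρ ^ d := by
    have h := toReal_hypIntensity_ball_le zero_le_one hρ hρ1 y (s := 12) (by norm_num)
    rw [ENNReal.ofReal_one, one_smul, one_mul] at h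
    refine h.trans_eq ?_
    norm_num1
    ring
  calc ballVolume o R ≤ (hypVolume d).real (⋃ y ∈ T, Metric.ball y (12 * ρ)) :=
        measureReal_mono hcover ((measure_biUnion_lt_top T.finite_toSet fun y _ =>
          hypVolume_ball_lt_top y _).ne)
    _ ≤ ∑ y ∈ T, (hypVolume d).real (Metric.ball y (12 * ρ)) := measureReal_biUnion_finset_le _ _
    _ ≤ _ := by
        rw [← nsmul_eq_mul, ← Finset.sum_const]
        exact Finset.sum_le_sum fun y _ => hball y

/-- The constant in the lower bound for the variance, for a process with `γ * ρ ^ d = β`. -/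
def varianceLowerConst (d : ℕ) (α β : ℝ) : ℝ :=
  forkCorrelation d α β ^ 2 / (unitBallVolume d * (12 * Real.exp 24) ^ d)

theorem varianceLowerConst_pos (d : ℕ) {β : ℝ} (hα : 0 < α) (hβ : 0 < β) :
    0 < varianceLowerConst d α β := by
  have := forkCorrelation_pos d hα hβ
  have := unitBallVolume_pos d
  unfold varianceLowerConst
  positivity

variable {Ω : Type*} [MeasurableSpace Ω] {P : Measure Ω} [IsProbabilityMeasure P]
  {η : Ω → Set (HypSpace d)}

theorem card_mul_sq_forkCorrelation_le_variance (hd : 2 ≤ d)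
    (hη : IsPoissonProcess P η (ENNReal.ofReal γ • hypVolume d)) (hα : 0 < α) (hγ : 0 < γ)
    (hρ : 0 < ρ) (hρ1 : ρ ≤ 1 / 2) {T : Finset (HypSpace d)}
    (hT : IsSeparatedNet (4 * ρ) {x | 4 * ρ ≤ dist o x ∧ dist o x ≤ R - 2 * ρ} T) :
    T.card * (forkCorrelation d α (γ * ρ ^ d) * ρ ^ α) ^ 2 ≤
      Var[fun ω => edgeLengthFunctional o α R (η ω); P] := by
  have hfork (z : HypSpace d) (hz : z ∈ T) : ∃ t u w, IsFork o z t u w ρ :=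
    exists_isFork hd o z hρ hρ1 (hT.subset hz).1
  choose! t u w h using hfork
  have hcorr := forkCorrelation_pos d hα (show 0 < γ * ρ ^ d by positivity)
  have hmeas (z : HypSpace d) (hz : z ∈ T) := (h z hz).measurable_forkTest P η
  refine card_mul_sq_le_variance (memLp_edgeLengthFunctional hd hη hα.le hγ o R)
    (H := fun z => forkTest P η z (t z) (u z) (w z) ρ)
    (fun z hz => (hmeas z hz).mono (hη.regionSigma_le _) le_rfl)
    (fun z _ => abs_voidTest_le _ _ _ _) (fun z hz => (h z hz).integral_forkTest hη)
    (fun x hx y hy hxy => hη.indepFun_of_regionSigma measurableSet_ball measurableSet_ball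
      (Metric.ball_disjoint_ball (by linarith [hT.separated hx hy hxy])) (hmeas x hx) (hmeas y hy))
    (by positivity)
    (fun z hz => (h z hz).forkCorrelation_mul_rpow_le hd hη hα.le hγ (by linarith) ?_)
  exact Metric.ball_subset_ball' (by linarith [(hT.subset hz).2, dist_comm o z])

theorem le_variance_edgeLengthFunctional (hd : 2 ≤ d)
    (hη : IsPoissonProcess P η (ENNReal.ofReal γ • hypVolume d)) (hα : 0 < α) (hγ : 0 < γ)
    (hρ : 0 < ρ) (hρ1 : ρ ≤ 1 / 2) (hR : 8 * ρ ≤ R) (o : HypSpace d) :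
    varianceLowerConst d α (γ * ρ ^ d) * (ρ ^ (2 * α) / ρ ^ d) * ballVolume o R ≤
      Var[fun ω => edgeLengthFunctional o α R (η ω); P] := by
  obtain ⟨T, hT⟩ := exists_isSeparatedNet_of_subset_ball hd (show 0 < 4 * ρ by positivity) (o := o)
    (A := {x | 4 * ρ ≤ dist o x ∧ dist o x ≤ R - 2 * ρ}) fun x hx => by
      rw [Metric.mem_ball, dist_comm]
      linarith [hx.2]
  have hconst := varianceLowerConst_pos d hα (show 0 < γ * ρ ^ d by positivity)
  have hunit := unitBallVolume_pos d
  have hpow : (ρ ^ α) ^ 2 = ρ ^ (2 * α) := by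
    rw [mul_comm, Real.rpow_mul hρ.le, Real.rpow_two]
  calc varianceLowerConst d α (γ * ρ ^ d) * (ρ ^ (2 * α) / ρ ^ d) * ballVolume o R
      ≤ varianceLowerConst d α (γ * ρ ^ d) * (ρ ^ (2 * α) / ρ ^ d) *
          (T.card * (unitBallVolume d * (12 * Real.exp 24) ^ d * ρ ^ d)) := by
        gcongr
        exact ballVolume_le_card_mul hρ.le (by linarith) hR hT
    _ = T.card * (forkCorrelation d α (γ * ρ ^ d) * ρ ^ α) ^ 2 := by
        rw [varianceLowerConst, mul_pow (forkCorrelation _ _ _), hpow]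
        field_simp
    _ ≤ _ := card_mul_sq_forkCorrelation_le_variance hd hη hα hγ hρ hρ1 hT

end LowerBound

theorem exists_scale {c γ : ℝ} (d : ℕ) [NeZero d] (α : ℝ) (hc : 0 < c) (hγ : c ≤ γ) :
    ∃ ρ : ℝ, 0 < ρ ∧ ρ ≤ 1 / 2 ∧ γ * ρ ^ d = c * (1 / 2) ^ d ∧
      ρ ^ (2 * α) / ρ ^ d =
        (c * (1 / 2) ^ d) ^ (2 * α / (d : ℝ) - 1) * γ ^ (1 - 2 * α / (d : ℝ)) := by
  have hγ0 : 0 < γ := hc.trans_le hγ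
  have hd : d ≠ 0 := NeZero.ne d
  obtain ⟨β, hβ⟩ : ∃ β, β = c * (1 / 2) ^ d := ⟨_, rfl⟩
  have hβ0 : 0 < β := by rw [hβ]; positivity
  have hpow : ((β / γ) ^ (1 / (d : ℝ))) ^ d = β / γ := by
    rw [one_div, Real.rpow_inv_natCast_pow (by positivity) hd]
  rw [← hβ]
  refine ⟨(β / γ) ^ (1 / (d : ℝ)), by positivity, ?_, ?_, ?_⟩
  · refine le_of_pow_le_pow_left₀ hd (by norm_num) ?_
    rw [hpow, div_le_iff₀ hγ0, hβ, mul_comm]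
    gcongr
  · rw [hpow, mul_div_cancel₀ _ hγ0.ne']
  · rw [hpow, ← Real.rpow_mul (by positivity), show 1 / (d : ℝ) * (2 * α) = 2 * α / d by ring,
      ← Real.rpow_sub_one (by positivity), Real.div_rpow hβ0.le hγ0.le, div_eq_mul_inv,
      ← Real.rpow_neg hγ0.le, neg_sub]

end HypSpace

end

theorem proposition8p5 (d : ℕ) [NeZero d] (hd : 2 ≤ d) (α : ℝ) (hα : 0 < α) (c₀ : ℝ)
    (hc₀ : 0 < c₀) :
    ∃ cl cu r₀ : ℝ, 0 < cl ∧ 0 < cu ∧ 0 < r₀ ∧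
      ∀ (o : HypSpace d) (γ R : ℝ), c₀ ≤ γ → r₀ ≤ R →
        ∀ (Ω : Type*) [MeasurableSpace Ω] (P : Measure Ω) [IsProbabilityMeasure P]
          (η : Ω → Set (HypSpace d)),
          IsPoissonProcess P η (ENNReal.ofReal γ • HypSpace.hypVolume d) →
          MemLp (fun ω => edgeLengthFunctional o α R (η ω)) 2 P ∧
          cl * γ ^ (1 - 2 * α / (d : ℝ)) * HypSpace.ballVolume o R ≤
            Var[fun ω => edgeLengthFunctional o α R (η ω); P] ∧
          Var[fun ω => edgeLengthFunctional o α R (η ω); P] ≤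
            cu * γ ^ (1 - 2 * α / (d : ℝ)) * HypSpace.ballVolume o R := by
  obtain ⟨β, hβ⟩ : ∃ β, β = c₀ * (1 / 2) ^ d := ⟨_, rfl⟩
  have hβ0 : 0 < β := by rw [hβ]; positivity
  have hscale0 : 0 < β ^ (2 * α / (d : ℝ) - 1) := Real.rpow_pos_of_pos hβ0 _
  refine ⟨HypSpace.varianceLowerConst d α β * β ^ (2 * α / (d : ℝ) - 1),
    HypSpace.varianceUpperConst d α β * β ^ (2 * α / (d : ℝ) - 1), 4,
    mul_pos (HypSpace.varianceLowerConst_pos d hα hβ0) hscale0,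
    mul_pos (HypSpace.varianceUpperConst_pos d hα.le hβ0) hscale0, four_pos, ?_⟩
  intro o γ R hγ hR Ω _ P _ η hη
  have hγ0 : 0 < γ := hc₀.trans_le hγ
  obtain ⟨ρ, hρ, hρ1, hγρ, hscale⟩ := HypSpace.exists_scale d α hc₀ hγ
  have lower := HypSpace.le_variance_edgeLengthFunctional hd hη hα hγ0 hρ hρ1
    (by linarith : 8 * ρ ≤ R) o
  have upper := HypSpace.variance_edgeLengthFunctional_le hd hη hα.le hγ0 hρ (by linarith)
    (by linarith : ρ ≤ 2 * R) o
  rw [hγρ, hscale, ← hβ, ← mul_assoc] at lower upper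
  exact ⟨HypSpace.memLp_edgeLengthFunctional hd hη hα.le hγ0 o R, lower, upper⟩
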